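/- **Model.** *RF hop.* Let $L\ge 1$ be an integer, $\kappa,\mu,\alpha,\varrho,D>0$. Let $h_1,\dots,h_L$ be i.i.d. $\kappa$-$\mu$ envelopes, with density on $(0,\infty)$ $$f_h(x)=\frac{2\mu(1+\kappa)^{\frac{\mu+1}{2}}}{\kappa^{\frac{\mu-1}{2}}e^{\mu\kappa}}\,x^{\mu}e^{-\mu(1+\kappa)x^2}\,I_{\mu-1}\!\left(2\mu\sqrt{\kappa(1+\kappa)}\,x\right),$$ where $I_v$ is the modified Bessel function of the first kind, and let $q$, independent of them, have the random-waypoint density $f_q(x)=\sum_{i=1}^{3}\frac{C_i}{D^{\beta_i+1}}x^{\beta_i}$ on $[0,D]$, with $C=\frac1{72}(735,-1190,455)$, $\beta=(2,4,6)$. For average SNR $\bar\gamma>0$ put $\gamma_R=\sum_{l=1}^{L}\varrho|h_l|^2q^{-\alpha}\bar\gamma$. *UOWC hop.* Let $N\ge1$ be an integer and $r\in\{1,2\}$. The gains of the relay–RIS and RIS–destination links are independent products of a mixture exponential-generalized gamma (mEGG) variable with density $$\frac{\omega}{\nu}e^{-x/\nu}+(1-\omega)\frac{c\,x^{ac-1}}{b^{ac}\Gamma(a)}e^{-(x/b)^c}\qquad(x>0)$$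 and an independent pointing-error factor with density $\xi^2x^{\xi^2-1}/J^{\xi^2}$ on $(0,J)$, where $0<\omega<1$ and $\nu,a,b,c,\xi,J>0$ may differ between the two links. Let $Y$ be the product of the two gains, $S$ the sum of $N$ independent copies of $Y$, $\rho=\mathbb E(S)^2/\mathrm{Var}(S)$, $w=\mathrm{Var}(S)/\mathbb E(S)$. The gamma approximation replaces $S$ by a variable $\chi$ with gamma law of shape $\rho$ and scale $w$. For electrical SNR $\tau>0$ put $\gamma_{\mathcal D}=\tau\,(\chi/\mathbb E Y)^r$; $\chi$ is independent of $(h_1,\dots,h_L,q)$. Under the min-SNR approximation the end-to-end SNR is $\gamma_{eq}=\min\{\gamma_R,\gamma_{\mathcal D}\}$. Write $F_{\gamma_R},F_{\gamma_{\mathcal D}},F_{\gamma_{eq}}$ for the CDFs. **Bessel approximation.** For $p\ge1$ let $$I_v^{(p)}(x)=\sum_{k=0}^pV(k,p,v)\left(\tfrac x2\right)^{v+2k},\qquad V(k,p,v)=\frac{\Gamma(p+k)\,p^{1-2k}}{\Gamma(k+1)\Gamma(p-k+1)\Gamma(v+k+1)}.$$ For a function $\mathcal I_v(x)$ let $$F_{R}[\mathcal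 I](\gamma)=\int_0^D f_q(s)\int_0^{\sqrt{\gamma s^\alpha/(\varrho L\bar\gamma)}}f_{\mathcal I}(x)\,dx\,ds,$$ $f_{\mathcal I}$ being the $\kappa$-$\mu$ density above with $\mu$ replaced by $L\mu$ and $I$ by $\mathcal I$. Put $F_R^{(p)}=F_R[I^{(p)}]$. **Constants.** $$\Psi_i=\frac{\beta_i+1}{\alpha},\quad K_{1}=\frac{C_i\,V(k,p,L\mu-1)(L\mu\kappa)^k}{\alpha e^{L\mu\kappa}},\quad K_2=\frac{L\mu(1+\kappa)D^\alpha}{\varrho L\bar\gamma},$$ $$\Upsilon_3=\frac{(\mathbb EY)^\rho}{\sqrt r\,\Gamma(\rho)w^\rho\tau^{\rho/r}(2\pi)^{\frac{r-1}2}},\quad \Upsilon_4=\frac{(\mathbb EY)^r}{r^rw^r\tau}.$$ Let $G$ be Meijer's $G$-function, $\mathbf b=(0,-\rho)$ if $r=1$, $\mathbf b=(0,\tfrac12,-\tfrac\rho2)$ if $r=2$, and $T_j=1-b_j$ for $1\le j\le r+1$. Put $$G_R^{(p)}(\gamma)=\sum_{i=1}^3\sum_{k=0}^pK_1\,G^{1,2}_{2,3}\!\left[K_2\gamma\,\middle|\,{1-\Psi_i,\,1\atop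 L\mu+k,\,0,\,-\Psi_i}\right],\qquad G_{\mathcal D}(\gamma)=\Upsilon_3\gamma^{\rho/r}\,G^{r,1}_{1,r+1}\!\left[\Upsilon_4\gamma\,\middle|\,{1-\frac\rho r\atop \mathbf b}\right],$$ $$F_R^{\infty,p}(\gamma)=\sum_{i=1}^3\sum_{k=0}^pK_1(K_2\gamma)^{L\mu+k}\frac{\Gamma(\Psi_i+L\mu+k)\Gamma(L\mu+k)}{\Gamma(1+L\mu+k)\Gamma(1+\Psi_i+L\mu+k)},$$ $$F_{\mathcal D}^\infty(\gamma)=\Upsilon_3\gamma^{\rho/r}\sum_{k=1}^r\left(\frac1{\Upsilon_4\gamma}\right)^{T_k-1}\frac{\prod_{l=1,\,l\ne k}^r\Gamma(T_k-T_l)\;\Gamma(1+\frac\rho r-T_k)}{\Gamma(1+T_{r+1}-T_k)}.$$ **Statement.** For every $\gamma>0$: 1. For all $\bar\gamma,\tau>0$, $F_{\gamma_{eq}}(\gamma)=F_{\gamma_R}(\gamma)+F_{\gamma_{\mathcal D}}(\gamma)-F_{\gamma_R}(\gamma)F_{\gamma_{\mathcal D}}(\gamma)$, and $F_{\gamma_R}(\gamma)=F_R[I](\gamma)$.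 2. For all $\bar\gamma,\tau>0$ and $p\ge1$, $F_{\gamma_{\mathcal D}}(\gamma)=G_{\mathcal D}(\gamma)$ and $F_R^{(p)}(\gamma)=G_R^{(p)}(\gamma)$, and the end-to-end CDF with the Bessel approximation of order $p$ is $$F_R^{(p)}(\gamma)+F_{\gamma_{\mathcal D}}(\gamma)-F_R^{(p)}(\gamma)F_{\gamma_{\mathcal D}}(\gamma)=G_{\mathcal D}(\gamma)+G_R^{(p)}(\gamma)\bigl(1-G_{\mathcal D}(\gamma)\bigr).$$ 3. For all $\bar\gamma,\tau>0$, $G_{\mathcal D}(\gamma)+G_R^{(p)}(\gamma)(1-G_{\mathcal D}(\gamma))\to F_{\gamma_{eq}}(\gamma)$ as $p\to\infty$. 4. For every $p\ge1$, in the high-SNR regime (writing $f\sim g$ for $f-g=o(g)$): $F_{\gamma_R}(\gamma)\sim F_R^{\infty,p}(\gamma)$ and $F_R^{(p)}(\gamma)\sim F_R^{\infty,p}(\gamma)$ as $\bar\gamma\to\infty$; $F_{\gamma_{\mathcal D}}(\gamma)\sim F_{\mathcal D}^\infty(\gamma)$ as $\tau\to\infty$; and, as $\bar\gamma\to\infty$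 and $\tau\to\infty$ jointly, $$F_{\gamma_{eq}}(\gamma)\sim F_R^{\infty,p}(\gamma)+F_{\mathcal D}^\infty(\gamma),\qquad G_{\mathcal D}(\gamma)+G_R^{(p)}(\gamma)\bigl(1-G_{\mathcal D}(\gamma)\bigr)\sim F_R^{\infty,p}(\gamma)+F_{\mathcal D}^\infty(\gamma).$$ -/

import Mathlib

open MeasureTheory ProbabilityTheory Filter Topology Asymptotics
open scoped BigOperators

noncomputable section

/-! ## Meijer's G-function -/

/-- The Mellin-Barnes integrand of `G^{m,n}_{p,q}[z | a; b]`. -/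
def meijerIntegrand {p q : ℕ} (m n : ℕ) (a : Fin p → ℂ) (b : Fin q → ℂ) (z s : ℂ) : ℂ :=
  ((∏ j ∈ Finset.univ.filter (fun j : Fin q => (j : ℕ) < m), Complex.Gamma (b j - s)) *
      ∏ j ∈ Finset.univ.filter (fun j : Fin p => (j : ℕ) < n), Complex.Gamma (1 - a j + s)) /
    ((∏ j ∈ Finset.univ.filter (fun j : Fin q => m ≤ (j : ℕ)), Complex.Gamma (1 - b j + s)) *
      ∏ j ∈ Finset.univ.filter (fun j : Fin p => n ≤ (j : ℕ)), Complex.Gamma (a j - s)) * z ^ s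

/-- The vertical line `Re s = c` has all poles of `Γ(1 - a j + s)`, `j ≤ n`, on its left and all
poles of `Γ(b j - s)`, `j ≤ m`, on its right. -/
def MeijerSeparates {p q : ℕ} (m n : ℕ) (a : Fin p → ℂ) (b : Fin q → ℂ) (c : ℝ) : Prop :=
  (∀ j : Fin p, (j : ℕ) < n → (a j).re - 1 < c) ∧ ∀ j : Fin q, (j : ℕ) < m → c < (b j).re

open Classical in
/-- Meijer's function `G^{m,n}_{p,q}[z | a; b] = (2πi)⁻¹ ∫ (Mellin-Barnes integrand) ds`, the contour
being a vertical line that separates the two families of poles (by Cauchy's theorem all such lines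
give the same value when `|arg z| < (m + n - (p + q)/2) π`). The value is `0` by convention if no
straight line separates them, a case that does not occur for the parameters used below. -/
def meijerG {p q : ℕ} (m n : ℕ) (a : Fin p → ℂ) (b : Fin q → ℂ) (z : ℂ) : ℂ :=
  if h : ∃ c : ℝ, MeijerSeparates m n a b c then
    (1 / (2 * Real.pi : ℂ)) *
      ∫ t : ℝ, meijerIntegrand m n a b z ((h.choose : ℂ) + t * Complex.I)
  else 0

/-! ## The RF hop: κ-μ fading, random-waypoint distance, maximal-ratio combining -/

/-- The modified Bessel function of the first kind `I_v(x)`. -/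
def besselI (v x : ℝ) : ℝ :=
  ∑' k : ℕ, (x / 2) ^ (v + 2 * k) / ((k.factorial : ℝ) * Real.Gamma (v + k + 1))

/-- The coefficients `V(k, p, v)` of the `p`-th polynomial approximation of `I_v`. -/
def besselCoeff (k p : ℕ) (v : ℝ) : ℝ :=
  Real.Gamma (p + k) * (p : ℝ) ^ (1 - 2 * (k : ℤ)) /
    (Real.Gamma (k + 1) * Real.Gamma ((p : ℝ) - k + 1) * Real.Gamma (v + k + 1))

/-- The approximation `∑_{k ≤ p} V(k, p, v) (x / 2) ^ (v + 2k)` of `I_v(x)`. -/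
def besselApprox (p : ℕ) (v x : ℝ) : ℝ :=
  ∑ k ∈ Finset.range (p + 1), besselCoeff k p v * (x / 2) ^ (v + 2 * k)

/-- The rate `B = μ (1 + κ)` of the κ-μ distribution. -/
def kappaMuRate (κ μ : ℝ) : ℝ := μ * (1 + κ)

/-- The κ-μ envelope density `A x^μ exp(-B x²) I_{μ-1}(M x)`, with `J` in the place of `I`. -/
def kappaMuPDF (J : ℝ → ℝ → ℝ) (κ μ x : ℝ) : ℝ :=
  2 * μ * (1 + κ) ^ ((μ + 1) / 2) / (κ ^ ((μ - 1) / 2) * Real.exp (μ * κ)) *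
    x ^ μ * Real.exp (-kappaMuRate κ μ * x ^ 2) *
    J (μ - 1) (2 * μ * Real.sqrt (κ * (1 + κ)) * x)

/-- The κ-μ law of a fading envelope. -/
def kappaMuLaw (κ μ : ℝ) : Measure ℝ :=
  (volume.restrict (Set.Ioi 0)).withDensity
    fun x => ENNReal.ofReal (kappaMuPDF besselI κ μ x)

/-- The coefficients `C_i` of the three-dimensional random-waypoint distance density. -/
def rwpC (i : Fin 3) : ℝ := ![735, -1190, 455] i / 72

/-- The exponents `β_i` of the three-dimensional random-waypoint distance density. -/
def rwpBeta (i : Fin 3) : ℝ := ![2, 4, 6] i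

/-- The random-waypoint distance density on `[0, D]`. -/
def rwpPDF (D x : ℝ) : ℝ := ∑ i, rwpC i / D ^ (rwpBeta i + 1) * x ^ rwpBeta i

/-- The random-waypoint law of the distance. -/
def rwpLaw (D : ℝ) : Measure ℝ :=
  (volume.restrict (Set.Icc 0 D)).withDensity fun x => ENNReal.ofReal (rwpPDF D x)

/-- Parameters of the RF hop: number `L` of receive antennas, fading parameters `κ`, `μ`, path-loss
exponent `α`, gain factor `ϱ`, radius `D`. -/
structure RFHop where
  L : ℕ
  κ : ℝ
  μ : ℝ
  α : ℝ
  ϱ : ℝ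
  D : ℝ
  L_pos : 0 < L
  κ_pos : 0 < κ
  μ_pos : 0 < μ
  α_pos : 0 < α
  ϱ_pos : 0 < ϱ
  D_pos : 0 < D

namespace RFHop

variable (R : RFHop)

/-- The SNR `∑_l ϱ |h_l|² q^{-α} g` after maximal-ratio combining; `g` is the average SNR per
branch. -/
def snr (g : ℝ) (h : Fin R.L → ℝ) (q : ℝ) : ℝ :=
  ∑ l, R.ϱ * |h l| ^ 2 * q ^ (-R.α) * g

/-- The CDF of `ϱ x² q^{-α} L g` for a random-waypoint distance `q` and an independent κ-μ
envelope `x` with the combined parameters `κ`, `L μ`, the Bessel function being replaced by `J`. -/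
def cdfWith (J : ℝ → ℝ → ℝ) (g γ : ℝ) : ℝ :=
  ∫ q in (0 : ℝ)..R.D, rwpPDF R.D q *
    ∫ x in (0 : ℝ)..Real.sqrt (γ * q ^ R.α / (R.ϱ * (R.L * g))),
      kappaMuPDF J R.κ (R.L * R.μ) x

/-- `Ψ_i = (β_i + 1) / α`. -/
def Psi (i : Fin 3) : ℝ := 1 / R.α * (rwpBeta i + 1)

/-- `K₁`, depending on `i`, `k` and on the order `p` of the Bessel approximation. -/
def K₁ (p : ℕ) (i : Fin 3) (k : ℕ) : ℝ :=
  1 / (R.α * Real.exp (R.L * R.μ * R.κ)) * rwpC i * besselCoeff k p (R.L * R.μ - 1) *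
    (R.L * R.μ * R.κ) ^ k

/-- `K₂ = B D^α / (ϱ L g)`, with the rate `B = L μ (1 + κ)` of the combined branches. -/
def K₂ (g : ℝ) : ℝ :=
  kappaMuRate R.κ (R.L * R.μ) * R.D ^ R.α / (R.ϱ * R.L * g)

/-- The closed form of the RF hop's CDF. -/
def closedCDF (p : ℕ) (g γ : ℝ) : ℂ :=
  ∑ i : Fin 3, ∑ k ∈ Finset.range (p + 1), (R.K₁ p i k : ℂ) *
    meijerG 1 2 ![1 - (R.Psi i : ℂ), 1]
      ![(R.L : ℂ) * (R.μ : ℂ) + k, 0, -(R.Psi i : ℂ)] ((R.K₂ g * γ : ℝ) : ℂ)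

/-- The asymptotic CDF of the RF hop. -/
def asympCDF (p : ℕ) (g γ : ℝ) : ℝ :=
  ∑ i : Fin 3, ∑ k ∈ Finset.range (p + 1),
    R.K₁ p i k / (R.K₂ g * γ) ^ (-(R.L * R.μ) - k : ℝ) *
      (Real.Gamma (R.Psi i + R.L * R.μ + k) * Real.Gamma (0 + R.L * R.μ + k) /
        (Real.Gamma (1 + R.L * R.μ + k) * Real.Gamma (1 + R.Psi i + R.L * R.μ + k)))

end RFHop

/-! ## The UOWC hop: mEGG turbulence with pointing errors, RIS, gamma approximation -/

/-- Parameters of one optical link: mixture weight `ω`, exponential parameter `ν`, generalized-gamma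
parameters `a`, `b`, `c`, pointing-error parameter `ξ`, pointing loss `J`. -/
structure OpticalLink where
  ω : ℝ
  ν : ℝ
  a : ℝ
  b : ℝ
  c : ℝ
  ξ : ℝ
  J : ℝ
  ω_pos : 0 < ω
  ω_lt_one : ω < 1
  ν_pos : 0 < ν
  a_pos : 0 < a
  b_pos : 0 < b
  c_pos : 0 < c
  ξ_pos : 0 < ξ
  J_pos : 0 < J

namespace OpticalLink

variable (O : OpticalLink)

/-- The mixture exponential-generalized gamma (mEGG) density on `(0, ∞)`. -/
def meggPDF (x : ℝ) : ℝ :=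
  O.ω / O.ν * Real.exp (-x / O.ν) +
    (1 - O.ω) * (O.c * x ^ (O.a * O.c - 1) / (O.b ^ (O.a * O.c) * Real.Gamma O.a) *
      Real.exp (-(x / O.b) ^ O.c))

/-- The density `ξ² x^{ξ²-1} / J^{ξ²}` on `(0, J)` of the attenuation by pointing errors. -/
def pointingPDF (x : ℝ) : ℝ := O.ξ ^ 2 * x ^ (O.ξ ^ 2 - 1) / O.J ^ (O.ξ ^ 2)

/-- The law of the gain of the link: mEGG turbulence times an independent pointing-error factor. -/
def gainLaw : Measure ℝ :=
  (((volume.restrict (Set.Ioi 0)).withDensity fun x => ENNReal.ofReal (O.meggPDF x)).prod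
    ((volume.restrict (Set.Ioo 0 O.J)).withDensity fun x => ENNReal.ofReal (O.pointingPDF x))).map
      fun z => z.1 * z.2

end OpticalLink

/-- Parameters of the optical hop: the links relay-RIS and RIS-destination, the number `N` of
reflecting elements, the detection type `r` (`1` heterodyne, `2` intensity modulation / direct
detection). -/
structure OpticalHop where
  linkI : OpticalLink
  linkD : OpticalLink
  N : ℕ
  r : ℕ
  N_pos : 0 < N
  r_eq : r = 1 ∨ r = 2

namespace OpticalHop

variable (O : OpticalHop)

/-- The law of the cascaded gain `Y = α_u β_u` through one reflecting element. -/
def cascadeLaw : Measure ℝ := (O.linkI.gainLaw.prod O.linkD.gainLaw).map fun z => z.1 * z.2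

/-- `E(Y)`. -/
def meanY : ℝ := ∫ y, y ∂O.cascadeLaw

/-- The law of `χ = ∑_u Y_u` over `N` independent reflecting elements. -/
def sumLaw : Measure ℝ := (Measure.pi fun _ : Fin O.N => O.cascadeLaw).map fun y => ∑ u, y u

/-- The shape `ρ = E(χ)² / Var(χ)` of the gamma approximation of `χ`. -/
def rho : ℝ := (∫ x, x ∂O.sumLaw) ^ 2 / variance id O.sumLaw

/-- The scale `w = Var(χ) / E(χ)` of the gamma approximation of `χ`. -/
def scale : ℝ := variance id O.sumLaw / ∫ x, x ∂O.sumLaw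

/-- The gamma approximation of the law of `χ` (shape `ρ`, scale `w`, that is, rate `1 / w`). -/
def gammaApproxLaw : Measure ℝ := gammaMeasure O.rho (1 / O.scale)

/-- The SNR `τ (χ / E(Y))^r`, where `τ` is the electrical SNR. -/
def snr (τ χ : ℝ) : ℝ := τ * (χ / O.meanY) ^ O.r

/-- `Υ₃`. -/
def Ups₃ (τ : ℝ) : ℝ :=
  O.meanY ^ O.rho / (Real.sqrt O.r * Real.Gamma O.rho * O.scale ^ O.rho *
    τ ^ (O.rho / O.r) * (2 * Real.pi) ^ (((O.r : ℝ) - 1) / 2))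

/-- `Υ₄`. -/
def Ups₄ (τ : ℝ) : ℝ := O.meanY ^ O.r / ((O.r : ℝ) ^ O.r * O.scale ^ O.r * τ)

/-- The lower parameters: `0, -ρ` if `r = 1`, and `0, 1/2, -ρ/2` if `r = 2`. -/
def lowerParams (j : Fin (O.r + 1)) : ℂ :=
  if (j : ℕ) < O.r then (j : ℕ) / (O.r : ℂ) else -((O.rho / O.r : ℝ) : ℂ)

/-- The closed form of the UOWC hop's CDF. -/
def closedCDF (τ γ : ℝ) : ℂ :=
  ((O.Ups₃ τ * γ ^ (O.rho / O.r) : ℝ) : ℂ) *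
    meijerG O.r 1 ![1 - ((O.rho / O.r : ℝ) : ℂ)] O.lowerParams ((O.Ups₄ τ * γ : ℝ) : ℂ)

/-- `T₃`, indexed from `1` to `r + 1`: `(1, 1 + ρ)` if `r = 1`, `(1, 1/2, 1 + ρ/2)` if `r = 2`. -/
def T₃ (l : ℕ) : ℝ := if l ≤ O.r then 1 - ((l : ℝ) - 1) / O.r else 1 + O.rho / O.r

/-- The asymptotic CDF of the UOWC hop. -/
def asympCDF (τ γ : ℝ) : ℝ :=
  O.Ups₃ τ * γ ^ (O.rho / O.r) * ∑ k ∈ Finset.Icc 1 O.r,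
    (1 / (O.Ups₄ τ * γ)) ^ (O.T₃ k - 1) *
      ((∏ l ∈ (Finset.Icc 1 O.r).erase k, Real.Gamma (O.T₃ k - O.T₃ l)) *
          Real.Gamma (1 + O.rho / O.r - O.T₃ k) /
        Real.Gamma (1 + O.T₃ (O.r + 1) - O.T₃ k))

end OpticalHop

/-! ## The dual-hop link -/

/-- The closed form of the end-to-end CDF. -/
def endToEndClosedCDF (R : RFHop) (O : OpticalHop) (p : ℕ) (g τ γ : ℝ) : ℂ :=
  O.closedCDF τ γ + R.closedCDF p g γ * (1 - O.closedCDF τ γ)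

/-- The sum of the asymptotic CDFs of the two hops. -/
def endToEndAsympCDF (R : RFHop) (O : OpticalHop) (p : ℕ) (g τ γ : ℝ) : ℝ :=
  R.asympCDF p g γ + O.asympCDF τ γ

end

/-! Both hops reduce to the lower incomplete gamma function and to the operator `powerAvg m`, which
sends `f` to `∫₀¹ u^(m-1) f(u x) du`.

Meijer functions. By Fubini, `powerAvg m` multiplies the Mellin transform at `s` by `1 / (m - s)`
(`hasMellin_powerAvg`). Starting from `e^{-x}`, whose transform is `Γ(s)`, and using that
`lowerGamma m` is `x^m` times a power average of `e^{-x}`, one obtains functions whose transforms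
are exactly the Gamma quotients of the Mellin-Barnes integrands. Mellin inversion then evaluates
`meijerG` as a power average; for `r = 2` the duplication formula first reduces the integrand to
that of `r = 1`.

RF hop. Expanding the Bessel series writes the law of the squared κ-μ envelope as a Poisson mixture,
with mean `m κ`, of gamma laws of shapes `m + k` and common rate `B`. Its moment generating function
is `θ^m exp(m κ (θ - 1))` with `θ = B / (B - s)`, and the `L`-th power of this has the same form
with `L μ` for `μ`; so maximal-ratio combining stays in the κ-μ family (`map_sum_sq_eq`). Averaging
over the distance gives the CDF as a Poisson mixture of the functions `rwpGammaCDF` at `z = K₂ γ`.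
The polynomial approximation of order `p` only multiplies the `k`-th weight by `besselRatio p k =
∏_{j<k} (1 - j²/p²)`. This factor lies in `[0, 1]`, vanishes for `k > p`, tends to `1` as `p → ∞`
and equals `1` at `k = 0`. Dominated convergence therefore makes the closed form exact in the limit;
and since the `k = 0` term dominates as `z → 0`, the exact CDF, the approximate CDF and the
asymptotic expression all have the same leading term, for every fixed `p ≥ 1`.

UOWC hop. The CDF is `lowerGamma ρ T / Γ(ρ)` at a threshold `T` proportional to `(γ/τ)^(1/r)`.
Positivity of `ρ` and `w` requires a positive mean and a positive variance of the sum; they hold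
because the gains are positive, square integrable and free of atoms, a class stable under
independent products.

End to end. Independence gives inclusion-exclusion for the minimum. At high SNR the product of the
CDFs is negligible because one factor tends to `0`, and the two relative errors add up because both
leading terms are positive (`isEquivalent_add_sub_mul`). -/

/-! ## The lower incomplete gamma function and power averages -/

/-- The lower incomplete gamma function. -/
noncomputable def lowerGamma (m x : ℝ) : ℝ := ∫ t in (0 : ℝ)..x, t ^ (m - 1) * Real.exp (-t)

/-- The average `∫₀¹ u^{m-1} f(u x) du`. -/
noncomputable def powerAvg (m : ℝ) (f : ℝ → ℝ) (x : ℝ) : ℝ :=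
  ∫ u in (0 : ℝ)..1, u ^ (m - 1) * f (u * x)

theorem intervalIntegrable_rpow_sub_one {m : ℝ} (hm : 0 < m) (a b : ℝ) :
    IntervalIntegrable (fun t : ℝ => t ^ (m - 1)) volume a b :=
  intervalIntegral.intervalIntegrable_rpow' (by linarith)

theorem integral_rpow_sub_one {m : ℝ} (hm : 0 < m) (x : ℝ) :
    ∫ t in (0 : ℝ)..x, t ^ (m - 1) = x ^ m / m := by
  rw [integral_rpow (Or.inl (by linarith))]
  simp [Real.zero_rpow hm.ne']

theorem intervalIntegrable_lowerGamma {m : ℝ} (hm : 0 < m) (a b : ℝ) :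
    IntervalIntegrable (fun t : ℝ => t ^ (m - 1) * Real.exp (-t)) volume a b :=
  (intervalIntegrable_rpow_sub_one hm a b).mul_continuousOn (by fun_prop)

theorem continuous_lowerGamma {m : ℝ} (hm : 0 < m) : Continuous (lowerGamma m) :=
  intervalIntegral.continuous_primitive (intervalIntegrable_lowerGamma hm) 0

theorem lowerGamma_nonneg (m : ℝ) {x : ℝ} (hx : 0 ≤ x) : 0 ≤ lowerGamma m x :=
  intervalIntegral.integral_nonneg hx fun _ ht =>
    mul_nonneg (Real.rpow_nonneg ht.1 _) (Real.exp_pos _).le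

theorem lowerGamma_le_rpow {m x : ℝ} (hm : 0 < m) (hx : 0 ≤ x) :
    lowerGamma m x ≤ x ^ m / m := by
  rw [← integral_rpow_sub_one hm]
  refine intervalIntegral.integral_mono_on hx (intervalIntegrable_lowerGamma hm _ _)
    (intervalIntegrable_rpow_sub_one hm _ _) fun t ht => ?_
  exact mul_le_of_le_one_right (Real.rpow_nonneg ht.1 _) (by simpa using ht.1)

/-- Integrates `1 - t ≤ e^{-t}`. Together with the upper bound this is a first-order expansion at
`0` with explicit error, from which all the high-SNR asymptotics of the true CDFs follow. -/
theorem rpow_sub_le_lowerGamma {m x : ℝ} (hm : 0 < m) (hx : 0 ≤ x) :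
    x ^ m / m - x ^ (m + 1) / (m + 1) ≤ lowerGamma m x := by
  rw [← integral_rpow_sub_one hm, ← integral_rpow_sub_one (by linarith : 0 < m + 1),
    ← intervalIntegral.integral_sub (intervalIntegrable_rpow_sub_one hm _ _)
      (intervalIntegrable_rpow_sub_one (by linarith) _ _)]
  refine intervalIntegral.integral_mono_on_of_le_Ioo hx
    ((intervalIntegrable_rpow_sub_one hm _ _).sub
      (intervalIntegrable_rpow_sub_one (by linarith) _ _))
    (intervalIntegrable_lowerGamma hm _ _) fun t ht => ?_
  have h1 : t ^ (m + 1 - 1) = t ^ (m - 1) * t := by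
    rw [← Real.rpow_add_one ht.1.ne']; ring_nf
  have h2 := Real.add_one_le_exp (-t)
  have h3 := Real.rpow_nonneg ht.1.le (m - 1)
  rw [h1]
  nlinarith

theorem lowerGamma_le_Gamma {m x : ℝ} (hm : 0 < m) (hx : 0 ≤ x) :
    lowerGamma m x ≤ Real.Gamma m := by
  rw [lowerGamma, intervalIntegral.integral_of_le hx, Real.Gamma_eq_integral hm]
  simp_rw [mul_comm (_ ^ (m - 1))]
  refine setIntegral_mono_set (Real.GammaIntegral_convergent hm) ?_
    (Set.Ioc_subset_Ioi_self.eventuallyLE)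
  filter_upwards [ae_restrict_mem measurableSet_Ioi] with t ht
  exact mul_nonneg (Real.exp_pos _).le (Real.rpow_nonneg (le_of_lt ht) _)

/-- The substitution `t = u x`. It lets the Mellin transform be deduced from that of `e^{-x}`, and
it matches the factor `γ^(ρ/r)` in front of the optical Meijer function. -/
theorem lowerGamma_eq_powerAvg {m x : ℝ} (hm : 0 < m) (hx : 0 ≤ x) :
    lowerGamma m x = x ^ m * powerAvg m (fun t => Real.exp (-t)) x := by
  rcases hx.eq_or_lt with rfl | hx
  · simp [lowerGamma, Real.zero_rpow hm.ne']
  have h := intervalIntegral.integral_comp_mul_right (a := 0) (b := 1)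
    (fun t : ℝ => t ^ (m - 1) * Real.exp (-t)) hx.ne'
  simp only [zero_mul, one_mul, smul_eq_mul] at h
  rw [lowerGamma, powerAvg, ← intervalIntegral.integral_const_mul]
  rw [eq_comm, inv_mul_eq_iff_eq_mul₀ hx.ne'] at h
  rw [h, ← intervalIntegral.integral_const_mul]
  refine intervalIntegral.integral_congr fun u hu => ?_
  rw [Set.uIcc_of_le zero_le_one] at hu
  rw [Real.mul_rpow hu.1 hx.le, Real.rpow_sub_one hx.ne']
  field_simp

theorem continuousOn_powerAvg {m C : ℝ} (hm : 0 < m) {f : ℝ → ℝ} (hf : Continuous f)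
    (hC : ∀ x, 0 ≤ x → |f x| ≤ C) : ContinuousOn (powerAvg m f) (Set.Ici 0) := by
  intro x hx
  refine intervalIntegral.continuousWithinAt_of_dominated_interval
    (bound := fun u => u ^ (m - 1) * C) ?_ ?_ ?_ ?_
  · refine Eventually.of_forall fun y => ?_
    exact (((measurable_id.pow_const _).mul
      (hf.measurable.comp (measurable_id.mul_const y)))).aestronglyMeasurable
  · filter_upwards [self_mem_nhdsWithin] with y hy
    refine Eventually.of_forall fun u hu => ?_
    rw [Set.uIoc_of_le zero_le_one] at hu
    rw [Real.norm_eq_abs, abs_mul, abs_of_nonneg (Real.rpow_nonneg hu.1.le _)]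
    exact mul_le_mul_of_nonneg_left (hC _ (mul_nonneg hu.1.le hy)) (Real.rpow_nonneg hu.1.le _)
  · exact (intervalIntegrable_rpow_sub_one hm _ _).mul_const _
  · refine Eventually.of_forall fun u _ => ?_
    exact (by fun_prop : Continuous fun y => u ^ (m - 1) * f (u * y)).continuousWithinAt

/-! ## Mellin transforms of power averages -/

open Complex in
-- Exchange the integrals: for fixed `u`, scaling turns the inner one into `u^{-s} M`, and `∫₀¹
-- u^(m-s-1) du = 1 / (m - s)` converges because `Re s < m`.
theorem hasMellin_powerAvg {m : ℝ} {f : ℝ → ℝ} (hf : Continuous f) {s M : ℂ}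
    (h : HasMellin (fun x => (f x : ℂ)) s M) (hs : s.re < m) :
    HasMellin (fun x => (powerAvg m f x : ℂ)) s (M / (m - s)) := by
  set F : ℝ → ℝ → ℂ := fun u x => (u : ℂ) ^ ((m : ℂ) - 1) * ((x : ℂ) ^ (s - 1) * (f (u * x) : ℂ))
    with hF
  set I := ∫ x in Set.Ioi (0 : ℝ), ‖(x : ℂ) ^ (s - 1) • (f x : ℂ)‖ with hI
  have hmeas : AEStronglyMeasurable (Function.uncurry F)
      ((volume.restrict (Set.Ioc (0 : ℝ) 1)).prod (volume.restrict (Set.Ioi (0 : ℝ)))) := by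
    refine Measurable.aestronglyMeasurable ?_
    simp only [hF, Function.uncurry_def]
    have := hf.measurable
    fun_prop
  have hint : Integrable (Function.uncurry F)
      ((volume.restrict (Set.Ioc (0 : ℝ) 1)).prod (volume.restrict (Set.Ioi (0 : ℝ)))) := by
    rw [integrable_prod_iff hmeas]
    constructor
    · filter_upwards [ae_restrict_mem measurableSet_Ioc] with u hu
      have := (MellinConvergent.comp_mul_left (f := fun x => (f x : ℂ)) (s := s) hu.1).2 h.1
      simp only [MellinConvergent, smul_eq_mul] at this
      exact Integrable.const_mul this ((u : ℂ) ^ ((m : ℂ) - 1))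
    -- The same scaling for absolute values; the resulting exponent `m - Re s - 1` exceeds `-1`,
    -- which gives the absolute convergence needed for Fubini.
    · have key : ∀ u ∈ Set.Ioc (0 : ℝ) 1,
          ∫ x in Set.Ioi (0 : ℝ), ‖F u x‖ = u ^ (m - s.re - 1) * I := by
        intro u hu
        have h1 := integral_comp_mul_left_Ioi (fun x : ℝ => ‖(x : ℂ) ^ (s - 1) • (f x : ℂ)‖) 0 hu.1
        rw [mul_zero, ← hI] at h1
        have h2 : ∀ x ∈ Set.Ioi (0 : ℝ), ‖F u x‖ = u ^ (m - s.re) *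
            ‖((u * x : ℝ) : ℂ) ^ (s - 1) • (f (u * x) : ℂ)‖ := by
          intro x hx
          simp only [hF, norm_mul, norm_smul]
          rw [norm_cpow_eq_rpow_re_of_pos hu.1, norm_cpow_eq_rpow_re_of_pos hx,
            norm_cpow_eq_rpow_re_of_pos (mul_pos hu.1 hx), Real.mul_rpow hu.1.le (le_of_lt hx),
            ← mul_assoc, ← mul_assoc, ← mul_assoc, ← Real.rpow_add hu.1]
          congr 3
          simp
        rw [setIntegral_congr_fun measurableSet_Ioi h2, integral_const_mul, h1, smul_eq_mul,
          Real.rpow_sub_one hu.1.ne']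
        field_simp
      refine Integrable.congr (f := fun u : ℝ => u ^ (m - s.re - 1) * I) ?_ ?_
      · refine Integrable.mul_const ?_ _
        exact (intervalIntegrable_iff_integrableOn_Ioc_of_le zero_le_one).1
          (intervalIntegrable_rpow_sub_one (by linarith) 0 1)
      · filter_upwards [ae_restrict_mem measurableSet_Ioc] with u hu using (key u hu).symm
  have hinner : ∀ x : ℝ, ∫ u in Set.Ioc (0 : ℝ) 1, F u x =
      (x : ℂ) ^ (s - 1) • (powerAvg m f x : ℂ) := by
    intro x
    rw [powerAvg, ← intervalIntegral.integral_ofReal, intervalIntegral.integral_of_le zero_le_one,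
      smul_eq_mul, ← integral_const_mul]
    refine setIntegral_congr_fun measurableSet_Ioc fun u hu => ?_
    simp only [hF]
    push_cast [ofReal_cpow hu.1.le]
    ring
  refine ⟨?_, ?_⟩
  · have := hint.swap.integral_prod_left
    refine this.congr (Eventually.of_forall fun x => ?_)
    exact hinner x
  · have h1 : mellin (fun x => (powerAvg m f x : ℂ)) s =
        ∫ x in Set.Ioi (0 : ℝ), ∫ u in Set.Ioc (0 : ℝ) 1, F u x :=
      integral_congr_ae (Eventually.of_forall fun x => (hinner x).symm)
    rw [h1, ← integral_integral_swap hint]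
    have h2 : ∀ u ∈ Set.Ioc (0 : ℝ) 1, ∫ x in Set.Ioi (0 : ℝ), F u x =
        (u : ℂ) ^ ((m : ℂ) - s - 1) * M := by
      intro u hu
      simp only [hF]
      rw [integral_const_mul]
      have h3 := mellin_comp_mul_left (fun x => (f x : ℂ)) s hu.1
      simp only [mellin, smul_eq_mul] at h3
      rw [h3]
      have h4 := h.2
      simp only [mellin, smul_eq_mul] at h4
      rw [h4, ← mul_assoc, ← cpow_add _ _ (ofReal_ne_zero.2 hu.1.ne')]
      ring_nf
    rw [setIntegral_congr_fun measurableSet_Ioc h2, integral_mul_const,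
      ← intervalIntegral.integral_of_le zero_le_one, integral_cpow (Or.inl (by simp; linarith))]
    have hne : (m : ℂ) - s ≠ 0 := by
      intro h0
      have := congrArg Complex.re h0
      simp at this
      linarith
    simp [zero_cpow hne, div_eq_mul_inv, mul_comm]

open Complex in
theorem hasMellin_exp_neg {s : ℂ} (hs : 0 < s.re) :
    HasMellin (fun x : ℝ => ((Real.exp (-x) : ℝ) : ℂ)) s (Complex.Gamma s) := by
  refine ⟨?_, ?_⟩
  · have := Complex.GammaIntegral_convergent hs
    simpa only [MellinConvergent, smul_eq_mul, mul_comm] using this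
  · rw [Complex.Gamma_eq_integral hs, Complex.GammaIntegral_eq_mellin]

open Complex in
-- The factor `x^m` shifts `s` to `s + m`, so the average contributes `1 / (m - (s + m)) = 1 /
-- (-s)`. The left edge of the strip is where `Γ(m + s)` stops converging, the right edge where the
-- average does.
theorem hasMellin_lowerGamma {m : ℝ} (hm : 0 < m) {s : ℂ} (h1 : -m < s.re) (h2 : s.re < 0) :
    HasMellin (fun x => (lowerGamma m x : ℂ)) s (Complex.Gamma (m + s) / (-s)) := by
  have h := hasMellin_powerAvg (m := m) (s := s + m) (f := fun t => Real.exp (-t)) (by fun_prop)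
    (hasMellin_exp_neg (by simp; linarith)) (by simp; linarith)
  have hEq : Set.EqOn (fun x : ℝ => (x : ℂ) ^ (s - 1) • (lowerGamma m x : ℂ))
      (fun x : ℝ => (x : ℂ) ^ (s - 1) •
        ((x : ℂ) ^ (m : ℂ) • (powerAvg m (fun t => Real.exp (-t)) x : ℂ)))
      (Set.Ioi 0) := by
    intro x hx
    simp only
    rw [lowerGamma_eq_powerAvg hm (le_of_lt hx), ofReal_mul, ofReal_cpow (le_of_lt hx), smul_eq_mul,
      smul_eq_mul, smul_eq_mul]
  refine ⟨?_, ?_⟩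
  · have h3 := MellinConvergent.cpow_smul.2 h.1
    exact IntegrableOn.congr_fun h3 (fun x hx => (hEq hx).symm) measurableSet_Ioi
  · rw [mellin, setIntegral_congr_fun measurableSet_Ioi hEq]
    have h3 := mellin_cpow_smul
      (fun x => (powerAvg m (fun t => Real.exp (-t)) x : ℂ)) s m
    rw [mellin] at h3
    rw [h3, h.2]
    ring_nf

/-! ## Evaluation of Meijer functions by Mellin inversion -/

open Complex in
theorem norm_Gamma_le {s : ℂ} (hs : 0 < s.re) : ‖Complex.Gamma s‖ ≤ Real.Gamma s.re := by
  rw [Complex.Gamma_eq_integral hs, Complex.GammaIntegral, Real.Gamma_eq_integral hs]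
  refine (norm_integral_le_integral_norm _).trans (le_of_eq ?_)
  refine setIntegral_congr_fun measurableSet_Ioi fun x hx => ?_
  simp only [norm_mul, norm_cpow_eq_rpow_re_of_pos hx, Complex.norm_real, Real.norm_eq_abs,
    Real.abs_exp, sub_re, one_re]

open Complex in
-- No Stirling estimate is needed: `Γ` is bounded on a vertical line in the right half-plane, and
-- the two linear factors already give decay of order `1 / (1 + t²)`.
theorem integrable_Gamma_div_mul {a p q : ℝ} (ha : 0 < a) (hp : p ≠ 0) (hq : q ≠ 0) {u v : ℝ}
    (hu : u ≠ 0) (hv : v ≠ 0) :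
    Integrable fun t : ℝ => Complex.Gamma (a + t * I) / ((p + u * t * I) * (q + v * t * I)) := by
  have hne : ∀ {r w : ℝ}, r ≠ 0 → ∀ t : ℝ, (r + w * t * I : ℂ) ≠ 0 := by
    intro r w hr t h0
    have := congrArg Complex.re h0
    simp at this
    exact hr this
  -- `|r + w t i|² = r² + w² t² ≥ min (r²) (w²) (1 + t²)`.
  have hlow : ∀ {r w : ℝ}, r ≠ 0 → w ≠ 0 → ∃ c > 0, ∀ t : ℝ,
      c * (1 + t ^ 2) ≤ ‖(r + w * t * I : ℂ)‖ ^ 2 := by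
    intro r w hr hw
    refine ⟨min (r ^ 2) (w ^ 2), lt_min (by positivity) (by positivity), fun t => ?_⟩
    rw [← Complex.normSq_eq_norm_sq, Complex.normSq_apply]
    simp
    have h1 := min_le_left (r ^ 2) (w ^ 2)
    have h2 := min_le_right (r ^ 2) (w ^ 2)
    nlinarith [sq_nonneg t, mul_le_mul_of_nonneg_right h2 (sq_nonneg t)]
  obtain ⟨c, hc, hc'⟩ := hlow hp hu
  obtain ⟨d, hd, hd'⟩ := hlow hq hv
  have hcont : Continuous fun t : ℝ =>
      Complex.Gamma (a + t * I) / ((p + u * t * I) * (q + v * t * I)) := by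
    refine Continuous.div ?_ (by fun_prop) fun t => mul_ne_zero (hne hp t) (hne hq t)
    refine continuous_iff_continuousAt.2 fun t => ?_
    refine ContinuousAt.comp (f := fun t : ℝ => (a + t * I : ℂ)) ?_ (by fun_prop)
    refine (Complex.differentiableAt_Gamma _ fun n h0 => ?_).continuousAt
    have := congrArg Complex.re h0
    simp at this
    have h3 : (0 : ℝ) ≤ n := n.cast_nonneg
    linarith
  have hbase : Integrable fun t : ℝ => (Real.Gamma a / Real.sqrt (c * d)) * (1 + t ^ 2)⁻¹ :=
    integrable_inv_one_add_sq.const_mul _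
  refine hbase.mono' hcont.aestronglyMeasurable (Eventually.of_forall fun t => ?_)
  have h1 : ‖Complex.Gamma (a + t * I)‖ ≤ Real.Gamma a := by
    have := norm_Gamma_le (s := a + t * I) (by simpa using ha)
    simpa using this
  have h2 : Real.sqrt (c * d) * (1 + t ^ 2) ≤ ‖((p + u * t * I) * (q + v * t * I) : ℂ)‖ := by
    rw [norm_mul]
    refine abs_le_of_sq_le_sq' ?_ (by positivity) |>.2
    rw [mul_pow, mul_pow, Real.sq_sqrt (by positivity)]
    calc c * d * (1 + t ^ 2) ^ 2 = (c * (1 + t ^ 2)) * (d * (1 + t ^ 2)) := by ring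
      _ ≤ _ := mul_le_mul (hc' t) (hd' t) (by positivity) (by positivity)
  have h4 : 0 < Real.sqrt (c * d) := Real.sqrt_pos.2 (by positivity)
  have h5 : 0 < 1 + t ^ 2 := by positivity
  rw [norm_div, div_mul_eq_mul_div, ← div_eq_mul_inv, div_div, mul_comm (1 + t ^ 2)]
  exact div_le_div₀ (Real.Gamma_pos_of_pos ha).le h1 (by positivity) h2

open Complex in
theorem continuousAt_ofReal_powerAvg {m C : ℝ} (hm : 0 < m) {f : ℝ → ℝ} (hf : Continuous f)
    (hC : ∀ x, 0 ≤ x → |f x| ≤ C) {x : ℝ} (hx : 0 < x) :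
    ContinuousAt (fun x => (powerAvg m f x : ℂ)) x :=
  continuous_ofReal.continuousAt.comp
    ((continuousOn_powerAvg hm hf hC).continuousAt (Ici_mem_nhds hx))

open Complex in
/-- Mellin inversion, with the contour `Re s = c` and the kernel `z ^ s`. -/
theorem integral_mellin_neg_cpow {f : ℝ → ℂ} {c z : ℝ} (hz : 0 < z)
    (hf : MellinConvergent f (-c : ℝ)) (hFf : VerticalIntegrable (mellin f) (-c))
    (hfz : ContinuousAt f z) :
    (1 / (2 * Real.pi : ℂ)) * ∫ t : ℝ, mellin f (-(c + t * I)) * (z : ℂ) ^ (c + t * I : ℂ) =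
      f z := by
  -- `mellinInv` integrates against `z^{-s}` on `Re s = -c`; reversing the direction of `t` gives
  -- the kernel `z^s` on `Re s = c`.
  rw [← mellinInv_mellin_eq (-c) f hz hf hFf hfz, mellinInv,
    ← integral_neg_eq_self (fun y : ℝ => (z : ℂ) ^ (-(((-c : ℝ) : ℂ) + y * I)) •
      mellin f (((-c : ℝ) : ℂ) + y * I)) volume, ← Complex.coe_smul, smul_eq_mul]
  congr 1
  · push_cast; rfl
  · refine integral_congr_ae (Eventually.of_forall fun t => ?_)
    simp only [smul_eq_mul]
    rw [mul_comm]
    push_cast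
    ring_nf

open Complex in
-- At `-s`, the Mellin transform of `powerAvg Ψ (lowerGamma m)` is `Γ(m - s) / (s (Ψ + s))`, valid
-- on the strip `0 < Re s < m`; this is its inversion.
theorem integral_Gamma_sub_div_mul_cpow {m Ψ c z : ℝ} (hm : 0 < m) (hΨ : 0 < Ψ) (hz : 0 < z)
    (hc : 0 < c) (hcm : c < m) :
    (1 / (2 * Real.pi : ℂ)) * ∫ t : ℝ, Complex.Gamma (m - (c + t * I)) /
      ((c + t * I) * (Ψ + (c + t * I))) * (z : ℂ) ^ (c + t * I : ℂ) =
      (powerAvg Ψ (lowerGamma m) z : ℂ) := by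
  have hmel : ∀ t : ℝ, HasMellin (fun x => (powerAvg Ψ (lowerGamma m) x : ℂ)) (-(c + t * I))
      (Complex.Gamma (m - (c + t * I)) / ((c + t * I) * (Ψ + (c + t * I)))) := by
    intro t
    have h := hasMellin_powerAvg (m := Ψ) (continuous_lowerGamma hm)
      (hasMellin_lowerGamma hm (s := -(c + t * I)) (by simpa using hcm) (by simpa using hc))
      (by simp; linarith)
    rwa [div_div, sub_neg_eq_add, neg_neg, ← sub_eq_add_neg] at h
  rw [← integral_mellin_neg_cpow (f := fun x => (powerAvg Ψ (lowerGamma m) x : ℂ)) (c := c) hz]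
  · simp_rw [fun t : ℝ => (hmel t).2]
  · simpa using (hmel 0).1
  · have h := integrable_Gamma_div_mul (a := m - c) (p := c) (q := Ψ + c) (u := -1) (v := -1)
      (by linarith) hc.ne' (by positivity) (by norm_num) (by norm_num)
    refine h.congr (Eventually.of_forall fun t => ?_)
    have h2 := (hmel (-t)).2
    have h3 : (-(c + ((-t : ℝ) : ℂ) * I)) = ((-c : ℝ) : ℂ) + t * I := by push_cast; ring
    rw [h3] at h2
    simp only
    rw [h2]
    push_cast
    ring_nf
  · refine continuousAt_ofReal_powerAvg hΨ (continuous_lowerGamma hm) (C := Real.Gamma m)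
      (fun x hx => ?_) hz
    rw [abs_of_nonneg (lowerGamma_nonneg m hx)]
    exact lowerGamma_le_Gamma hm hx

open Complex in
theorem integral_Gamma_neg_div_cpow {ρ c z : ℝ} (hz : 0 < z) (hc : c < 0) (hcρ : -ρ < c) :
    (1 / (2 * Real.pi : ℂ)) * ∫ t : ℝ, Complex.Gamma (-(c + t * I)) /
      (ρ + (c + t * I)) * (z : ℂ) ^ (c + t * I : ℂ) =
      (powerAvg ρ (fun t => Real.exp (-t)) z : ℂ) := by
  have hmel : ∀ t : ℝ, HasMellin (fun x => (powerAvg ρ (fun t => Real.exp (-t)) x : ℂ))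
      (-(c + t * I)) (Complex.Gamma (-(c + t * I)) / (ρ + (c + t * I))) := by
    intro t
    have h := hasMellin_powerAvg (m := ρ) (f := fun t => Real.exp (-t)) (by fun_prop)
      (hasMellin_exp_neg (s := -(c + t * I)) (by simpa using hc)) (by simp; linarith)
    rwa [sub_neg_eq_add] at h
  rw [← integral_mellin_neg_cpow
    (f := fun x => (powerAvg ρ (fun t => Real.exp (-t)) x : ℂ)) (c := c) hz]
  · simp_rw [fun t : ℝ => (hmel t).2]
  · simpa using (hmel 0).1
  -- There is only one linear factor in the denominator here. Writing `Γ(w) = Γ(w + 1) / w` supplies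
  -- the second one, which is why `a = 1 - c` appears.
  · have h := integrable_Gamma_div_mul (a := 1 - c) (p := -c) (q := ρ + c) (u := 1) (v := -1)
      (by linarith) (by linarith) (by linarith) (by norm_num) (by norm_num)
    refine h.congr (Eventually.of_forall fun t => ?_)
    have h2 := (hmel (-t)).2
    have h3 : (-(c + ((-t : ℝ) : ℂ) * I)) = ((-c : ℝ) : ℂ) + t * I := by push_cast; ring
    rw [h3] at h2
    have h4 : ((-c : ℝ) : ℂ) + t * I ≠ 0 := by
      intro h0
      have := congrArg Complex.re h0
      simp at this
      linarith
    simp only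
    rw [h2]
    have h5 : (((1 - c : ℝ) : ℂ) + t * I) = (((-c : ℝ) : ℂ) + t * I) + 1 := by push_cast; ring
    rw [h5, Complex.Gamma_add_one _ h4]
    have h6 : ((-c : ℝ) : ℂ) + ((1 : ℝ) : ℂ) * t * I = ((-c : ℝ) : ℂ) + t * I := by simp
    have h7 : ((ρ + c : ℝ) : ℂ) + ((-1 : ℝ) : ℂ) * t * I = ρ + (c + ((-t : ℝ) : ℂ) * I) := by
      push_cast; ring
    rw [h6, h7, mul_div_mul_left _ _ h4]
  · refine continuousAt_ofReal_powerAvg (by linarith) (by fun_prop) (C := 1) (fun x hx => ?_) hz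
    rw [Real.abs_exp]
    simpa using hx

/-! ### Closed forms of the Meijer functions of the two hops -/

open Complex in
-- The quotients `Γ(s) / Γ(1 + s)` and `Γ(Ψ + s) / Γ(1 + Ψ + s)` collapse to `1 / s` and `1 / (Ψ +
-- s)`. The contour chosen inside `meijerG` is unknown, but the separation condition amounts to `0 <
-- c < m`, where the inversion formula holds.
theorem meijerG_one_two_eq {m Ψ z : ℝ} (hm : 0 < m) (hΨ : 0 < Ψ) (hz : 0 < z) :
    meijerG 1 2 ![1 - (Ψ : ℂ), 1] ![(m : ℂ), 0, -(Ψ : ℂ)] (z : ℂ) =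
      (powerAvg Ψ (lowerGamma m) z : ℂ) := by
  have hex : ∃ c : ℝ, MeijerSeparates 1 2 ![1 - (Ψ : ℂ), 1] ![(m : ℂ), 0, -(Ψ : ℂ)] c := by
    refine ⟨m / 2, ?_, ?_⟩
    · intro j _
      fin_cases j <;> simp <;> linarith
    · intro j hj
      fin_cases j <;> simp at hj ⊢
      linarith
  rw [meijerG, dif_pos hex]
  obtain ⟨h1, h2⟩ := hex.choose_spec
  set c := hex.choose
  have hc : 0 < c := by simpa using h1 1 (by simp)
  have hcm : c < m := by simpa using h2 0 (by simp)
  rw [← integral_Gamma_sub_div_mul_cpow hm hΨ hz hc hcm]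
  congr 1
  refine integral_congr_ae (Eventually.of_forall fun t => ?_)
  simp only
  have hs : ((c : ℂ) + t * I) ≠ 0 := by
    intro h0
    have := congrArg Complex.re h0
    simp at this
    linarith
  have hs2 : ((Ψ : ℂ) + (c + t * I)) ≠ 0 := by
    intro h0
    have := congrArg Complex.re h0
    simp at this
    linarith
  generalize hsdef : ((c : ℂ) + t * I) = s at *
  have hre : s.re = c := by rw [← hsdef]; simp
  have hG1 : Complex.Gamma s ≠ 0 := Complex.Gamma_ne_zero_of_re_pos (by rw [hre]; exact hc)
  have hG2 : Complex.Gamma ((Ψ : ℂ) + s) ≠ 0 :=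
    Complex.Gamma_ne_zero_of_re_pos (by simp [hre]; linarith)
  have e1 : Complex.Gamma (1 + s) = s * Complex.Gamma s := by
    rw [add_comm, Complex.Gamma_add_one _ hs]
  have e2 : Complex.Gamma (1 + (Ψ : ℂ) + s) = (Ψ + s) * Complex.Gamma (Ψ + s) := by
    rw [← Complex.Gamma_add_one _ hs2]; ring_nf
  have f1 : Finset.univ.filter (fun j : Fin 3 => (j : ℕ) < 1) = {0} := by decide
  have f2 : Finset.univ.filter (fun j : Fin 2 => (j : ℕ) < 2) = {0, 1} := by decide
  have f3 : Finset.univ.filter (fun j : Fin 3 => 1 ≤ (j : ℕ)) = {1, 2} := by decide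
  have f4 : Finset.univ.filter (fun j : Fin 2 => 2 ≤ (j : ℕ)) = ∅ := by decide
  rw [meijerIntegrand, f1, f2, f3, f4]
  rw [Finset.prod_pair (by decide), Finset.prod_pair (by decide)]
  simp only [Finset.prod_singleton, Finset.prod_empty, Matrix.cons_val_zero, Matrix.cons_val_one,
    Matrix.cons_val, sub_sub_cancel, sub_self, zero_add, sub_zero, sub_neg_eq_add, mul_one]
  rw [e1, e2]
  congr 1
  field_simp

open Complex in
theorem meijerG_one_one_eq {ρ z : ℝ} (hρ : 0 < ρ) (hz : 0 < z) {b : Fin 2 → ℂ} (hb0 : b 0 = 0)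
    (hb1 : b 1 = -(ρ : ℂ)) :
    meijerG 1 1 ![1 - (ρ : ℂ)] b (z : ℂ) = (powerAvg ρ (fun t => Real.exp (-t)) z : ℂ) := by
  have hex : ∃ c : ℝ, MeijerSeparates 1 1 ![1 - (ρ : ℂ)] b c := by
    refine ⟨-(ρ / 2), ?_, ?_⟩
    · intro j _
      fin_cases j
      simp
      linarith
    · intro j hj
      fin_cases j
      · simp [hb0]; linarith
      · simp at hj
  rw [meijerG, dif_pos hex]
  obtain ⟨h1, h2⟩ := hex.choose_spec
  set c := hex.choose
  have hcρ : -ρ < c := by simpa using h1 0 (by simp)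
  have hc : c < 0 := by simpa [hb0] using h2 0 (by simp)
  rw [← integral_Gamma_neg_div_cpow hz hc hcρ]
  congr 1
  refine integral_congr_ae (Eventually.of_forall fun t => ?_)
  simp only
  have hs2 : ((ρ : ℂ) + (c + t * I)) ≠ 0 := by
    intro h0
    have := congrArg Complex.re h0
    simp at this
    linarith
  generalize hsdef : ((c : ℂ) + t * I) = s at *
  have hre : s.re = c := by rw [← hsdef]; simp
  have hG2 : Complex.Gamma ((ρ : ℂ) + s) ≠ 0 :=
    Complex.Gamma_ne_zero_of_re_pos (by simp [hre]; linarith)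
  have e2 : Complex.Gamma (1 + (ρ : ℂ) + s) = (ρ + s) * Complex.Gamma (ρ + s) := by
    rw [← Complex.Gamma_add_one _ hs2]; ring_nf
  have f1 : Finset.univ.filter (fun j : Fin 2 => (j : ℕ) < 1) = {0} := by decide
  have f2 : Finset.univ.filter (fun j : Fin 1 => (j : ℕ) < 1) = {0} := by decide
  have f3 : Finset.univ.filter (fun j : Fin 2 => 1 ≤ (j : ℕ)) = {1} := by decide
  have f4 : Finset.univ.filter (fun j : Fin 1 => 1 ≤ (j : ℕ)) = ∅ := by decide
  rw [meijerIntegrand, f1, f2, f3, f4]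
  simp only [Finset.prod_singleton, Finset.prod_empty, Matrix.cons_val_zero, hb0, hb1,
    sub_sub_cancel, zero_sub, sub_neg_eq_add, mul_one]
  rw [e2]
  congr 1
  field_simp

open Complex in
-- The duplication formula `Γ(-s) Γ(1/2 - s) = 2^(1+2s) √π Γ(-2s)` turns the integrand into the
-- kernel `Γ(-w) / (ρ + w)` in the variable `w = 2s` at the point `2√z`. The Jacobian `1/2` of `t ↦
-- 2t` reduces the constant `4√π` to `2√π`.
theorem meijerG_two_one_eq {ρ z : ℝ} (hρ : 0 < ρ) (hz : 0 < z) {b : Fin 3 → ℂ} (hb0 : b 0 = 0)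
    (hb1 : b 1 = 1 / 2) (hb2 : b 2 = -((ρ / 2 : ℝ) : ℂ)) :
    meijerG 2 1 ![1 - ((ρ / 2 : ℝ) : ℂ)] b (z : ℂ) =
      ((2 * Real.sqrt Real.pi *
        powerAvg ρ (fun t => Real.exp (-t)) (2 * Real.sqrt z) : ℝ) : ℂ) := by
  have hex : ∃ c : ℝ, MeijerSeparates 2 1 ![1 - ((ρ / 2 : ℝ) : ℂ)] b c := by
    refine ⟨-(ρ / 4), ?_, ?_⟩
    · intro j _
      fin_cases j
      simp
      linarith
    · intro j hj
      fin_cases j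
      · simp [hb0]; linarith
      · simp [hb1]; linarith
      · simp at hj
  rw [meijerG, dif_pos hex]
  obtain ⟨h1, h2⟩ := hex.choose_spec
  set c := hex.choose
  have hcρ : -(ρ / 2) < c := by
    have := h1 0 (by simp)
    simp at this
    linarith
  have hc : c < 0 := by simpa [hb0] using h2 0 (by simp)
  have hz2 : 0 < 2 * Real.sqrt z := by positivity
  rw [ofReal_mul, ← integral_Gamma_neg_div_cpow (ρ := ρ) (c := 2 * c) hz2 (by linarith)
    (by linarith)]
  set G : ℝ → ℂ := fun t => Complex.Gamma (-(((2 * c : ℝ) : ℂ) + t * I)) /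
      (ρ + (((2 * c : ℝ) : ℂ) + t * I)) *
        ((2 * Real.sqrt z : ℝ) : ℂ) ^ (((2 * c : ℝ) : ℂ) + t * I : ℂ) with hG
  have hscale := Measure.integral_comp_mul_left G 2
  have key : ∀ t : ℝ, meijerIntegrand 2 1 ![1 - ((ρ / 2 : ℝ) : ℂ)] b z (c + t * I) =
      (4 * Real.sqrt Real.pi : ℂ) * G (2 * t) := by
    intro t
    have hs2 : (((ρ / 2 : ℝ) : ℂ) + (c + t * I)) ≠ 0 := by
      intro h0
      have := congrArg Complex.re h0
      simp at this
      linarith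
    have hu : (((2 * c : ℝ) : ℂ) + ((2 * t : ℝ) : ℂ) * I) = 2 * (c + t * I) := by push_cast; ring
    simp only [hG, hu]
    have hre : ((c : ℂ) + t * I).re = c := by simp
    generalize ((c : ℂ) + t * I) = s at *
    have hG2 : Complex.Gamma (((ρ / 2 : ℝ) : ℂ) + s) ≠ 0 :=
      Complex.Gamma_ne_zero_of_re_pos (by simp [hre]; linarith)
    have e2 : Complex.Gamma (1 + ((ρ / 2 : ℝ) : ℂ) + s) =
        (((ρ / 2 : ℝ) : ℂ) + s) * Complex.Gamma (((ρ / 2 : ℝ) : ℂ) + s) := by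
      rw [← Complex.Gamma_add_one _ hs2]; ring_nf
    have f1 : Finset.univ.filter (fun j : Fin 3 => (j : ℕ) < 2) = {0, 1} := by decide
    have f2 : Finset.univ.filter (fun j : Fin 1 => (j : ℕ) < 1) = {0} := by decide
    have f3 : Finset.univ.filter (fun j : Fin 3 => 2 ≤ (j : ℕ)) = {2} := by decide
    have f4 : Finset.univ.filter (fun j : Fin 1 => 1 ≤ (j : ℕ)) = ∅ := by decide
    rw [meijerIntegrand, f1, f2, f3, f4, Finset.prod_pair (by decide)]
    simp only [Finset.prod_singleton, Finset.prod_empty, Matrix.cons_val_zero, hb0, hb1, hb2,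
      sub_sub_cancel, zero_sub, sub_neg_eq_add, mul_one]
    have hdup := Complex.Gamma_mul_Gamma_add_half (-s)
    rw [show (1 / 2 : ℂ) - s = -s + 1 / 2 by ring, hdup, e2]
    have hpow : ((2 * Real.sqrt z : ℝ) : ℂ) ^ (2 * s) = (2 : ℂ) ^ (2 * s) * (z : ℂ) ^ s := by
      rw [ofReal_mul, mul_cpow_ofReal_nonneg (by norm_num) (Real.sqrt_nonneg _)]
      congr 1
      rw [show (2 : ℂ) * s = ((2 : ℕ) : ℂ) * s by norm_num, cpow_nat_mul', ← ofReal_pow,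
        Real.sq_sqrt hz.le] <;>
        rw [Complex.arg_ofReal_of_nonneg (Real.sqrt_nonneg _)] <;> simp [Real.pi_pos, Real.pi_pos.le]
    have h2pow : (2 : ℂ) ^ (1 - 2 * -s) = 2 * 2 ^ (2 * s) := by
      rw [show (1 : ℂ) - 2 * -s = 1 + 2 * s by ring, cpow_add _ _ two_ne_zero, cpow_one]
    rw [hpow, h2pow, show (2 : ℂ) * -s = -(2 * s) by ring]
    have hs3 : (ρ : ℂ) + 2 * s ≠ 0 := by
      intro h0
      apply hs2
      push_cast
      linear_combination h0 / 2
    have hs4 : (((ρ / 2 : ℝ) : ℂ) + s) = (ρ + 2 * s) / 2 := by push_cast; ring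
    rw [hs4] at hG2 ⊢
    field_simp
    ring
  simp_rw [key]
  rw [integral_const_mul, hscale]
  simp only [hG]
  rw [← Complex.coe_smul, smul_eq_mul, abs_of_pos (by norm_num)]
  push_cast
  ring

/-- Puts both detectors in the form suggested by Gauss's multiplication formula, whose constant `√r
(2π)^((r-1)/2)` is `1` for `r = 1` and `2√π` for `r = 2`. -/
theorem meijerG_detector_eq {r : ℕ} (hr : r = 1 ∨ r = 2) {ρ z : ℝ} (hρ : 0 < ρ) (hz : 0 < z) :
    meijerG r 1 ![1 - ((ρ / r : ℝ) : ℂ)]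
      (fun j : Fin (r + 1) => if (j : ℕ) < r then (j : ℕ) / (r : ℂ) else -((ρ / r : ℝ) : ℂ))
      (z : ℂ) =
      ((Real.sqrt r * (2 * Real.pi) ^ (((r : ℝ) - 1) / 2) *
        powerAvg ρ (fun t => Real.exp (-t)) (r * z ^ (1 / (r : ℝ))) : ℝ) : ℂ) := by
  rcases hr with rfl | rfl
  · have h := meijerG_one_one_eq hρ hz
      (b := fun j : Fin 2 => if (j : ℕ) < 1 then (j : ℕ) / ((1 : ℕ) : ℂ)
        else -((ρ / (1 : ℕ) : ℝ) : ℂ)) (by simp) (by simp)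
    simpa using h
  · have h := meijerG_two_one_eq hρ hz
      (b := fun j : Fin 3 => if (j : ℕ) < 2 then (j : ℕ) / ((2 : ℕ) : ℂ)
        else -((ρ / (2 : ℕ) : ℝ) : ℂ)) (by simp) (by simp) (by simp)
    have h2 : Real.sqrt (2 : ℕ) * (2 * Real.pi) ^ ((((2 : ℕ) : ℝ) - 1) / 2) =
        2 * Real.sqrt Real.pi := by
      rw [show (((2 : ℕ) : ℝ) - 1) / 2 = 1 / 2 by norm_num, ← Real.sqrt_eq_rpow,
        Real.sqrt_mul (by norm_num), ← mul_assoc]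
      norm_num
    have h3 : ((2 : ℕ) : ℝ) * z ^ (1 / ((2 : ℕ) : ℝ)) = 2 * Real.sqrt z := by
      rw [Real.sqrt_eq_rpow]; norm_num
    rw [h2, h3, ← h]
    simp

/-! ## The κ-μ density as a mixture -/

/-- The `k`-th term of the κ-μ density, without the factor `1 / (k! Γ(m + k))`. -/
noncomputable def kappaMuTerm (κ m : ℝ) (k : ℕ) (x : ℝ) : ℝ :=
  2 * (Real.exp (-(m * κ)) * (m * κ) ^ k) * kappaMuRate κ m ^ (m + k) *
    (x ^ (2 * (m + k) - 1) * Real.exp (-kappaMuRate κ m * x ^ 2))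

theorem kappaMuRate_pos {κ m : ℝ} (hκ : 0 < κ) (hm : 0 < m) : 0 < kappaMuRate κ m := by
  unfold kappaMuRate; positivity

/-- The half-integer shifts in the exponents of the prefactor cancel against those in `(M x /
2)^(m-1+2k)`: of `κ` only `κ^k` survives, and the powers of `m` and `1 + κ` assemble to `m^k` and
the rate to the power `m + k`. -/
theorem kappaMuPDF_prefactor_mul {κ m x : ℝ} (hκ : 0 < κ) (hm : 0 < m) (hx : 0 < x) (k : ℕ) :
    2 * m * (1 + κ) ^ ((m + 1) / 2) / (κ ^ ((m - 1) / 2) * Real.exp (m * κ)) *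
      x ^ m * Real.exp (-kappaMuRate κ m * x ^ 2) *
      (2 * m * Real.sqrt (κ * (1 + κ)) * x / 2) ^ (m - 1 + 2 * k) = kappaMuTerm κ m k x := by
  have h1 : 2 * m * Real.sqrt (κ * (1 + κ)) * x / 2 = m * (κ ^ (1 / 2 : ℝ) *
      (1 + κ) ^ (1 / 2 : ℝ)) * x := by
    rw [Real.sqrt_eq_rpow, Real.mul_rpow hκ.le (by linarith)]; ring
  have hκ1 : 0 < 1 + κ := by linarith
  rw [h1, kappaMuTerm]
  rw [Real.mul_rpow (by positivity) hx.le, Real.mul_rpow hm.le (by positivity),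
    Real.mul_rpow (by positivity) (by positivity), ← Real.rpow_mul hκ.le, ← Real.rpow_mul hκ1.le]
  have hB : kappaMuRate κ m ^ (m + k) = m ^ (m + k) * (1 + κ) ^ (m + k) := by
    rw [kappaMuRate, Real.mul_rpow hm.le hκ1.le]
  rw [hB, Real.exp_neg, mul_pow, ← Real.rpow_natCast m k, ← Real.rpow_natCast κ k]
  have e1 : κ ^ (1 / 2 * (m - 1 + 2 * k)) = κ ^ ((m - 1) / 2) * κ ^ (k : ℝ) := by
    rw [← Real.rpow_add hκ]; ring_nf
  have e2 : (1 + κ) ^ (m + k) = (1 + κ) ^ ((m + 1) / 2) * (1 + κ) ^ (1 / 2 * (m - 1 + 2 * k)) := by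
    rw [← Real.rpow_add hκ1]; ring_nf
  have e3 : x ^ (2 * (m + k) - 1) = x ^ m * x ^ (m - 1 + 2 * k) := by
    rw [← Real.rpow_add hx]; ring_nf
  have e4 : m * m ^ (m - 1 + 2 * k) = m ^ (m + k) * m ^ (k : ℝ) := by
    rw [← Real.rpow_add hm, mul_comm, ← Real.rpow_add_one hm.ne']; ring_nf
  rw [e1, e2, e3]
  have h3 : 0 < κ ^ ((m - 1) / 2) := by positivity
  field_simp
  linear_combination e4

theorem kappaMuPDF_besselI {κ m x : ℝ} (hκ : 0 < κ) (hm : 0 < m) (hx : 0 < x) :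
    kappaMuPDF besselI κ m x =
      ∑' k : ℕ, kappaMuTerm κ m k x / ((k.factorial : ℝ) * Real.Gamma (m + k)) := by
  rw [kappaMuPDF, besselI, ← tsum_mul_left]
  refine tsum_congr fun k => ?_
  rw [← mul_div_assoc, kappaMuPDF_prefactor_mul hκ hm hx]
  ring_nf

theorem kappaMuPDF_besselApprox {κ m x : ℝ} (hκ : 0 < κ) (hm : 0 < m) (hx : 0 < x) (p : ℕ) :
    kappaMuPDF (besselApprox p) κ m x =
      ∑ k ∈ Finset.range (p + 1), besselCoeff k p (m - 1) * kappaMuTerm κ m k x := by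
  rw [kappaMuPDF, besselApprox, Finset.mul_sum]
  refine Finset.sum_congr rfl fun k _ => ?_
  rw [← kappaMuPDF_prefactor_mul hκ hm hx]
  ring

theorem kappaMuTerm_nonneg {κ m x : ℝ} (hκ : 0 < κ) (hm : 0 < m) (hx : 0 ≤ x) (k : ℕ) :
    0 ≤ kappaMuTerm κ m k x := by
  have := kappaMuRate_pos hκ hm
  unfold kappaMuTerm
  positivity

theorem kappaMuPDF_besselI_nonneg {κ m x : ℝ} (hκ : 0 < κ) (hm : 0 < m) (hx : 0 < x) :
    0 ≤ kappaMuPDF besselI κ m x := by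
  rw [kappaMuPDF_besselI hκ hm hx]
  refine tsum_nonneg fun k => div_nonneg (kappaMuTerm_nonneg hκ hm hx.le k) ?_
  have : 0 < Real.Gamma (m + k) := Real.Gamma_pos_of_pos (by positivity)
  positivity

/-! ### Moment generating function of the squared envelope -/

theorem kappaMuTerm_mul_exp (κ m : ℝ) (k : ℕ) (s x : ℝ) :
    kappaMuTerm κ m k x * Real.exp (s * x ^ 2) =
      2 * (Real.exp (-(m * κ)) * (m * κ) ^ k) * kappaMuRate κ m ^ (m + k) *
        (x ^ (2 * (m + k) - 1) * Real.exp (-(kappaMuRate κ m - s) * x ^ 2)) := by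
  rw [kappaMuTerm, mul_assoc, mul_assoc (_ ^ _), ← Real.exp_add]
  ring_nf

theorem integrableOn_kappaMuTerm_mul_exp {κ m s : ℝ} (hm : 0 < m)
    (hs : s < kappaMuRate κ m) (k : ℕ) :
    IntegrableOn (fun x => kappaMuTerm κ m k x * Real.exp (s * x ^ 2)) (Set.Ioi 0) := by
  simp_rw [kappaMuTerm_mul_exp]
  have : (0 : ℝ) ≤ k := k.cast_nonneg
  exact (integrableOn_rpow_mul_exp_neg_mul_sq (sub_pos.2 hs) (by linarith)).const_mul _

theorem integral_kappaMuTerm_mul_exp {κ m s : ℝ} (hκ : 0 < κ) (hm : 0 < m)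
    (hs : s < kappaMuRate κ m) (k : ℕ) :
    ∫ x in Set.Ioi 0, kappaMuTerm κ m k x * Real.exp (s * x ^ 2) =
      Real.exp (-(m * κ)) * (m * κ) ^ k * Real.Gamma (m + k) *
        (kappaMuRate κ m / (kappaMuRate κ m - s)) ^ (m + k) := by
  have hk : (0 : ℝ) ≤ k := k.cast_nonneg
  have hB := kappaMuRate_pos hκ hm
  simp_rw [kappaMuTerm_mul_exp]
  have h := integral_rpow_mul_exp_neg_mul_rpow (p := 2) (q := 2 * (m + k) - 1)
    (b := kappaMuRate κ m - s) two_pos (by linarith) (sub_pos.2 hs)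
  simp_rw [Real.rpow_two] at h
  rw [integral_const_mul, h, Real.div_rpow hB.le (sub_pos.2 hs).le,
    show -(2 * (m + k) - 1 + 1) / 2 = -(m + k) by ring,
    show (2 * (m + k) - 1 + 1) / 2 = m + k by ring, Real.rpow_neg (sub_pos.2 hs).le]
  ring

theorem hasSum_exp_mul_pow (lam θ : ℝ) :
    HasSum (fun k : ℕ => Real.exp (-lam) * lam ^ k / (k.factorial : ℝ) * θ ^ k)
      (Real.exp (lam * (θ - 1))) := by
  have h := (NormedSpace.expSeries_div_hasSum_exp (lam * θ)).mul_left (Real.exp (-lam))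
  rw [← Real.exp_eq_exp_ℝ, ← Real.exp_add] at h
  rw [show lam * (θ - 1) = -lam + lam * θ by ring]
  refine h.congr_fun fun k => ?_
  rw [mul_pow]; ring

/-- Tilting by `e^{s x²}` only lowers the rate from `B` to `B - s`, so the `k`-th gamma component
contributes `θ^(m+k)` with `θ = B / (B - s)`; the Poisson generating function sums these. -/
theorem integral_kappaMuPDF_mul_exp {κ m s : ℝ} (hκ : 0 < κ) (hm : 0 < m)
    (hs : s < kappaMuRate κ m) :
    ∫ x in Set.Ioi 0, kappaMuPDF besselI κ m x * Real.exp (s * x ^ 2) =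
      (kappaMuRate κ m / (kappaMuRate κ m - s)) ^ m *
        Real.exp (m * κ * (kappaMuRate κ m / (kappaMuRate κ m - s) - 1)) := by
  set θ := kappaMuRate κ m / (kappaMuRate κ m - s) with hθ
  have hB := kappaMuRate_pos hκ hm
  have hθ0 : 0 < θ := div_pos hB (sub_pos.2 hs)
  have hΓ : ∀ k : ℕ, 0 < Real.Gamma (m + k) := fun k => Real.Gamma_pos_of_pos (by positivity)
  have hint : ∀ k : ℕ, Integrable (fun x => kappaMuTerm κ m k x /
      ((k.factorial : ℝ) * Real.Gamma (m + k)) * Real.exp (s * x ^ 2))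
      (volume.restrict (Set.Ioi 0)) := by
    intro k
    refine ((integrableOn_kappaMuTerm_mul_exp hm hs k).div_const
      ((k.factorial : ℝ) * Real.Gamma (m + k))).congr (Eventually.of_forall fun x => ?_)
    ring
  have hval : ∀ k : ℕ, ∫ x in Set.Ioi 0, kappaMuTerm κ m k x /
      ((k.factorial : ℝ) * Real.Gamma (m + k)) * Real.exp (s * x ^ 2) =
      θ ^ m * (Real.exp (-(m * κ)) * (m * κ) ^ k / (k.factorial : ℝ) * θ ^ k) := by
    intro k
    simp_rw [div_mul_eq_mul_div]
    rw [integral_div, integral_kappaMuTerm_mul_exp hκ hm hs, ← hθ, Real.rpow_add hθ0,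
      Real.rpow_natCast]
    have := (hΓ k).ne'
    field_simp
  have hsum := (hasSum_exp_mul_pow (m * κ) θ).mul_left (θ ^ m)
  have h := hasSum_integral_of_summable_integral_norm hint ?_
  · simp_rw [hval] at h
    rw [← h.unique hsum]
    refine setIntegral_congr_fun measurableSet_Ioi fun x hx => ?_
    rw [tsum_mul_right, kappaMuPDF_besselI hκ hm hx]
  · refine hsum.summable.congr fun k => ?_
    rw [← hval]
    refine setIntegral_congr_fun measurableSet_Ioi fun x hx => ?_
    have h1 := kappaMuTerm_nonneg hκ hm (le_of_lt hx) k
    have h2 := hΓ k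
    rw [Real.norm_of_nonneg (by positivity)]

theorem integrableOn_kappaMuPDF_mul_exp {κ m s : ℝ} (hκ : 0 < κ) (hm : 0 < m)
    (hs : s < kappaMuRate κ m) :
    IntegrableOn (fun x => kappaMuPDF besselI κ m x * Real.exp (s * x ^ 2)) (Set.Ioi 0) := by
  -- The integral of a non-integrable function is `0` by convention, so the nonzero value just
  -- computed already proves integrability.
  refine Integrable.of_integral_ne_zero ?_
  rw [integral_kappaMuPDF_mul_exp hκ hm hs]
  have hθ0 := div_pos (kappaMuRate_pos hκ hm) (sub_pos.2 hs)
  positivity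

theorem integrableOn_kappaMuPDF {κ m : ℝ} (hκ : 0 < κ) (hm : 0 < m) :
    IntegrableOn (fun x => kappaMuPDF besselI κ m x) (Set.Ioi 0) := by
  simpa using integrableOn_kappaMuPDF_mul_exp hκ hm (kappaMuRate_pos hκ hm)

/-! ### Distribution functions of the envelope and of its approximation -/

theorem intervalIntegrable_kappaMuTerm {κ m y : ℝ} (hκ : 0 < κ) (hm : 0 < m) (hy : 0 ≤ y) (k : ℕ) :
    IntervalIntegrable (kappaMuTerm κ m k) volume 0 y := by
  rw [intervalIntegrable_iff_integrableOn_Ioc_of_le hy]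
  have := integrableOn_kappaMuTerm_mul_exp hm (kappaMuRate_pos hκ hm) k
  simp only [zero_mul, Real.exp_zero, mul_one] at this
  exact this.mono_set Set.Ioc_subset_Ioi_self

/-- The substitution `t = B x²` with `B` the rate. -/
theorem integral_kappaMuTerm {κ m y : ℝ} (hκ : 0 < κ) (hm : 0 < m) (hy : 0 ≤ y) (k : ℕ) :
    ∫ x in (0 : ℝ)..y, kappaMuTerm κ m k x =
      Real.exp (-(m * κ)) * (m * κ) ^ k * lowerGamma (m + k) (kappaMuRate κ m * y ^ 2) := by
  have hk : (0 : ℝ) ≤ k := k.cast_nonneg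
  have hB := kappaMuRate_pos hκ hm
  set B := kappaMuRate κ m with hBdef
  have hEq : ∀ x ∈ Set.Ioc 0 y, kappaMuTerm κ m k x = Real.exp (-(m * κ)) * (m * κ) ^ k *
      (((fun t : ℝ => t ^ (m + k - 1) * Real.exp (-t)) ∘ fun x => B * x ^ 2) x * (B * (2 * x))) := by
    intro x hx
    rw [kappaMuTerm, ← hBdef]
    simp only [Function.comp]
    have e1 : (B * x ^ 2) ^ (m + k - 1) * (B * x) = B ^ (m + k) * x ^ (2 * (m + k) - 1) := by
      rw [Real.mul_rpow hB.le (by positivity), ← Real.rpow_two, ← Real.rpow_mul hx.1.le]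
      have a1 : B ^ (m + k) = B ^ (m + k - 1) * B := by
        rw [← Real.rpow_add_one hB.ne']; ring_nf
      have a2 : x ^ (2 * (m + k) - 1) = x ^ (2 * (m + k - 1)) * x := by
        rw [← Real.rpow_add_one hx.1.ne']; ring_nf
      rw [a1, a2]; ring
    rw [neg_mul]
    linear_combination (-2 * (Real.exp (-(m * κ)) * (m * κ) ^ k)) * Real.exp (-(B * x ^ 2)) * e1
  have hint := intervalIntegrable_kappaMuTerm hκ hm hy k
  rw [intervalIntegral.integral_of_le hy, setIntegral_congr_fun measurableSet_Ioc hEq,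
    integral_const_mul, ← intervalIntegral.integral_of_le hy]
  congr 1
  have hpos : 0 < Real.exp (-(m * κ)) * (m * κ) ^ k := by positivity
  rw [intervalIntegral.integral_comp_mul_deriv''' (by fun_prop)]
  · simp [lowerGamma]
  · intro x _
    have := ((hasDerivAt_pow 2 x).const_mul B).hasDerivWithinAt (s := Set.Ioi x)
    simpa using this
  · rintro _ ⟨x, hx, rfl⟩
    rw [min_eq_left hy, max_eq_right hy] at hx
    refine ContinuousAt.continuousWithinAt ?_
    have h0 : 0 < B * x ^ 2 := by have := hx.1; positivity
    exact (Real.continuousAt_rpow_const _ _ (Or.inl h0.ne')).mul (by fun_prop)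
  · refine IntegrableOn.mono_set (t := Set.uIcc 0 (B * y ^ 2))
      ((intervalIntegrable_iff').1 (intervalIntegrable_lowerGamma (by linarith) _ _)) ?_
    rintro _ ⟨x, hx, rfl⟩
    rw [Set.uIcc_of_le hy] at hx
    rw [Set.uIcc_of_le (by positivity)]
    have := hx.1
    exact ⟨by positivity, mul_le_mul_of_nonneg_left (pow_le_pow_left₀ hx.1 hx.2 2) hB.le⟩
  · rw [← intervalIntegrable_iff', intervalIntegrable_iff_integrableOn_Ioc_of_le hy]
    rw [intervalIntegrable_iff_integrableOn_Ioc_of_le hy] at hint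
    have h2 := (hint.congr_fun hEq measurableSet_Ioc).const_mul
      (Real.exp (-(m * κ)) * (m * κ) ^ k)⁻¹
    refine h2.congr (Eventually.of_forall fun x => ?_)
    simp only
    rw [inv_mul_cancel_left₀ hpos.ne']

/-- The distribution function of the squared κ-μ envelope, as a Poisson mixture of gamma
distribution functions. -/
theorem hasSum_integral_kappaMuPDF {κ m y : ℝ} (hκ : 0 < κ) (hm : 0 < m) (hy : 0 ≤ y) :
    HasSum (fun k : ℕ => Real.exp (-(m * κ)) * (m * κ) ^ k / (k.factorial : ℝ) *
        (lowerGamma (m + k) (kappaMuRate κ m * y ^ 2) / Real.Gamma (m + k)))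
      (∫ x in (0 : ℝ)..y, kappaMuPDF besselI κ m x) := by
  have hB := kappaMuRate_pos hκ hm
  have hΓ : ∀ k : ℕ, 0 < Real.Gamma (m + k) := fun k => Real.Gamma_pos_of_pos (by positivity)
  have hint : ∀ k : ℕ, Integrable (fun x => kappaMuTerm κ m k x /
      ((k.factorial : ℝ) * Real.Gamma (m + k))) (volume.restrict (Set.Ioc 0 y)) := fun k =>
    ((intervalIntegrable_iff_integrableOn_Ioc_of_le hy).1
      (intervalIntegrable_kappaMuTerm hκ hm hy k)).div_const _
  have hval : ∀ k : ℕ, ∫ x in Set.Ioc 0 y, kappaMuTerm κ m k x /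
      ((k.factorial : ℝ) * Real.Gamma (m + k)) =
      Real.exp (-(m * κ)) * (m * κ) ^ k / (k.factorial : ℝ) *
        (lowerGamma (m + k) (kappaMuRate κ m * y ^ 2) / Real.Gamma (m + k)) := by
    intro k
    rw [integral_div, ← intervalIntegral.integral_of_le hy, integral_kappaMuTerm hκ hm hy]
    have := (hΓ k).ne'
    field_simp
  have h := hasSum_integral_of_summable_integral_norm hint ?_
  · simp_rw [hval] at h
    have hEq : ∫ x in (0 : ℝ)..y, kappaMuPDF besselI κ m x = ∫ x in Set.Ioc 0 y,
        ∑' k : ℕ, kappaMuTerm κ m k x / ((k.factorial : ℝ) * Real.Gamma (m + k)) := by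
      rw [intervalIntegral.integral_of_le hy]
      exact setIntegral_congr_fun measurableSet_Ioc fun x hx => kappaMuPDF_besselI hκ hm hx.1
    rwa [hEq]
  · have hP := (hasSum_exp_mul_pow (m * κ) 1).summable
    simp only [one_pow, mul_one] at hP
    refine Summable.of_nonneg_of_le (fun k => integral_nonneg fun _ => norm_nonneg _)
      (fun k => ?_) hP
    have h1 : ∫ x in Set.Ioc 0 y, ‖kappaMuTerm κ m k x /
        ((k.factorial : ℝ) * Real.Gamma (m + k))‖ = ∫ x in Set.Ioc 0 y, kappaMuTerm κ m k x /
        ((k.factorial : ℝ) * Real.Gamma (m + k)) := by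
      refine setIntegral_congr_fun measurableSet_Ioc fun x hx => ?_
      have h1 := kappaMuTerm_nonneg hκ hm hx.1.le k
      have h2 := hΓ k
      rw [Real.norm_of_nonneg (by positivity)]
    rw [h1, hval]
    refine mul_le_of_le_one_right (by positivity) ?_
    rw [div_le_one (hΓ k)]
    exact lowerGamma_le_Gamma (by positivity) (by positivity)

theorem integral_kappaMuPDF_besselApprox {κ m y : ℝ} (hκ : 0 < κ) (hm : 0 < m) (hy : 0 ≤ y)
    (p : ℕ) :
    ∫ x in (0 : ℝ)..y, kappaMuPDF (besselApprox p) κ m x =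
      ∑ k ∈ Finset.range (p + 1), besselCoeff k p (m - 1) *
        (Real.exp (-(m * κ)) * (m * κ) ^ k * lowerGamma (m + k) (kappaMuRate κ m * y ^ 2)) := by
  simp_rw [← integral_kappaMuTerm hκ hm hy, ← intervalIntegral.integral_const_mul]
  rw [← intervalIntegral.integral_finsetSum fun k _ =>
    (intervalIntegrable_kappaMuTerm hκ hm hy k).const_mul _]
  rw [intervalIntegral.integral_of_le hy, intervalIntegral.integral_of_le hy]
  exact setIntegral_congr_fun measurableSet_Ioc fun x hx =>
    kappaMuPDF_besselApprox hκ hm hx.1 p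

/-! ## Laws with a density -/

theorem integral_withDensity_ofReal {s : Set ℝ} (hs : MeasurableSet s) {f : ℝ → ℝ}
    (hf : IntegrableOn f s) (h0 : ∀ x ∈ s, 0 ≤ f x) (g : ℝ → ℝ) :
    ∫ x, g x ∂((volume.restrict s).withDensity fun x => ENNReal.ofReal (f x)) =
      ∫ x in s, f x * g x := by
  rw [integral_withDensity_eq_integral_toReal_smul₀
    hf.aestronglyMeasurable.aemeasurable.ennreal_ofReal
    (Eventually.of_forall fun _ => ENNReal.ofReal_lt_top)]
  refine setIntegral_congr_fun hs fun x hx => ?_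
  simp only [smul_eq_mul]
  rw [ENNReal.toReal_ofReal (h0 x hx)]

theorem measureReal_withDensity_ofReal {s t : Set ℝ} (hs : MeasurableSet s) (ht : MeasurableSet t)
    {f : ℝ → ℝ} (hf : IntegrableOn f s) (h0 : ∀ x ∈ s, 0 ≤ f x) :
    ((volume.restrict s).withDensity fun x => ENNReal.ofReal (f x)).real t =
      ∫ x in t ∩ s, f x := by
  rw [measureReal_def, withDensity_apply _ ht, Measure.restrict_restrict ht,
    integral_eq_lintegral_of_nonneg_ae]
  · filter_upwards [ae_restrict_mem (ht.inter hs)] with x hx using h0 x hx.2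
  · exact (hf.mono_set Set.inter_subset_right).aestronglyMeasurable

/-- Two random variables whose moment generating functions are finite and agree on a half-line
around `0` have the same law. -/
theorem map_eq_of_mgf_eq {Ω Ω' : Type*} [MeasurableSpace Ω] [MeasurableSpace Ω'] {μ : Measure Ω}
    {ν : Measure Ω'} [IsFiniteMeasure μ] [IsFiniteMeasure ν] {X : Ω → ℝ} {Y : Ω' → ℝ}
    (hX : AEMeasurable X μ) (hY : AEMeasurable Y ν) {B : ℝ} (hB : 0 < B)
    (hXi : ∀ t < B, Integrable (fun ω => Real.exp (t * X ω)) μ)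
    (hYi : ∀ t < B, Integrable (fun ω => Real.exp (t * Y ω)) ν)
    (h : ∀ t < B, mgf X μ t = mgf Y ν t) : μ.map X = ν.map Y := by
  have hsX : {z : ℂ | z.re < B} ⊆ {z | z.re ∈ interior (integrableExpSet X μ)} := fun z hz =>
    interior_maximal (fun t ht => hXi t ht) isOpen_Iio hz
  have hsY : {z : ℂ | z.re < B} ⊆ {z | z.re ∈ interior (integrableExpSet Y ν)} := fun z hz =>
    interior_maximal (fun t ht => hYi t ht) isOpen_Iio hz
  -- Both complex moment generating functions are analytic on the half-plane `Re z < B` and agree on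
  -- the reals near `0`. The identity theorem extends this to the imaginary axis, where they are the
  -- characteristic functions.
  have hEq : Set.EqOn (complexMGF X μ) (complexMGF Y ν) {z : ℂ | z.re < B} := by
    refine AnalyticOnNhd.eqOn_of_preconnected_of_frequently_eq (analyticOnNhd_complexMGF.mono hsX)
      (analyticOnNhd_complexMGF.mono hsY) (convex_halfSpace_re_lt B).isPreconnected
      (z₀ := ((0 : ℝ) : ℂ)) (by simpa using hB) ?_
    have h_real : ∃ᶠ x : ℝ in 𝓝[≠] (0 : ℝ), complexMGF X μ x = complexMGF Y ν x := by
      refine Eventually.frequently ?_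
      filter_upwards [mem_nhdsWithin_of_mem_nhds (Iio_mem_nhds hB)] with t ht
      rw [complexMGF_ofReal, complexMGF_ofReal, h t ht]
    rw [frequently_iff_seq_forall] at h_real ⊢
    obtain ⟨xs, hx_tendsto, hx_eq⟩ := h_real
    refine ⟨fun n ↦ xs n, ?_, fun n ↦ by simp [hx_eq]⟩
    rw [tendsto_nhdsWithin_iff] at hx_tendsto ⊢
    exact ⟨(Complex.continuous_ofReal.tendsto 0).comp hx_tendsto.1, by simpa using hx_tendsto.2⟩
  refine Measure.ext_of_charFun (funext fun t => ?_)
  rw [← complexMGF_mul_I hX, ← complexMGF_mul_I hY]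
  exact hEq (by simpa using hB)

/-! ## The κ-μ law -/

theorem integral_kappaMuLaw {κ m : ℝ} (hκ : 0 < κ) (hm : 0 < m) (g : ℝ → ℝ) :
    ∫ x, g x ∂(kappaMuLaw κ m) = ∫ x in Set.Ioi 0, kappaMuPDF besselI κ m x * g x :=
  integral_withDensity_ofReal measurableSet_Ioi (integrableOn_kappaMuPDF hκ hm)
    (fun _ hx => kappaMuPDF_besselI_nonneg hκ hm hx) g

theorem isFiniteMeasure_kappaMuLaw {κ m : ℝ} (hκ : 0 < κ) (hm : 0 < m) :
    IsFiniteMeasure (kappaMuLaw κ m) :=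
  isFiniteMeasure_withDensity_ofReal (integrableOn_kappaMuPDF hκ hm).2

theorem mgf_mul_sq_kappaMuLaw {κ m c t : ℝ} (hκ : 0 < κ) (hm : 0 < m)
    (ht : t * c < kappaMuRate κ m) :
    mgf (fun x => c * x ^ 2) (kappaMuLaw κ m) t =
      (kappaMuRate κ m / (kappaMuRate κ m - t * c)) ^ m *
        Real.exp (m * κ * (kappaMuRate κ m / (kappaMuRate κ m - t * c) - 1)) := by
  rw [← integral_kappaMuPDF_mul_exp hκ hm ht, mgf, integral_kappaMuLaw hκ hm]
  simp only [mul_assoc]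

theorem mgf_mul_sq_kappaMuLaw_pos {κ m c t : ℝ} (hκ : 0 < κ) (hm : 0 < m)
    (ht : t * c < kappaMuRate κ m) : 0 < mgf (fun x => c * x ^ 2) (kappaMuLaw κ m) t := by
  rw [mgf_mul_sq_kappaMuLaw hκ hm ht]
  have := div_pos (kappaMuRate_pos hκ hm) (sub_pos.2 ht)
  positivity

/-- The sum of the squares of `L` independent κ-μ envelopes is `L` times the square of a κ-μ
envelope with the parameters `κ`, `L μ`. -/
theorem map_sum_sq_eq {Ω : Type*} [MeasurableSpace Ω] {P : Measure Ω} [IsProbabilityMeasure P]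
    {κ μ : ℝ} (hκ : 0 < κ) (hμ : 0 < μ) {L : ℕ} (hL : 0 < L) {h : Fin L → Ω → ℝ}
    (hh : ∀ l, HasLaw (h l) (kappaMuLaw κ μ) P) (hi : iIndepFun h P) :
    P.map (fun ω => ∑ l, h l ω ^ 2) =
      (kappaMuLaw κ (L * μ)).map (fun x => (L : ℝ) * x ^ 2) := by
  have hL' : (0 : ℝ) < L := by exact_mod_cast hL
  have hLμ : 0 < L * μ := by positivity
  have := isFiniteMeasure_kappaMuLaw hκ hLμ
  have hB := kappaMuRate_pos hκ hμ
  have hrate : kappaMuRate κ (L * μ) = L * kappaMuRate κ μ := by unfold kappaMuRate; ring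
  have hmeas : ∀ l, AEMeasurable (fun ω => h l ω ^ 2) P := fun l =>
    (hh l).aemeasurable.pow_const 2
  have hi2 : iIndepFun (fun l ω => h l ω ^ 2) P := hi.comp (fun _ x => x ^ 2) (by fun_prop)
  have hmgf1 : ∀ l t, t < kappaMuRate κ μ → mgf (fun ω => h l ω ^ 2) P t =
      (kappaMuRate κ μ / (kappaMuRate κ μ - t)) ^ μ *
        Real.exp (μ * κ * (kappaMuRate κ μ / (kappaMuRate κ μ - t) - 1)) := by
    intro l t ht
    have h1 := mgf_mul_sq_kappaMuLaw (c := 1) hκ hμ (t := t) (by simpa using ht)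
    rw [mul_one] at h1
    rw [← h1, ← (hh l).map_eq, mgf_map (hh l).aemeasurable (by fun_prop)]
    congr 1
    ext ω
    simp
  have hmgfS : ∀ t < kappaMuRate κ μ, mgf (fun ω => ∑ l, h l ω ^ 2) P t =
      mgf (fun x => (L : ℝ) * x ^ 2) (kappaMuLaw κ (L * μ)) t := by
    intro t ht
    have hS : (fun ω => ∑ l, h l ω ^ 2) = ∑ l, fun ω => h l ω ^ 2 := by ext ω; simp
    rw [hS, hi2.mgf_sum₀ hmeas, Finset.prod_congr rfl fun l _ => hmgf1 l t ht]
    have ht2 : t * L < kappaMuRate κ (L * μ) := by rw [hrate]; nlinarith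
    have hθ := div_pos hB (sub_pos.2 ht)
    -- The factor `L` in `L x²` compensates the combined rate `L B`, so the ratio `θ` is that of a
    -- single branch; hence the `L`-th power of one branch's generating function is the combined
    -- one.
    have hθe : kappaMuRate κ (L * μ) / (kappaMuRate κ (L * μ) - t * L) =
        kappaMuRate κ μ / (kappaMuRate κ μ - t) := by
      rw [hrate, mul_comm t, ← mul_sub, mul_div_mul_left _ _ hL'.ne']
    rw [mgf_mul_sq_kappaMuLaw hκ hLμ ht2, hθe]
    simp only [Finset.prod_const, Finset.card_univ, Fintype.card_fin]
    rw [mul_pow, ← Real.rpow_mul_natCast hθ.le, ← Real.exp_nat_mul]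
    ring_nf
  have hpos : ∀ t < kappaMuRate κ μ,
      0 < mgf (fun x => (L : ℝ) * x ^ 2) (kappaMuLaw κ (L * μ)) t := fun t ht =>
    mgf_mul_sq_kappaMuLaw_pos hκ hLμ (by rw [hrate]; nlinarith)
  refine map_eq_of_mgf_eq (by fun_prop) (by fun_prop) hB (fun t ht => ?_) (fun t ht => ?_) hmgfS
  · exact Integrable.of_integral_ne_zero (by rw [← mgf, hmgfS t ht]; exact (hpos t ht).ne')
  · exact Integrable.of_integral_ne_zero (hpos t ht).ne'

theorem measureReal_kappaMuLaw_mul_sq_le {κ m c T : ℝ} (hκ : 0 < κ) (hm : 0 < m) (hc : 0 < c)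
    (hT : 0 ≤ T) :
    ((kappaMuLaw κ m).map (fun x => c * x ^ 2)).real (Set.Iic T) =
      ∫ x in (0 : ℝ)..Real.sqrt (T / c), kappaMuPDF besselI κ m x := by
  have hset : (fun x : ℝ => c * x ^ 2) ⁻¹' Set.Iic T ∩ Set.Ioi 0 =
      Set.Ioc 0 (Real.sqrt (T / c)) := by
    ext x
    simp only [Set.mem_inter_iff, Set.mem_preimage, Set.mem_Iic, Set.mem_Ioi, Set.mem_Ioc]
    rw [and_comm]
    refine and_congr_right fun hx => ?_
    rw [Real.le_sqrt hx.le (by positivity), le_div_iff₀ hc, mul_comm]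
  have hmeas : Measurable fun x : ℝ => c * x ^ 2 := by fun_prop
  rw [map_measureReal_apply hmeas measurableSet_Iic, kappaMuLaw,
    measureReal_withDensity_ofReal measurableSet_Ioi (hmeas measurableSet_Iic)
      (integrableOn_kappaMuPDF hκ hm) (fun _ hx => kappaMuPDF_besselI_nonneg hκ hm hx), hset,
    intervalIntegral.integral_of_le (Real.sqrt_nonneg _)]

/-! ## The random-waypoint law and the law of the SNR of the RF hop -/

/-- `D` is a scale parameter, so all later averages are taken over the normalized distance on `[0,
1]`. -/
theorem rwpPDF_eq {D x : ℝ} (hD : 0 < D) :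
    rwpPDF D x = 1 / D * rwpPDF 1 (x / D) := by
  have e1 : (2 : ℝ) + 1 = (3 : ℕ) := by norm_num
  have e2 : (4 : ℝ) + 1 = (5 : ℕ) := by norm_num
  have e3 : (6 : ℝ) + 1 = (7 : ℕ) := by norm_num
  have f1 : (2 : ℝ) = (2 : ℕ) := by norm_num
  have f2 : (4 : ℝ) = (4 : ℕ) := by norm_num
  have f3 : (6 : ℝ) = (6 : ℕ) := by norm_num
  simp only [rwpPDF, rwpBeta, Fin.sum_univ_three, Matrix.cons_val, Real.one_rpow, div_one]
  rw [e1, e2, e3]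
  simp only [Real.rpow_natCast]
  rw [f1, f2, f3]
  simp only [Real.rpow_natCast]
  field_simp

theorem rwpPDF_one (x : ℝ) : rwpPDF 1 x = 735 / 72 * x ^ 2 - 1190 / 72 * x ^ 4 + 455 / 72 * x ^ 6 := by
  have f1 : x ^ (2 : ℝ) = x ^ 2 := by norm_cast
  have f2 : x ^ (4 : ℝ) = x ^ 4 := by norm_cast
  have f3 : x ^ (6 : ℝ) = x ^ 6 := by norm_cast
  simp only [rwpPDF, rwpBeta, rwpC, Fin.sum_univ_three, Matrix.cons_val, Real.one_rpow, div_one]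
  rw [f1, f2, f3]
  ring

theorem rwpPDF_one_pos {x : ℝ} (h0 : 0 < x) (h1 : x < 1) : 0 < rwpPDF 1 x := by
  -- The polynomial `735 - 1190 y + 455 y²` has the root `y = 1`, and its cofactor is positive for
  -- `y < 1`.
  have h : rwpPDF 1 x = x ^ 2 * ((1 - x ^ 2) * (735 - 455 * x ^ 2)) / 72 := by
    rw [rwpPDF_one]; ring
  have h2 : x ^ 2 < 1 := by nlinarith
  rw [h]
  have h3 : 0 < 1 - x ^ 2 := by linarith
  have h4 : 0 < 735 - 455 * x ^ 2 := by linarith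
  positivity

theorem continuous_rwpPDF_one : Continuous (rwpPDF 1) := by
  simp_rw [funext rwpPDF_one]; fun_prop

theorem rwpPDF_one_nonneg {x : ℝ} (h : x ∈ Set.Icc (0 : ℝ) 1) : 0 ≤ rwpPDF 1 x := by
  have hcl : Set.Icc (0 : ℝ) 1 = closure (Set.Ioo 0 1) := (closure_Ioo zero_ne_one).symm
  rw [hcl] at h
  exact closure_minimal (fun y hy => (rwpPDF_one_pos hy.1 hy.2).le)
    (isClosed_le continuous_const continuous_rwpPDF_one) h

theorem continuous_rwpPDF {D : ℝ} (hD : 0 < D) : Continuous (rwpPDF D) := by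
  rw [show rwpPDF D = fun x => 1 / D * rwpPDF 1 (x / D) from funext fun x => rwpPDF_eq hD]
  have := continuous_rwpPDF_one
  fun_prop

theorem rwpPDF_nonneg {D x : ℝ} (hD : 0 < D) (h : x ∈ Set.Icc (0 : ℝ) D) : 0 ≤ rwpPDF D x := by
  rw [rwpPDF_eq hD]
  have := rwpPDF_one_nonneg (x := x / D) ⟨div_nonneg h.1 hD.le, (div_le_one hD).2 h.2⟩
  positivity

theorem integral_rwpLaw {D : ℝ} (hD : 0 < D) (g : ℝ → ℝ) :
    ∫ x, g x ∂(rwpLaw D) = ∫ x in (0 : ℝ)..D, rwpPDF D x * g x := by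
  rw [rwpLaw, integral_withDensity_ofReal measurableSet_Icc
    (continuous_rwpPDF hD).continuousOn.integrableOn_Icc fun x hx => rwpPDF_nonneg hD hx,
    intervalIntegral.integral_of_le hD.le, integral_Icc_eq_integral_Ioc]

theorem measureReal_prod_eq_integral {α β : Type*} [MeasurableSpace α] [MeasurableSpace β]
    (μ : Measure α) (ν : Measure β) [IsFiniteMeasure μ] [IsFiniteMeasure ν] {s : Set (α × β)}
    (hs : MeasurableSet s) :
    (μ.prod ν).real s = ∫ y, μ.real ((fun x => (x, y)) ⁻¹' s) ∂ν := by
  rw [measureReal_def, Measure.prod_apply_symm hs, ← integral_toReal]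
  · rfl
  · exact (measurable_measure_prodMk_right hs).aemeasurable
  · exact Eventually.of_forall fun _ => measure_lt_top _ _

/-- Condition on the distance: by independence the joint law of `∑ h²` and `q` is a product, and its
slice at distance `x > 0` is the event that `∑ h²` is at most `γ x^α / (ϱ g)`, to which the combined
κ-μ law applies. -/
theorem measureReal_snr_le_eq {Ω : Type*} [MeasurableSpace Ω] {P : Measure Ω}
    [IsProbabilityMeasure P] (R : RFHop) {h : Fin R.L → Ω → ℝ} {q : Ω → ℝ}
    (hh : ∀ l, HasLaw (h l) (kappaMuLaw R.κ R.μ) P) (hq : HasLaw q (rwpLaw R.D) P)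
    (h_indep : iIndepFun h P) (hq_indep : IndepFun (fun ω l => h l ω) q P) {g γ : ℝ} (hg : 0 < g)
    (hγ : 0 ≤ γ) :
    P.real {ω | R.snr g (fun l => h l ω) (q ω) ≤ γ} = R.cdfWith besselI g γ := by
  have hL : (0 : ℝ) < R.L := by exact_mod_cast R.L_pos
  have hϱ := R.ϱ_pos
  set S : Ω → ℝ := fun ω => ∑ l, h l ω ^ 2 with hS
  have hSm : AEMeasurable S P := by
    have := fun l => (hh l).aemeasurable
    fun_prop
  have hSq : IndepFun S q P := by
    refine hq_indep.comp (φ := fun v : Fin R.L → ℝ => ∑ l, v l ^ 2) (ψ := id) ?_ measurable_id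
    fun_prop
  have hprod := hSq.map_prod_eq_prod_map_map hSm hq.aemeasurable
  set A : Set (ℝ × ℝ) := {z | R.ϱ * g * z.2 ^ (-R.α) * z.1 ≤ γ} with hA
  have hAm : MeasurableSet A := measurableSet_le (by fun_prop) measurable_const
  have hset : {ω | R.snr g (fun l => h l ω) (q ω) ≤ γ} = (fun ω => (S ω, q ω)) ⁻¹' A := by
    ext ω
    simp only [RFHop.snr, Set.mem_ofPred_eq, hA, Set.mem_preimage, hS, Finset.mul_sum, sq_abs]
    rw [Finset.sum_congr rfl fun l _ =>
      (by ring : R.ϱ * h l ω ^ 2 * q ω ^ (-R.α) * g = R.ϱ * g * q ω ^ (-R.α) * h l ω ^ 2)]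
  have hqp : IsProbabilityMeasure (P.map q) := Measure.isProbabilityMeasure_map hq.aemeasurable
  have hSp : IsProbabilityMeasure (P.map S) := Measure.isProbabilityMeasure_map hSm
  rw [hset, ← map_measureReal_apply_of_aemeasurable (hSm.prodMk hq.aemeasurable) hAm, hprod,
    measureReal_prod_eq_integral _ _ hAm, hq.map_eq, integral_rwpLaw R.D_pos, RFHop.cdfWith,
    intervalIntegral.integral_of_le R.D_pos.le, intervalIntegral.integral_of_le R.D_pos.le]
  refine setIntegral_congr_fun measurableSet_Ioc fun x hx => ?_
  congr 1
  have hslice : (fun s => (s, x)) ⁻¹' A = Set.Iic (γ * x ^ R.α / (R.ϱ * g)) := by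
    ext s
    simp only [hA, Set.mem_preimage, Set.mem_ofPred_eq, Set.mem_Iic]
    have hxα := Real.rpow_pos_of_pos hx.1 R.α
    rw [Real.rpow_neg hx.1.le, le_div_iff₀ (by positivity)]
    have : R.ϱ * g * (x ^ R.α)⁻¹ * s = s * (R.ϱ * g) / x ^ R.α := by field_simp
    rw [this, div_le_iff₀ hxα]
  have hxα := Real.rpow_nonneg hx.1.le R.α
  rw [hslice, map_sum_sq_eq R.κ_pos R.μ_pos R.L_pos hh h_indep,
    measureReal_kappaMuLaw_mul_sq_le R.κ_pos (mul_pos hL R.μ_pos) hL (by positivity), div_div]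
  congr 3
  ring

/-! ## Averages over the normalized random-waypoint distance -/

theorem integral_rwpPDF_one : ∫ u in (0 : ℝ)..1, rwpPDF 1 u = 1 := by
  simp_rw [rwpPDF_one]
  rw [intervalIntegral.integral_add (by apply Continuous.intervalIntegrable; fun_prop)
      (by apply Continuous.intervalIntegrable; fun_prop),
    intervalIntegral.integral_sub (by apply Continuous.intervalIntegrable; fun_prop)
      (by apply Continuous.intervalIntegrable; fun_prop)]
  simp only [intervalIntegral.integral_const_mul, integral_pow]
  norm_num

theorem integral_rwpPDF_one_mul_mono {F G : ℝ → ℝ} (hF : Continuous F) (hG : Continuous G)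
    (h : ∀ u ∈ Set.Icc (0 : ℝ) 1, F u ≤ G u) :
    ∫ u in (0 : ℝ)..1, rwpPDF 1 u * F u ≤ ∫ u in (0 : ℝ)..1, rwpPDF 1 u * G u :=
  intervalIntegral.integral_mono_on zero_le_one
    ((continuous_rwpPDF_one.mul hF).intervalIntegrable _ _)
    ((continuous_rwpPDF_one.mul hG).intervalIntegrable _ _)
    fun u hu => mul_le_mul_of_nonneg_left (h u hu) (rwpPDF_one_nonneg hu)

theorem integral_rwpPDF_one_mul_le {F : ℝ → ℝ} (hF : Continuous F) {c : ℝ}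
    (h : ∀ u ∈ Set.Icc (0 : ℝ) 1, F u ≤ c) : ∫ u in (0 : ℝ)..1, rwpPDF 1 u * F u ≤ c := by
  refine (integral_rwpPDF_one_mul_mono hF continuous_const h).trans (le_of_eq ?_)
  rw [intervalIntegral.integral_mul_const, integral_rwpPDF_one, one_mul]

theorem integral_rwpPDF_one_mul_nonneg {F : ℝ → ℝ}
    (h : ∀ u ∈ Set.Icc (0 : ℝ) 1, 0 ≤ F u) : 0 ≤ ∫ u in (0 : ℝ)..1, rwpPDF 1 u * F u :=
  intervalIntegral.integral_nonneg zero_le_one fun u hu =>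
    mul_nonneg (rwpPDF_one_nonneg hu) (h u hu)

/-- The moment of order `s` of the `α`-th power of the normalized distance. -/
noncomputable def rwpMoment (α s : ℝ) : ℝ := ∫ u in (0 : ℝ)..1, rwpPDF 1 u * (u ^ α) ^ s

/-- The distribution function of a gamma law of shape `s`, averaged over the distance. -/
noncomputable def rwpGammaCDF (α s z : ℝ) : ℝ :=
  ∫ u in (0 : ℝ)..1, rwpPDF 1 u * (lowerGamma s (z * u ^ α) / Real.Gamma s)

theorem rpow_mem_Icc {α u : ℝ} (hα : 0 < α) (hu : u ∈ Set.Icc (0 : ℝ) 1) :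
    u ^ α ∈ Set.Icc (0 : ℝ) 1 :=
  ⟨Real.rpow_nonneg hu.1 _, Real.rpow_le_one hu.1 hu.2 hα.le⟩

theorem continuous_rpow_rpow {α s : ℝ} (hα : 0 < α) (hs : 0 < s) :
    Continuous fun u : ℝ => (u ^ α) ^ s :=
  (Real.continuous_rpow_const hs.le).comp (Real.continuous_rpow_const hα.le)

theorem continuous_lowerGamma_rpow {α s : ℝ} (hα : 0 < α) (hs : 0 < s) (z : ℝ) :
    Continuous fun u : ℝ => lowerGamma s (z * u ^ α) :=
  (continuous_lowerGamma hs).comp (continuous_const.mul (Real.continuous_rpow_const hα.le))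

theorem rwpMoment_le_one {α s : ℝ} (hα : 0 < α) (hs : 0 < s) : rwpMoment α s ≤ 1 :=
  integral_rwpPDF_one_mul_le (continuous_rpow_rpow hα hs) fun _ hu =>
    Real.rpow_le_one (rpow_mem_Icc hα hu).1 (rpow_mem_Icc hα hu).2 hs.le

theorem rwpMoment_pos {α s : ℝ} (hα : 0 < α) (hs : 0 < s) : 0 < rwpMoment α s := by
  refine intervalIntegral.intervalIntegral_pos_of_pos_on
    ((continuous_rwpPDF_one.mul (continuous_rpow_rpow hα hs)).intervalIntegrable _ _)
    (fun u hu => ?_) zero_lt_one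
  have := rwpPDF_one_pos hu.1 hu.2
  have := hu.1
  positivity

theorem rwpGammaCDF_nonneg {α s z : ℝ} (hs : 0 < s) (hz : 0 ≤ z) :
    0 ≤ rwpGammaCDF α s z :=
  integral_rwpPDF_one_mul_nonneg fun _ hu =>
    div_nonneg (lowerGamma_nonneg _ (mul_nonneg hz (Real.rpow_nonneg hu.1 _)))
      (Real.Gamma_pos_of_pos hs).le

theorem rwpGammaCDF_le_one {α s z : ℝ} (hα : 0 < α) (hs : 0 < s) (hz : 0 ≤ z) :
    rwpGammaCDF α s z ≤ 1 :=
  integral_rwpPDF_one_mul_le ((continuous_lowerGamma_rpow hα hs z).div_const _) fun _ hu => by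
    rw [div_le_one (Real.Gamma_pos_of_pos hs)]
    exact lowerGamma_le_Gamma hs (mul_nonneg hz (Real.rpow_nonneg hu.1 _))

theorem rwpGammaCDF_le_moment {α s z : ℝ} (hα : 0 < α) (hs : 0 < s) (hz : 0 ≤ z) :
    rwpGammaCDF α s z ≤ rwpMoment α s * z ^ s / Real.Gamma (s + 1) := by
  have hΓ := Real.Gamma_pos_of_pos hs
  have h : rwpMoment α s * z ^ s / Real.Gamma (s + 1) = ∫ u in (0 : ℝ)..1, rwpPDF 1 u *
      ((u ^ α) ^ s * (z ^ s / Real.Gamma (s + 1))) := by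
    simp_rw [← mul_assoc]
    rw [intervalIntegral.integral_mul_const, rwpMoment]
    ring
  rw [h]
  refine integral_rwpPDF_one_mul_mono ((continuous_lowerGamma_rpow hα hs z).div_const _)
    ((continuous_rpow_rpow hα hs).mul_const _) fun u hu => ?_
  have hu' := (rpow_mem_Icc hα hu).1
  refine (div_le_div_of_nonneg_right (lowerGamma_le_rpow hs (mul_nonneg hz hu')) hΓ.le).trans ?_
  rw [Real.mul_rpow hz hu', Real.Gamma_add_one hs.ne']
  refine le_of_eq ?_
  field_simp

/-- Averages the two-term lower bound for `lowerGamma`, bounding `(u^α)^(s+1)` by `1` in the error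
term. -/
theorem moment_sub_le_rwpGammaCDF {α s z : ℝ} (hα : 0 < α) (hs : 0 < s) (hz : 0 ≤ z) :
    rwpMoment α s * z ^ s / Real.Gamma (s + 1) - z ^ (s + 1) / ((s + 1) * Real.Gamma s) ≤
      rwpGammaCDF α s z := by
  have hΓ := Real.Gamma_pos_of_pos hs
  have h : rwpMoment α s * z ^ s / Real.Gamma (s + 1) - z ^ (s + 1) / ((s + 1) * Real.Gamma s) =
      ∫ u in (0 : ℝ)..1, rwpPDF 1 u *
        ((u ^ α) ^ s * (z ^ s / Real.Gamma (s + 1)) - z ^ (s + 1) / ((s + 1) * Real.Gamma s)) := by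
    simp_rw [mul_sub, ← mul_assoc]
    rw [intervalIntegral.integral_sub, intervalIntegral.integral_mul_const,
      intervalIntegral.integral_mul_const, integral_rwpPDF_one, rwpMoment]
    · ring
    · exact ((continuous_rwpPDF_one.mul (continuous_rpow_rpow hα hs)).mul_const _).intervalIntegrable
        _ _
    · exact (continuous_rwpPDF_one.mul_const _).intervalIntegrable _ _
  rw [h]
  refine integral_rwpPDF_one_mul_mono (((continuous_rpow_rpow hα hs).mul_const _).sub
    continuous_const) ((continuous_lowerGamma_rpow hα hs z).div_const _) fun u hu => ?_
  have hu' := rpow_mem_Icc hα hu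
  refine le_trans ?_
    (div_le_div_of_nonneg_right (rpow_sub_le_lowerGamma hs (mul_nonneg hz hu'.1)) hΓ.le)
  rw [Real.mul_rpow hz hu'.1, Real.Gamma_add_one hs.ne', Real.mul_rpow hz hu'.1]
  have h1 : (u ^ α) ^ (s + 1) ≤ 1 := Real.rpow_le_one hu'.1 hu'.2 (by linarith)
  have h2 : z ^ (s + 1) * (u ^ α) ^ (s + 1) ≤ z ^ (s + 1) :=
    mul_le_of_le_one_right (Real.rpow_nonneg hz _) h1
  rw [sub_div]
  refine sub_le_sub (le_of_eq (by field_simp)) ?_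
  rw [div_div]
  gcongr

/-! ## Substitution of a power -/

theorem integral_rpow_mul_comp_rpow {α Ψ : ℝ} (hα : 0 < α) (f : ℝ → ℝ) :
    ∫ u in (0 : ℝ)..1, u ^ (α * Ψ - 1) * f (u ^ α) =
      1 / α * ∫ v in (0 : ℝ)..1, v ^ (Ψ - 1) * f v := by
  -- Cutting off with the indicator of `(-∞, 1]`, a set that `u ↦ u^α` respects on the half-line,
  -- reduces to the change of variables on `(0, ∞)`.
  have h := integral_comp_rpow_Ioi_of_pos
    (g := Set.indicator (Set.Iic (1 : ℝ)) fun v => v ^ (Ψ - 1) * f v) hα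
  rw [setIntegral_indicator measurableSet_Iic, Set.Ioi_inter_Iic] at h
  rw [intervalIntegral.integral_of_le zero_le_one, intervalIntegral.integral_of_le zero_le_one,
    ← h, ← integral_const_mul, ← Set.Ioi_inter_Iic, ← setIntegral_indicator measurableSet_Iic]
  refine setIntegral_congr_fun measurableSet_Ioi fun x hx => ?_
  have hx' : 0 < x := hx
  have hiff : x ^ α ∈ Set.Iic (1 : ℝ) ↔ x ∈ Set.Iic (1 : ℝ) := by
    simp only [Set.mem_Iic]
    rw [← Real.one_rpow α, Real.rpow_le_rpow_iff hx'.le zero_le_one hα, Real.one_rpow]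
  simp only [smul_eq_mul]
  by_cases h1 : x ∈ Set.Iic (1 : ℝ)
  · rw [Set.indicator_of_mem h1, Set.indicator_of_mem (hiff.2 h1), ← Real.rpow_mul hx'.le]
    have : x ^ (α * Ψ - 1) = x ^ (α - 1) * x ^ (α * (Ψ - 1)) := by
      rw [← Real.rpow_add hx']; ring_nf
    rw [this]
    field_simp
  · rw [Set.indicator_of_notMem h1, Set.indicator_of_notMem (fun h2 => h1 (hiff.1 h2))]
    simp

theorem rwpBeta_pos (i : Fin 3) : 0 < rwpBeta i := by
  fin_cases i <;> simp [rwpBeta]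

/-- The origin of `Ψ_i`: since `β_i = α Ψ_i - 1`, substituting `v = u^α` turns each monomial of the
density into the weight `v^(Ψ_i - 1)` of a power average. -/
theorem integral_rwpPDF_one_mul_comp_rpow {α : ℝ} (hα : 0 < α) {f : ℝ → ℝ} (hf : Continuous f) :
    ∫ u in (0 : ℝ)..1, rwpPDF 1 u * f (u ^ α) =
      ∑ i, rwpC i / α * ∫ v in (0 : ℝ)..1, v ^ (1 / α * (rwpBeta i + 1) - 1) * f v := by
  have h1 : ∀ u : ℝ, rwpPDF 1 u * f (u ^ α) =
      ∑ i, rwpC i * (u ^ (α * (1 / α * (rwpBeta i + 1)) - 1) * f (u ^ α)) := by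
    intro u
    rw [rwpPDF, Finset.sum_mul]
    refine Finset.sum_congr rfl fun i _ => ?_
    rw [← mul_assoc α, mul_one_div_cancel hα.ne', Real.one_rpow, div_one, one_mul,
      add_sub_cancel_right, mul_assoc]
  simp_rw [h1]
  rw [intervalIntegral.integral_finsetSum]
  · refine Finset.sum_congr rfl fun i _ => ?_
    rw [intervalIntegral.integral_const_mul, integral_rpow_mul_comp_rpow hα]
    ring
  · intro i _
    refine Continuous.intervalIntegrable ?_ _ _
    refine continuous_const.mul ((Real.continuous_rpow_const ?_).mul
      (hf.comp (Real.continuous_rpow_const hα.le)))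
    have := rwpBeta_pos i
    rw [← mul_assoc, mul_one_div_cancel hα.ne']
    linarith

theorem rwpMoment_eq {α s : ℝ} (hα : 0 < α) (hs : 0 < s) :
    rwpMoment α s = ∑ i, rwpC i / α / (1 / α * (rwpBeta i + 1) + s) := by
  rw [rwpMoment, integral_rwpPDF_one_mul_comp_rpow hα (Real.continuous_rpow_const hs.le)]
  refine Finset.sum_congr rfl fun i _ => ?_
  have h1 : 0 < 1 / α * (rwpBeta i + 1) := by have := rwpBeta_pos i; positivity
  have h2 := integral_rpow_sub_one (m := 1 / α * (rwpBeta i + 1) + s) (by positivity) 1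
  rw [Real.one_rpow] at h2
  rw [div_eq_mul_one_div _ (_ + s), ← h2]
  congr 1
  rw [intervalIntegral.integral_of_le zero_le_one, intervalIntegral.integral_of_le zero_le_one]
  refine setIntegral_congr_fun measurableSet_Ioc fun v hv => ?_
  rw [← Real.rpow_add hv.1]
  ring_nf

theorem rwpGammaCDF_eq {α s z : ℝ} (hα : 0 < α) (hs : 0 < s) :
    rwpGammaCDF α s z * Real.Gamma s =
      ∑ i, rwpC i / α * powerAvg (1 / α * (rwpBeta i + 1)) (lowerGamma s) z := by
  have h := integral_rwpPDF_one_mul_comp_rpow hα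
    (f := fun v => lowerGamma s (v * z)) ((continuous_lowerGamma hs).comp (by fun_prop))
  simp only [powerAvg]
  rw [← h, rwpGammaCDF, ← intervalIntegral.integral_mul_const]
  refine intervalIntegral.integral_congr fun u _ => ?_
  have := (Real.Gamma_pos_of_pos hs).ne'
  simp only [mul_comm z]
  field_simp

/-! ## The coefficients of the Bessel approximation -/

/-- The ratio of a coefficient of the approximation of order `p` and that of the Bessel series. -/
noncomputable def besselRatio (p k : ℕ) : ℝ := ∏ j ∈ Finset.range k, (1 - (j : ℝ) ^ 2 / (p : ℝ) ^ 2)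

/-- Induction on `k`: raising `k` by one multiplies `Γ(p + k)` by `p + k`, divides `Γ(p - k + 1)` by
`p - k` and brings in `p^{-2}`, for a total factor `1 - k²/p²`. -/
theorem besselCoeff_eq {p : ℕ} (hp : 1 ≤ p) (k : ℕ) (v : ℝ) :
    besselCoeff k p v = besselRatio p k / ((k.factorial : ℝ) * Real.Gamma (v + k + 1)) := by
  have hp0 : (0 : ℝ) < p := by exact_mod_cast hp
  have key : Real.Gamma (p + k) * (p : ℝ) ^ (1 - 2 * (k : ℤ)) / Real.Gamma ((p : ℝ) - k + 1) =
      besselRatio p k := by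
    induction k with
    | zero =>
      simp only [Nat.cast_zero, add_zero, mul_zero, sub_zero, besselRatio, Finset.range_zero,
        Finset.prod_empty, zpow_one]
      rw [Real.Gamma_add_one hp0.ne', mul_comm, div_self]
      exact mul_ne_zero hp0.ne' (Real.Gamma_pos_of_pos hp0).ne'
    | succ k ih =>
      rcases lt_or_ge k p with hk | hk
      · have hk0 : (0 : ℝ) < (p : ℝ) - k := by
          have : (k : ℝ) < p := by exact_mod_cast hk
          linarith
        have hpk : (0 : ℝ) < p + k := by positivity
        rw [besselRatio, Finset.prod_range_succ, ← besselRatio, ← ih]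
        push_cast
        rw [← add_assoc, Real.Gamma_add_one hpk.ne', show (p : ℝ) - (k + 1) + 1 = p - k by ring,
          Real.Gamma_add_one hk0.ne', show (1 - 2 * ((k : ℤ) + 1)) = (1 - 2 * (k : ℤ)) - (2 : ℕ) by
            push_cast; ring, zpow_sub₀ hp0.ne', zpow_natCast]
        have h1 := (Real.Gamma_pos_of_pos hk0).ne'
        field_simp
        ring
      -- Beyond the order `p` the Gamma function sits at a pole, where its value is `0` by
      -- convention; division by zero then gives `0`, in agreement with the product, which contains
      -- the vanishing factor `j = p`.
      · have h0 : Real.Gamma ((p : ℝ) - (k + 1 : ℕ) + 1) = 0 := by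
          have := Real.Gamma_neg_nat_eq_zero (k - p)
          rw [Nat.cast_sub hk] at this
          rw [← this]
          congr 1
          push_cast
          ring
        rw [h0, div_zero, besselRatio, eq_comm]
        refine Finset.prod_eq_zero (Finset.mem_range.2 (Nat.lt_succ_of_le hk)) ?_
        rw [div_self (by positivity), sub_self]
  rw [← key, besselCoeff, Real.Gamma_nat_eq_factorial, div_div]
  ring_nf

theorem besselRatio_zero (p : ℕ) : besselRatio p 0 = 1 := by simp [besselRatio]

theorem besselRatio_eq_zero {p k : ℕ} (hp : 1 ≤ p) (hk : p < k) : besselRatio p k = 0 := by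
  have hp0 : (0 : ℝ) < p := by exact_mod_cast hp
  refine Finset.prod_eq_zero (Finset.mem_range.2 hk) ?_
  rw [div_self (by positivity), sub_self]

theorem besselRatio_mem_Icc {p : ℕ} (hp : 1 ≤ p) (k : ℕ) : besselRatio p k ∈ Set.Icc (0 : ℝ) 1 := by
  rcases lt_or_ge p k with hk | hk
  · rw [besselRatio_eq_zero hp hk]; simp
  have hp0 : (0 : ℝ) < p := by exact_mod_cast hp
  have h : ∀ j ∈ Finset.range k, 0 ≤ 1 - (j : ℝ) ^ 2 / (p : ℝ) ^ 2 := by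
    intro j hj
    have hjp : (j : ℝ) ≤ p := by exact_mod_cast (Finset.mem_range.1 hj).le.trans hk
    rw [sub_nonneg, div_le_one (by positivity)]
    gcongr
  exact ⟨Finset.prod_nonneg h, Finset.prod_le_one h fun j _ => sub_le_self _ (by positivity)⟩

theorem tendsto_besselRatio (k : ℕ) : Tendsto (fun p => besselRatio p k) atTop (𝓝 1) := by
  have h : ∀ j ∈ Finset.range k,
      Tendsto (fun p : ℕ => 1 - (j : ℝ) ^ 2 / (p : ℝ) ^ 2) atTop (𝓝 1) := by
    intro j _
    have h1 : Tendsto (fun p : ℕ => (p : ℝ) ^ 2) atTop atTop :=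
      (tendsto_pow_atTop two_ne_zero).comp tendsto_natCast_atTop_atTop
    simpa using (h1.const_div_atTop ((j : ℝ) ^ 2)).const_sub 1
  have h2 := tendsto_finsetProd _ h
  rw [Finset.prod_const_one] at h2
  exact h2

/-! ## Poisson mixtures -/

/-- The weights of the Poisson distribution. -/
noncomputable def poissonWeight (lam : ℝ) (k : ℕ) : ℝ :=
  Real.exp (-lam) * lam ^ k / (k.factorial : ℝ)

theorem poissonWeight_pos {lam : ℝ} (h : 0 < lam) (k : ℕ) : 0 < poissonWeight lam k := by
  unfold poissonWeight; positivity

theorem hasSum_poissonWeight (lam : ℝ) : HasSum (poissonWeight lam) 1 := by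
  have h := hasSum_exp_mul_pow lam 1
  simp only [one_pow, mul_one, sub_self, mul_zero, Real.exp_zero] at h
  exact h

theorem summable_mixture {lam : ℝ} (hlam : 0 < lam) {c f : ℕ → ℝ} {C : ℝ}
    (hc : ∀ k, c k ∈ Set.Icc (0 : ℝ) 1) (hf : ∀ k, |f k| ≤ C) :
    Summable fun k => c k * poissonWeight lam k * f k := by
  refine Summable.of_norm_bounded ((hasSum_poissonWeight lam).summable.mul_right C) fun k => ?_
  have h1 := (poissonWeight_pos hlam k).le
  have h2 := (abs_nonneg _).trans (hf k)
  rw [Real.norm_eq_abs, abs_mul, abs_of_nonneg (mul_nonneg (hc k).1 h1)]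
  exact mul_le_mul (mul_le_of_le_one_left h1 (hc k).2) (hf k) (abs_nonneg _) h1

/-- The leading term of a Poisson mixture of functions of order `z ^ (m + k)`. -/
theorem abs_mixture_sub_le {lam m z A C₀ C₁ : ℝ} (hlam : 0 < lam) (hm : 0 < m) (hz : 0 < z)
    (hz1 : z ≤ 1) {c f : ℕ → ℝ} (hc : ∀ k, c k ∈ Set.Icc (0 : ℝ) 1) (hc0 : c 0 = 1)
    (hf : ∀ k : ℕ, |f k| ≤ C₁ * z ^ (m + k)) (hf0 : |f 0 - A * z ^ m| ≤ C₀ * z ^ (m + 1)) :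
    |∑' k, c k * poissonWeight lam k * f k - Real.exp (-lam) * A * z ^ m| ≤
      (C₀ + C₁) * z ^ (m + 1) := by
  have hC₁ : 0 ≤ C₁ := by
    have h := (abs_nonneg _).trans (hf 0)
    exact nonneg_of_mul_nonneg_left h (Real.rpow_pos_of_pos hz _)
  have hf' : ∀ k, |f k| ≤ C₁ := fun k => (hf k).trans <|
    mul_le_of_le_one_right hC₁ (Real.rpow_le_one hz.le hz1 (by positivity))
  have hs := summable_mixture hlam hc hf'
  -- As `z ≤ 1`, every term of index at least one is of order `z^(m+1)` uniformly in `k`; the tail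
  -- of the Poisson weights has mass at most one.
  have hf1 : ∀ k : ℕ, |f (k + 1)| ≤ C₁ * z ^ (m + 1) := fun k => (hf _).trans <| by
    refine mul_le_mul_of_nonneg_left (Real.rpow_le_rpow_of_exponent_ge hz hz1 ?_) hC₁
    push_cast
    have : (0 : ℝ) ≤ k := k.cast_nonneg
    linarith
  have hW := (hasSum_poissonWeight lam).summable
  have htail : |∑' k, c (k + 1) * poissonWeight lam (k + 1) * f (k + 1)| ≤ C₁ * z ^ (m + 1) := by
    have h1 : Summable fun k => poissonWeight lam (k + 1) * (C₁ * z ^ (m + 1)) :=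
      ((summable_nat_add_iff 1).2 hW).mul_right _
    have hle := tsum_of_norm_bounded (f := fun k =>
      c (k + 1) * poissonWeight lam (k + 1) * f (k + 1)) h1.hasSum (fun k => by
        have h1 := (poissonWeight_pos hlam (k + 1)).le
        rw [Real.norm_eq_abs, abs_mul, abs_of_nonneg (mul_nonneg (hc _).1 h1)]
        exact mul_le_mul (mul_le_of_le_one_left h1 (hc _).2) (hf1 k) (abs_nonneg _) h1)
    rw [tsum_mul_right] at hle
    refine hle.trans (mul_le_of_le_one_left (by positivity) ?_)
    have h2 := hW.tsum_eq_zero_add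
    rw [(hasSum_poissonWeight lam).tsum_eq] at h2
    have := (poissonWeight_pos hlam 0).le
    linarith
  have hW0 : poissonWeight lam 0 = Real.exp (-lam) := by simp [poissonWeight]
  rw [hs.tsum_eq_zero_add, hc0, hW0, one_mul]
  have h3 : Real.exp (-lam) * |f 0 - A * z ^ m| ≤ C₀ * z ^ (m + 1) := by
    refine le_trans (mul_le_of_le_one_left (abs_nonneg _) ?_) hf0
    simpa using hlam.le
  calc _ = |Real.exp (-lam) * (f 0 - A * z ^ m) +
        ∑' k, c (k + 1) * poissonWeight lam (k + 1) * f (k + 1)| := by congr 1; ring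
    _ ≤ _ := abs_add_le _ _
    _ ≤ _ := by
      rw [abs_mul, Real.abs_exp, add_mul]
      exact add_le_add h3 htail

/-- The relative error is at most `(C / K) z`, which tends to `0`. -/
theorem isEquivalent_of_abs_sub_le {f z : ℝ → ℝ} {K C m : ℝ} (hK : 0 < K)
    (hz : ∀ᶠ g in atTop, 0 < z g) (hz0 : Tendsto z atTop (𝓝 0))
    (h : ∀ᶠ g in atTop, |f g - K * z g ^ m| ≤ C * z g ^ (m + 1)) :
    f ~[atTop] fun g => K * z g ^ m := by
  rw [IsEquivalent, isLittleO_iff]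
  intro ε hε
  have h1 : ∀ᶠ g in atTop, C * z g < ε * K := by
    have := hz0.const_mul C
    rw [mul_zero] at this
    exact this.eventually_lt_const (by positivity)
  filter_upwards [hz, h, h1] with g hg h2 h3
  have hp := Real.rpow_pos_of_pos hg m
  rw [Pi.sub_apply, Real.norm_eq_abs, Real.norm_of_nonneg (by positivity)]
  refine h2.trans ?_
  rw [Real.rpow_add_one hg.ne']
  nlinarith

/-! ## The RF hop -/

namespace RFHop

variable (R : RFHop)

theorem combined_pos : 0 < R.L * R.μ :=
  mul_pos (by exact_mod_cast R.L_pos) R.μ_pos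

theorem mean_pos : 0 < R.L * R.μ * R.κ := mul_pos R.combined_pos R.κ_pos

theorem K₂_pos {g : ℝ} (hg : 0 < g) : 0 < R.K₂ g := by
  have hL : (0 : ℝ) < R.L := by exact_mod_cast R.L_pos
  have hB := kappaMuRate_pos R.κ_pos R.combined_pos
  have := R.ϱ_pos
  have := R.D_pos
  unfold K₂
  positivity

/-- The substitution `q = D u` gathers every scale parameter into `K₂`: the rate times the squared
integration limit becomes `K₂ γ u^α`. -/
theorem cdfWith_eq {J : ℝ → ℝ → ℝ} {H : ℝ → ℝ} {g γ : ℝ} (hg : 0 < g) (hγ : 0 ≤ γ)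
    (hJ : ∀ y, 0 ≤ y → ∫ x in (0 : ℝ)..y, kappaMuPDF J R.κ (R.L * R.μ) x =
      H (kappaMuRate R.κ (R.L * R.μ) * y ^ 2)) :
    R.cdfWith J g γ = ∫ u in (0 : ℝ)..1, rwpPDF 1 u * H (R.K₂ g * γ * u ^ R.α) := by
  have hD := R.D_pos
  have hϱ := R.ϱ_pos
  have hL : (0 : ℝ) < R.L := by exact_mod_cast R.L_pos
  have h := intervalIntegral.integral_comp_div (a := 0) (b := R.D)
    (fun u : ℝ => rwpPDF 1 u * H (R.K₂ g * γ * u ^ R.α)) hD.ne'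
  rw [zero_div, div_self hD.ne', smul_eq_mul] at h
  rw [← inv_mul_eq_iff_eq_mul₀ hD.ne'] at h
  rw [← h, ← intervalIntegral.integral_const_mul, cdfWith]
  refine intervalIntegral.integral_congr fun q hq => ?_
  rw [Set.uIcc_of_le hD.le] at hq
  have hqα := Real.rpow_nonneg hq.1 R.α
  have hDα := Real.rpow_pos_of_pos hD R.α
  rw [hJ _ (Real.sqrt_nonneg _), Real.sq_sqrt (by positivity), rwpPDF_eq hD, K₂,
    Real.div_rpow hq.1 hD.le, one_div, mul_assoc]
  congr 3
  field_simp

/-- The Poisson sum may be exchanged with the average over the distance, as the gamma CDFs are at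
most `1` and the distance density times the Poisson weights is a summable majorant. -/
theorem hasSum_cdfWith_besselI {g γ : ℝ} (hg : 0 < g) (hγ : 0 ≤ γ) :
    HasSum (fun k : ℕ => poissonWeight (R.L * R.μ * R.κ) k *
      rwpGammaCDF R.α (R.L * R.μ + k) (R.K₂ g * γ)) (R.cdfWith besselI g γ) := by
  have hm := R.combined_pos
  have hlam := R.mean_pos
  have hz : 0 ≤ R.K₂ g * γ := mul_nonneg (R.K₂_pos hg).le hγ
  have hmk : ∀ k : ℕ, 0 < R.L * R.μ + k := fun k => by positivity
  set z := R.K₂ g * γ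
  have hser : ∀ x : ℝ, 0 ≤ x → HasSum (fun k : ℕ => poissonWeight (R.L * R.μ * R.κ) k *
      (lowerGamma (R.L * R.μ + k) x / Real.Gamma (R.L * R.μ + k)))
      (∑' k : ℕ, poissonWeight (R.L * R.μ * R.κ) k *
        (lowerGamma (R.L * R.μ + k) x / Real.Gamma (R.L * R.μ + k))) := by
    intro x hx
    refine Summable.hasSum ?_
    have := summable_mixture (c := fun _ => 1) (C := 1) hlam (fun _ => by simp)
      (f := fun k : ℕ => lowerGamma (R.L * R.μ + k) x / Real.Gamma (R.L * R.μ + k)) fun k => by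
        rw [abs_of_nonneg (div_nonneg (lowerGamma_nonneg _ hx) (Real.Gamma_pos_of_pos (hmk k)).le),
          div_le_one (Real.Gamma_pos_of_pos (hmk k))]
        exact lowerGamma_le_Gamma (hmk k) hx
    simpa using this
  rw [R.cdfWith_eq (H := fun x => ∑' k : ℕ, poissonWeight (R.L * R.μ * R.κ) k *
    (lowerGamma (R.L * R.μ + k) x / Real.Gamma (R.L * R.μ + k))) hg hγ fun y hy =>
      (hasSum_integral_kappaMuPDF R.κ_pos hm hy).tsum_eq.symm]
  have h := intervalIntegral.hasSum_integral_of_dominated_convergence (μ := volume) (a := 0) (b := 1)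
    (F := fun (k : ℕ) u => rwpPDF 1 u * (poissonWeight (R.L * R.μ * R.κ) k *
      (lowerGamma (R.L * R.μ + k) (z * u ^ R.α) / Real.Gamma (R.L * R.μ + k))))
    (f := fun u => rwpPDF 1 u * ∑' k : ℕ, poissonWeight (R.L * R.μ * R.κ) k *
      (lowerGamma (R.L * R.μ + k) (z * u ^ R.α) / Real.Gamma (R.L * R.μ + k)))
    (fun k u => rwpPDF 1 u * poissonWeight (R.L * R.μ * R.κ) k) ?_ ?_ ?_ ?_ ?_
  · refine h.congr_fun fun k => ?_
    rw [rwpGammaCDF, ← intervalIntegral.integral_const_mul]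
    refine intervalIntegral.integral_congr fun u _ => ?_
    ring
  · intro k
    exact (continuous_rwpPDF_one.mul (continuous_const.mul
      ((continuous_lowerGamma_rpow R.α_pos (hmk k) z).div_const _))).aestronglyMeasurable
  · intro k
    refine Eventually.of_forall fun u hu => ?_
    rw [Set.uIoc_of_le zero_le_one] at hu
    have h1 := rwpPDF_one_nonneg (Set.Ioc_subset_Icc_self hu)
    have h2 := (poissonWeight_pos hlam k).le
    have h3 : 0 ≤ z * u ^ R.α := mul_nonneg hz (Real.rpow_nonneg hu.1.le _)
    have h4 := lowerGamma_nonneg (R.L * R.μ + k) h3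
    have h5 := Real.Gamma_pos_of_pos (hmk k)
    rw [Real.norm_of_nonneg (by positivity)]
    refine mul_le_mul_of_nonneg_left (mul_le_of_le_one_right h2 ?_) h1
    rw [div_le_one h5]
    exact lowerGamma_le_Gamma (hmk k) h3
  · exact Eventually.of_forall fun u _ => (hasSum_poissonWeight _).summable.mul_left _
  · simp_rw [tsum_mul_left, (hasSum_poissonWeight _).tsum_eq, mul_one]
    exact continuous_rwpPDF_one.intervalIntegrable _ _
  · refine Eventually.of_forall fun u hu => ?_
    rw [Set.uIoc_of_le zero_le_one] at hu
    exact (hser _ (mul_nonneg hz (Real.rpow_nonneg hu.1.le _))).mul_left _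

theorem cdfWith_besselApprox_eq_sum {p : ℕ} {g γ : ℝ} (hg : 0 < g) (hγ : 0 ≤ γ) :
    R.cdfWith (besselApprox p) g γ = ∑ k ∈ Finset.range (p + 1),
      besselCoeff k p (R.L * R.μ - 1) * (Real.exp (-(R.L * R.μ * R.κ)) * (R.L * R.μ * R.κ) ^ k) *
        (rwpGammaCDF R.α (R.L * R.μ + k) (R.K₂ g * γ) * Real.Gamma (R.L * R.μ + k)) := by
  have hm := R.combined_pos
  have hmk : ∀ k : ℕ, 0 < R.L * R.μ + k := fun k => by positivity
  rw [R.cdfWith_eq (H := fun x => ∑ k ∈ Finset.range (p + 1), besselCoeff k p (R.L * R.μ - 1) *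
    (Real.exp (-(R.L * R.μ * R.κ)) * (R.L * R.μ * R.κ) ^ k * lowerGamma (R.L * R.μ + k) x)) hg hγ
    fun y hy => integral_kappaMuPDF_besselApprox R.κ_pos hm hy p]
  simp_rw [Finset.mul_sum]
  rw [intervalIntegral.integral_finsetSum]
  · refine Finset.sum_congr rfl fun k _ => ?_
    rw [rwpGammaCDF, ← intervalIntegral.integral_mul_const, ← intervalIntegral.integral_const_mul]
    refine intervalIntegral.integral_congr fun u _ => ?_
    have := (Real.Gamma_pos_of_pos (hmk k)).ne'
    field_simp
  · intro k _
    exact (continuous_rwpPDF_one.mul (continuous_const.mul (continuous_const.mul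
      (continuous_lowerGamma_rpow R.α_pos (hmk k) _)))).intervalIntegrable _ _

/-- The same mixture as for the exact CDF, with damped weights; the finite sum becomes a full series
because `besselRatio p k = 0` for `k > p`. -/
theorem cdfWith_besselApprox_eq_tsum {p : ℕ} (hp : 1 ≤ p) {g γ : ℝ} (hg : 0 < g) (hγ : 0 ≤ γ) :
    R.cdfWith (besselApprox p) g γ = ∑' k : ℕ, besselRatio p k *
      poissonWeight (R.L * R.μ * R.κ) k * rwpGammaCDF R.α (R.L * R.μ + k) (R.K₂ g * γ) := by
  have hm := R.combined_pos
  rw [R.cdfWith_besselApprox_eq_sum hg hγ, tsum_eq_sum (s := Finset.range (p + 1))]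
  · refine Finset.sum_congr rfl fun k _ => ?_
    have hmk : 0 < R.L * R.μ + k := by positivity
    have := (Real.Gamma_pos_of_pos hmk).ne'
    rw [besselCoeff_eq hp, show R.L * R.μ - 1 + k + 1 = R.L * R.μ + k by ring, poissonWeight]
    field_simp
  · intro k hk
    rw [besselRatio_eq_zero hp (by simpa using hk)]
    ring

/-- The Bessel approximation becomes exact as its order tends to infinity. -/
theorem tendsto_cdfWith_besselApprox {g γ : ℝ} (hg : 0 < g) (hγ : 0 ≤ γ) :
    Tendsto (fun p : ℕ => R.cdfWith (besselApprox p) g γ) atTop (𝓝 (R.cdfWith besselI g γ)) := by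
  have hm := R.combined_pos
  have hz : 0 ≤ R.K₂ g * γ := mul_nonneg (R.K₂_pos hg).le hγ
  have h : Tendsto (fun p : ℕ => ∑' k : ℕ, besselRatio p k *
      poissonWeight (R.L * R.μ * R.κ) k * rwpGammaCDF R.α (R.L * R.μ + k) (R.K₂ g * γ)) atTop
      (𝓝 (∑' k : ℕ, 1 * poissonWeight (R.L * R.μ * R.κ) k *
        rwpGammaCDF R.α (R.L * R.μ + k) (R.K₂ g * γ))) := by
    refine tendsto_tsum_of_dominated_convergence
      (hasSum_poissonWeight (R.L * R.μ * R.κ)).summable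
      (fun k => ((tendsto_besselRatio k).mul_const _).mul_const _) ?_
    filter_upwards [eventually_ge_atTop 1] with p hp k
    have h1 := besselRatio_mem_Icc hp k
    have h2 := (poissonWeight_pos R.mean_pos k).le
    have hmk : 0 < R.L * R.μ + k := by positivity
    have h3 := rwpGammaCDF_nonneg (α := R.α) hmk hz
    rw [Real.norm_of_nonneg (mul_nonneg (mul_nonneg h1.1 h2) h3)]
    exact mul_le_of_le_one_right (mul_nonneg h1.1 h2) (rwpGammaCDF_le_one R.α_pos hmk hz) |>.trans
      (mul_le_of_le_one_left h2 h1.2)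
  simp only [one_mul] at h
  rw [(R.hasSum_cdfWith_besselI hg hγ).tsum_eq] at h
  refine h.congr' ?_
  filter_upwards [eventually_ge_atTop 1] with p hp
  rw [R.cdfWith_besselApprox_eq_tsum hp hg hγ]

theorem Psi_pos (i : Fin 3) : 0 < R.Psi i := by
  have := R.α_pos
  have := rwpBeta_pos i
  unfold Psi
  positivity

theorem cdfWith_besselApprox_eq_closedCDF {p : ℕ} {g γ : ℝ} (hg : 0 < g)
    (hγ : 0 < γ) : ((R.cdfWith (besselApprox p) g γ : ℝ) : ℂ) = R.closedCDF p g γ := by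
  have hm := R.combined_pos
  have hz : 0 < R.K₂ g * γ := mul_pos (R.K₂_pos hg) hγ
  rw [R.cdfWith_besselApprox_eq_sum hg hγ.le, closedCDF, Finset.sum_comm]
  push_cast
  refine Finset.sum_congr rfl fun k _ => ?_
  have hmk : 0 < R.L * R.μ + k := by positivity
  have hcast : (R.L : ℂ) * (R.μ : ℂ) + k = ((R.L * R.μ + k : ℝ) : ℂ) := by push_cast; ring
  have hG : ∀ i, meijerG 1 2 ![1 - (R.Psi i : ℂ), 1]
      ![(R.L : ℂ) * (R.μ : ℂ) + k, 0, -(R.Psi i : ℂ)] ((R.K₂ g * γ : ℝ) : ℂ) =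
      (powerAvg (R.Psi i) (lowerGamma (R.L * R.μ + k)) (R.K₂ g * γ) : ℂ) := by
    intro i
    rw [hcast, meijerG_one_two_eq hmk (R.Psi_pos i) hz]
  have hlast := rwpGammaCDF_eq (z := R.K₂ g * γ) R.α_pos hmk
  norm_cast at hG ⊢
  simp_rw [hG]
  norm_cast
  rw [hlast, Finset.mul_sum]
  refine Finset.sum_congr rfl fun i _ => ?_
  rw [K₁, Real.exp_neg, Psi]
  have := R.α_pos
  field_simp

/-- With `m = L μ + k`, the Gamma quotient equals `1 / (m (Ψ_i + m))`, and the sum over `i` rebuilds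
the moment of the distance. So the asymptotic expression is the mixture in which each averaged gamma
CDF is replaced by its leading monomial. -/
theorem asympCDF_eq_tsum {p : ℕ} (hp : 1 ≤ p) {g γ : ℝ} (hg : 0 < g) (hγ : 0 < γ) :
    R.asympCDF p g γ = ∑' k : ℕ, besselRatio p k * poissonWeight (R.L * R.μ * R.κ) k *
      (rwpMoment R.α (R.L * R.μ + k) * (R.K₂ g * γ) ^ (R.L * R.μ + k) /
        Real.Gamma (R.L * R.μ + k + 1)) := by
  have hm := R.combined_pos
  have hα := R.α_pos
  have hz : 0 < R.K₂ g * γ := mul_pos (R.K₂_pos hg) hγ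
  rw [tsum_eq_sum (s := Finset.range (p + 1)), asympCDF, Finset.sum_comm]
  · refine Finset.sum_congr rfl fun k _ => ?_
    have hmk : 0 < R.L * R.μ + k := by positivity
    rw [rwpMoment_eq hα hmk]
    simp only [Finset.sum_mul, Finset.mul_sum, Finset.sum_div]
    refine Finset.sum_congr rfl fun i _ => ?_
    have hΨ := R.Psi_pos i
    have hΓ := Real.Gamma_pos_of_pos hmk
    have hΓ2 : 0 < Real.Gamma (R.Psi i + (R.L * R.μ + k)) := Real.Gamma_pos_of_pos (by positivity)
    have e1 : 1 + R.L * R.μ + k = R.L * R.μ + k + 1 := by ring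
    have e2 : 1 + R.Psi i + R.L * R.μ + k = R.Psi i + (R.L * R.μ + k) + 1 := by ring
    have e3 : R.Psi i + R.L * R.μ + k = R.Psi i + (R.L * R.μ + k) := by ring
    have e4 : -(R.L * R.μ) - (k : ℝ) = -(R.L * R.μ + k) := by ring
    rw [e1, e2, e3, e4, zero_add, Real.Gamma_add_one hmk.ne',
      Real.Gamma_add_one (by positivity : R.Psi i + (R.L * R.μ + k) ≠ 0), Real.rpow_neg hz.le,
      K₁, besselCoeff_eq hp, show R.L * R.μ - 1 + k + 1 = R.L * R.μ + k by ring, poissonWeight,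
      Real.exp_neg, ← Psi]
    have hzp := Real.rpow_pos_of_pos hz (R.L * R.μ + k)
    field_simp
  · intro k hk
    rw [besselRatio_eq_zero hp (by simpa using hk)]
    ring

/-! ### High-SNR asymptotics of the RF hop -/

theorem Gamma_le_Gamma_add_nat {s : ℝ} (hs : 1 ≤ s) (k : ℕ) :
    Real.Gamma s ≤ Real.Gamma (s + k) := by
  induction k with
  | zero => simp
  | succ k ih =>
    have h1 : (1 : ℝ) ≤ s + k := by have : (0 : ℝ) ≤ k := k.cast_nonneg; linarith
    push_cast
    rw [← add_assoc, Real.Gamma_add_one (by positivity)]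
    refine ih.trans (le_mul_of_one_le_left ?_ h1)
    exact (Real.Gamma_pos_of_pos (by linarith)).le

/-- The leading coefficient at high SNR. -/
noncomputable def leadingCoeff : ℝ :=
  Real.exp (-(R.L * R.μ * R.κ)) * (rwpMoment R.α (R.L * R.μ) / Real.Gamma (R.L * R.μ + 1))

theorem leadingCoeff_pos : 0 < R.leadingCoeff := by
  have h1 := rwpMoment_pos R.α_pos R.combined_pos
  have h2 : 0 < Real.Gamma (R.L * R.μ + 1) := Real.Gamma_pos_of_pos (by linarith [R.combined_pos])
  unfold leadingCoeff
  positivity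

theorem tendsto_K₂_mul (γ : ℝ) : Tendsto (fun g => R.K₂ g * γ) atTop (𝓝 0) := by
  have hL : (0 : ℝ) < R.L := by exact_mod_cast R.L_pos
  have h : Tendsto R.K₂ atTop (𝓝 0) := by
    unfold K₂
    exact (tendsto_id.const_mul_atTop (mul_pos R.ϱ_pos hL)).const_div_atTop _
  simpa using h.mul_const γ

/-- Uniform in `k`: moments of a distance in `[0, 1]` are at most `1`, and `Γ` does not decrease
along unit steps from an argument at least `1`. -/
theorem moment_term_le {k : ℕ} {z : ℝ} (hz : 0 ≤ z) :
    rwpMoment R.α (R.L * R.μ + k) * z ^ (R.L * R.μ + k) / Real.Gamma (R.L * R.μ + k + 1) ≤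
      1 / Real.Gamma (R.L * R.μ + 1) * z ^ (R.L * R.μ + k) := by
  have hm := R.combined_pos
  have hΓ : 0 < Real.Gamma (R.L * R.μ + 1) := Real.Gamma_pos_of_pos (by linarith)
  have hmk : 0 < R.L * R.μ + k := by positivity
  have h1 := Gamma_le_Gamma_add_nat (s := R.L * R.μ + 1) (by linarith) k
  rw [add_right_comm] at h1
  rw [one_div_mul_eq_div]
  refine div_le_div₀ (Real.rpow_nonneg hz _) ?_ hΓ h1
  exact mul_le_of_le_one_left (Real.rpow_nonneg hz _) (rwpMoment_le_one R.α_pos hmk)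

/-- Serves three mixtures at once: the exact CDF (`c = 1`), the approximate CDF (`c = besselRatio
p`) and the asymptotic expression (`φ` the leading monomials). The common condition `c 0 = 1` makes
their leading terms coincide. -/
theorem isEquivalent_mixture {c : ℕ → ℝ} (hc : ∀ k, c k ∈ Set.Icc (0 : ℝ) 1) (hc0 : c 0 = 1)
    {φ : ℕ → ℝ → ℝ} {C : ℝ} {γ : ℝ} (hγ : 0 < γ)
    (hφ : ∀ (k : ℕ) (z : ℝ), 0 < z → |φ k z| ≤
      1 / Real.Gamma (R.L * R.μ + 1) * z ^ (R.L * R.μ + k))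
    (hφ0 : ∀ z, 0 < z → |φ 0 z - rwpMoment R.α (R.L * R.μ) / Real.Gamma (R.L * R.μ + 1) *
      z ^ (R.L * R.μ)| ≤ C * z ^ (R.L * R.μ + 1)) {f : ℝ → ℝ}
    (hf : ∀ g, 0 < g → f g = ∑' k, c k * poissonWeight (R.L * R.μ * R.κ) k *
      φ k (R.K₂ g * γ)) :
    f ~[atTop] fun g => R.leadingCoeff * (R.K₂ g * γ) ^ (R.L * R.μ) := by
  have hpos : ∀ᶠ g in atTop, 0 < R.K₂ g * γ := by
    filter_upwards [eventually_gt_atTop 0] with g hg using mul_pos (R.K₂_pos hg) hγ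
  refine isEquivalent_of_abs_sub_le R.leadingCoeff_pos
    (C := C + 1 / Real.Gamma (R.L * R.μ + 1)) hpos (R.tendsto_K₂_mul γ) ?_
  filter_upwards [eventually_gt_atTop 0, hpos,
    (R.tendsto_K₂_mul γ).eventually_le_const zero_lt_one] with g hg hz hz1
  rw [hf g hg]
  exact abs_mixture_sub_le R.mean_pos R.combined_pos hz hz1 hc hc0 (fun k => hφ k _ hz) (hφ0 _ hz)

theorem abs_rwpGammaCDF_le {k : ℕ} {z : ℝ} (hz : 0 < z) :
    |rwpGammaCDF R.α (R.L * R.μ + k) z| ≤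
      1 / Real.Gamma (R.L * R.μ + 1) * z ^ (R.L * R.μ + k) := by
  have hm := R.combined_pos
  have hmk : 0 < R.L * R.μ + k := by positivity
  rw [abs_of_nonneg (rwpGammaCDF_nonneg hmk hz.le)]
  exact (rwpGammaCDF_le_moment R.α_pos hmk hz.le).trans (R.moment_term_le hz.le)

theorem abs_rwpGammaCDF_sub_le {z : ℝ} (hz : 0 < z) :
    |rwpGammaCDF R.α (R.L * R.μ + (0 : ℕ)) z - rwpMoment R.α (R.L * R.μ) /
      Real.Gamma (R.L * R.μ + 1) * z ^ (R.L * R.μ)| ≤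
      1 / ((R.L * R.μ + 1) * Real.Gamma (R.L * R.μ)) * z ^ (R.L * R.μ + 1) := by
  have hm := R.combined_pos
  have h1 := rwpGammaCDF_le_moment R.α_pos hm hz.le
  have h2 := moment_sub_le_rwpGammaCDF R.α_pos hm hz.le
  have h3 : 0 < Real.Gamma (R.L * R.μ) := Real.Gamma_pos_of_pos hm
  have h4 : 0 ≤ z ^ (R.L * R.μ + 1) / ((R.L * R.μ + 1) * Real.Gamma (R.L * R.μ)) := by positivity
  rw [Nat.cast_zero, add_zero, one_div_mul_eq_div, div_mul_eq_mul_div, abs_le]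
  constructor <;> linarith

theorem isEquivalent_cdfWith_besselI {γ : ℝ} (hγ : 0 < γ) :
    (fun g => R.cdfWith besselI g γ) ~[atTop]
      fun g => R.leadingCoeff * (R.K₂ g * γ) ^ (R.L * R.μ) := by
  refine R.isEquivalent_mixture (c := fun _ => 1) (fun _ => by simp) rfl hγ
    (fun k z hz => R.abs_rwpGammaCDF_le hz) (fun z hz => R.abs_rwpGammaCDF_sub_le hz)
    fun g hg => ?_
  simp only [one_mul]
  exact (R.hasSum_cdfWith_besselI hg hγ.le).tsum_eq.symm

theorem isEquivalent_cdfWith_besselApprox {p : ℕ} (hp : 1 ≤ p) {γ : ℝ} (hγ : 0 < γ) :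
    (fun g => R.cdfWith (besselApprox p) g γ) ~[atTop]
      fun g => R.leadingCoeff * (R.K₂ g * γ) ^ (R.L * R.μ) :=
  R.isEquivalent_mixture (besselRatio_mem_Icc hp) (besselRatio_zero p) hγ
    (fun _ _ hz => R.abs_rwpGammaCDF_le hz) (fun _ hz => R.abs_rwpGammaCDF_sub_le hz)
    fun _ hg => R.cdfWith_besselApprox_eq_tsum hp hg hγ.le

theorem isEquivalent_asympCDF {p : ℕ} (hp : 1 ≤ p) {γ : ℝ} (hγ : 0 < γ) :
    (fun g => R.asympCDF p g γ) ~[atTop]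
      fun g => R.leadingCoeff * (R.K₂ g * γ) ^ (R.L * R.μ) := by
  have hm := R.combined_pos
  refine R.isEquivalent_mixture (besselRatio_mem_Icc hp) (besselRatio_zero p) hγ (C := 0)
    (φ := fun k z => rwpMoment R.α (R.L * R.μ + k) * z ^ (R.L * R.μ + k) /
        Real.Gamma (R.L * R.μ + k + 1))
    (fun k z hz => ?_) (fun z hz => ?_) fun g hg => R.asympCDF_eq_tsum hp hg hγ
  · have hmk : 0 < R.L * R.μ + k := by positivity
    have h1 := rwpMoment_pos R.α_pos hmk
    have h2 : 0 < Real.Gamma (R.L * R.μ + k + 1) := Real.Gamma_pos_of_pos (by linarith)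
    rw [abs_of_nonneg (by positivity)]
    exact R.moment_term_le hz.le
  · rw [Nat.cast_zero, add_zero, div_mul_eq_mul_div, sub_self, zero_mul, abs_zero]

end RFHop

/-! ## Positive square-integrable laws without atoms -/

/-- A probability law on `(0, ∞)` without atoms and with a finite second moment. -/
structure IsPositiveDiffuse (μ : Measure ℝ) : Prop where
  prob : IsProbabilityMeasure μ
  pos : ∀ᵐ x ∂μ, 0 < x
  sq : Integrable (fun x => x ^ 2) μ
  noAtoms : ∀ x, μ {x} = 0

namespace IsPositiveDiffuse

theorem of_density {s : Set ℝ} (hs : MeasurableSet s) (hs0 : s ⊆ Set.Ioi 0) {f : ℝ → ℝ}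
    (hf : IntegrableOn f s) (h0 : ∀ x ∈ s, 0 ≤ f x) (h1 : ∫ x in s, f x = 1)
    (h2 : IntegrableOn (fun x => x ^ 2 * f x) s) :
    IsPositiveDiffuse ((volume.restrict s).withDensity fun x => ENNReal.ofReal (f x)) := by
  have hac := withDensity_absolutelyContinuous (volume.restrict s) fun x => ENNReal.ofReal (f x)
  refine ⟨⟨?_⟩, ?_, ?_, ?_⟩
  · rw [withDensity_apply _ MeasurableSet.univ, Measure.restrict_univ,
      ← ofReal_integral_eq_lintegral_ofReal hf, h1, ENNReal.ofReal_one]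
    filter_upwards [ae_restrict_mem hs] with x hx using h0 x hx
  · exact hac.ae_le ((ae_restrict_mem hs).mono fun x hx => hs0 hx)
  · rw [integrable_withDensity_iff_integrable_smul₀'
      hf.aestronglyMeasurable.aemeasurable.ennreal_ofReal
      (Eventually.of_forall fun _ => ENNReal.ofReal_lt_top)]
    refine IntegrableOn.congr_fun h2 (fun x hx => ?_) hs
    rw [ENNReal.toReal_ofReal (h0 x hx), smul_eq_mul, mul_comm]
  · intro x
    exact hac (measure_singleton x)

variable {μ ν : Measure ℝ}

theorem memLp (h : IsPositiveDiffuse μ) : MemLp id 2 μ :=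
  (memLp_two_iff_integrable_sq aestronglyMeasurable_id).2 h.sq

theorem integrable (h : IsPositiveDiffuse μ) : Integrable id μ :=
  have := h.prob
  h.memLp.integrable one_le_two

theorem integral_pos (h : IsPositiveDiffuse μ) : 0 < ∫ x, x ∂μ := by
  have := h.prob
  rw [integral_pos_iff_support_of_nonneg_ae (h.pos.mono fun x hx => hx.le) h.integrable]
  have hae : ∀ᵐ x ∂μ, x ∈ Function.support fun x : ℝ => x := h.pos.mono fun x hx => hx.ne'
  rw [pos_iff_ne_zero]
  intro h0
  have h1 : μ (Function.support fun x : ℝ => x) = 1 :=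
    (measure_congr (eventuallyEq_univ.2 hae)).trans measure_univ
  rw [h1] at h0
  exact one_ne_zero h0

/-- Zero variance would concentrate the law at its mean, which would then be an atom. -/
theorem variance_pos (h : IsPositiveDiffuse μ) : 0 < variance id μ := by
  have := h.prob
  refine lt_of_le_of_ne (variance_nonneg _ _) fun h0 => ?_
  have h1 : evariance id μ = 0 := by
    rw [← h.memLp.ofReal_variance_eq, ← h0, ENNReal.ofReal_zero]
  rw [evariance_eq_zero_iff aemeasurable_id] at h1
  have h2 : ∀ᵐ x ∂μ, x ∉ ({∫ x, id x ∂μ} : Set ℝ) :=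
    measure_eq_zero_iff_ae_notMem.1 (h.noAtoms _)
  obtain ⟨x, hx1, hx2⟩ := (h1.and h2).exists
  exact hx2 hx1

/-- No atoms: for fixed `y > 0` the event `x y = c` forces `x = c / y`, a null set. Square
integrability is Fubini, since the square of a product factors. -/
theorem map_mul (hμ : IsPositiveDiffuse μ) (hν : IsPositiveDiffuse ν) :
    IsPositiveDiffuse ((μ.prod ν).map fun z => z.1 * z.2) := by
  have := hμ.prob
  have := hν.prob
  have hmeas : Measurable fun z : ℝ × ℝ => z.1 * z.2 := by fun_prop
  refine ⟨Measure.isProbabilityMeasure_map hmeas.aemeasurable, ?_, ?_, fun c => ?_⟩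
  · rw [ae_map_iff hmeas.aemeasurable measurableSet_Ioi]
    have h1 : ∀ᵐ z ∂(μ.prod ν), 0 < z.1 := Measure.quasiMeasurePreserving_fst.ae hμ.pos
    have h2 : ∀ᵐ z ∂(μ.prod ν), 0 < z.2 := Measure.quasiMeasurePreserving_snd.ae hν.pos
    filter_upwards [h1, h2] with z hz1 hz2 using mul_pos hz1 hz2
  · rw [integrable_map_measure (by fun_prop) hmeas.aemeasurable]
    refine (hμ.sq.mul_prod hν.sq).congr (Eventually.of_forall fun z => ?_)
    simp only [Function.comp]
    ring
  · rw [Measure.map_apply hmeas (measurableSet_singleton c), Measure.prod_apply_symm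
      (hmeas (measurableSet_singleton c)), lintegral_eq_zero_iff
      (measurable_measure_prodMk_right (hmeas (measurableSet_singleton c)))]
    filter_upwards [hν.pos] with y hy
    refine measure_mono_null (t := {c / y}) (fun x hx => ?_) (hμ.noAtoms _)
    simp only [Set.mem_preimage, Set.mem_singleton_iff] at hx ⊢
    rw [← hx, mul_div_cancel_right₀ _ hy.ne']

end IsPositiveDiffuse

/-! ## The gains of the optical links -/

namespace OpticalLink

variable (O : OpticalLink)

theorem gg_eqOn (s : ℝ) : Set.EqOn (fun x => x ^ s * (O.c * x ^ (O.a * O.c - 1) /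
      (O.b ^ (O.a * O.c) * Real.Gamma O.a) * Real.exp (-(x / O.b) ^ O.c)))
    (fun x => O.c / (O.b ^ (O.a * O.c) * Real.Gamma O.a) *
      (x ^ (s + O.a * O.c - 1) * Real.exp (-O.b ^ (-O.c) * x ^ O.c))) (Set.Ioi 0) := by
  intro x hx
  have hx' : 0 < x := hx
  simp only
  rw [Real.div_rpow hx'.le O.b_pos.le, Real.rpow_neg O.b_pos.le, add_sub_assoc, Real.rpow_add hx',
    ← neg_div, neg_mul, inv_mul_eq_div, neg_div]
  ring

theorem integrableOn_gg {s : ℝ} (hs : 0 ≤ s) :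
    IntegrableOn (fun x => x ^ s * (O.c * x ^ (O.a * O.c - 1) /
      (O.b ^ (O.a * O.c) * Real.Gamma O.a) * Real.exp (-(x / O.b) ^ O.c))) (Set.Ioi 0) := by
  have hac := mul_pos O.a_pos O.c_pos
  refine IntegrableOn.congr_fun (Integrable.const_mul (integrableOn_rpow_mul_exp_neg_mul_rpow
    (by linarith) O.c_pos (Real.rpow_pos_of_pos O.b_pos _)) _) (O.gg_eqOn s).symm measurableSet_Ioi

theorem integral_gg : ∫ x in Set.Ioi 0, O.c * x ^ (O.a * O.c - 1) /
      (O.b ^ (O.a * O.c) * Real.Gamma O.a) * Real.exp (-(x / O.b) ^ O.c) = 1 := by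
  have hb := O.b_pos
  have hc := O.c_pos
  have hac := mul_pos O.a_pos hc
  have hΓ := Real.Gamma_pos_of_pos O.a_pos
  have h := setIntegral_congr_fun (μ := volume) measurableSet_Ioi (O.gg_eqOn 0)
  simp only [Real.rpow_zero, one_mul, zero_add] at h
  rw [h, integral_const_mul, integral_rpow_mul_exp_neg_mul_rpow hc (by linarith)
    (Real.rpow_pos_of_pos hb _), ← Real.rpow_mul hb.le, sub_add_cancel]
  have e1 : -O.c * (-(O.a * O.c) / O.c) = O.a * O.c := by field_simp
  have e2 : O.a * O.c / O.c = O.a := by field_simp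
  have hbp := Real.rpow_pos_of_pos hb (O.a * O.c)
  rw [e1, e2]
  field_simp

theorem integrableOn_exp {s : ℝ} (hs : 0 ≤ s) :
    IntegrableOn (fun x => x ^ s * Real.exp (-x / O.ν)) (Set.Ioi 0) := by
  have h := integrableOn_rpow_mul_exp_neg_mul_rpow (s := s) (b := 1 / O.ν) (by linarith) one_pos
    (one_div_pos.2 O.ν_pos)
  refine h.congr_fun (fun x _ => ?_) measurableSet_Ioi
  simp only [Real.rpow_one]
  rw [neg_mul, one_div_mul_eq_div, neg_div]

theorem integral_exp : ∫ x in Set.Ioi 0, Real.exp (-x / O.ν) = O.ν := by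
  have h := integral_exp_neg_mul_rpow (p := 1) one_pos (one_div_pos.2 O.ν_pos)
  simp only [Real.rpow_one] at h
  have h2 : ∀ x : ℝ, -(1 / O.ν) * x = -x / O.ν := fun x => by ring
  simp_rw [h2] at h
  rw [h]
  norm_num [Real.rpow_neg_one]

theorem integrableOn_rpow_mul_meggPDF {s : ℝ} (hs : 0 ≤ s) :
    IntegrableOn (fun x => x ^ s * O.meggPDF x) (Set.Ioi 0) := by
  refine (((O.integrableOn_exp hs).const_mul (O.ω / O.ν)).add
    ((O.integrableOn_gg hs).const_mul (1 - O.ω))).congr (Eventually.of_forall fun x => ?_)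
  simp only [Pi.add_apply, meggPDF]
  ring

theorem integral_meggPDF : ∫ x in Set.Ioi 0, O.meggPDF x = 1 := by
  have h1 := O.integrableOn_exp le_rfl
  have h2 := O.integrableOn_gg le_rfl
  simp only [Real.rpow_zero, one_mul] at h1 h2
  simp only [meggPDF]
  rw [integral_add (h1.const_mul _) (h2.const_mul _), integral_const_mul, integral_const_mul,
    O.integral_exp, O.integral_gg]
  have := O.ν_pos.ne'
  field_simp
  ring

theorem isPositiveDiffuse_megg : IsPositiveDiffuse
    ((volume.restrict (Set.Ioi 0)).withDensity fun x => ENNReal.ofReal (O.meggPDF x)) := by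
  refine IsPositiveDiffuse.of_density measurableSet_Ioi subset_rfl ?_ (fun x hx => ?_)
    O.integral_meggPDF ?_
  · simpa using O.integrableOn_rpow_mul_meggPDF le_rfl
  · have hx' : 0 < x := hx
    have := O.ω_pos
    have := sub_pos.2 O.ω_lt_one
    have := O.ν_pos
    have := O.c_pos
    have := O.b_pos
    have := Real.Gamma_pos_of_pos O.a_pos
    unfold meggPDF
    positivity
  · simpa using O.integrableOn_rpow_mul_meggPDF (s := 2) zero_le_two

theorem isPositiveDiffuse_pointing : IsPositiveDiffuse
    ((volume.restrict (Set.Ioo 0 O.J)).withDensity fun x => ENNReal.ofReal (O.pointingPDF x)) := by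
  have hJ := O.J_pos
  have hξ : 0 < O.ξ ^ 2 := by have := O.ξ_pos; positivity
  have hint : IntegrableOn O.pointingPDF (Set.Ioo 0 O.J) := by
    have h := (intervalIntegrable_iff_integrableOn_Ioo_of_le hJ.le).1
      (intervalIntegrable_rpow_sub_one hξ 0 O.J)
    exact (h.const_mul (O.ξ ^ 2)).div_const _
  refine IsPositiveDiffuse.of_density measurableSet_Ioo Set.Ioo_subset_Ioi_self hint
    (fun x hx => ?_) ?_ ?_
  · have := hx.1
    unfold pointingPDF
    positivity
  · rw [← integral_Ioc_eq_integral_Ioo, ← intervalIntegral.integral_of_le hJ.le]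
    simp only [pointingPDF]
    rw [intervalIntegral.integral_div, intervalIntegral.integral_const_mul,
      integral_rpow_sub_one hξ]
    have := Real.rpow_pos_of_pos hJ (O.ξ ^ 2)
    generalize O.ξ ^ 2 = e at *
    field_simp
  · refine Integrable.mono' (hint.norm.const_mul (O.J ^ 2)) ?_ ?_
    · exact (by fun_prop : AEStronglyMeasurable (fun x : ℝ => x ^ 2) _).mul
        hint.aestronglyMeasurable
    · filter_upwards [ae_restrict_mem measurableSet_Ioo] with x hx
      rw [norm_mul, Real.norm_of_nonneg (sq_nonneg x)]
      exact mul_le_mul_of_nonneg_right (pow_le_pow_left₀ hx.1.le hx.2.le 2) (norm_nonneg _)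

theorem isPositiveDiffuse_gainLaw : IsPositiveDiffuse O.gainLaw :=
  O.isPositiveDiffuse_megg.map_mul O.isPositiveDiffuse_pointing

end OpticalLink

/-! ## The optical hop -/

namespace OpticalHop

variable (O : OpticalHop)

theorem isPositiveDiffuse_cascadeLaw : IsPositiveDiffuse O.cascadeLaw :=
  O.linkI.isPositiveDiffuse_gainLaw.map_mul O.linkD.isPositiveDiffuse_gainLaw

theorem meanY_pos : 0 < O.meanY := O.isPositiveDiffuse_cascadeLaw.integral_pos

theorem integral_sumLaw_pos : 0 < ∫ x, x ∂O.sumLaw := by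
  have h := O.isPositiveDiffuse_cascadeLaw
  have := h.prob
  have hN : (0 : ℝ) < O.N := by exact_mod_cast O.N_pos
  have hmp := fun i => measurePreserving_eval (fun _ : Fin O.N => O.cascadeLaw) i
  have hcoord : ∀ i, ∫ y, y i ∂(Measure.pi fun _ : Fin O.N => O.cascadeLaw) = O.meanY := by
    intro i
    rw [meanY]
    conv_rhs => rw [← (hmp i).map_eq]
    rw [integral_map (hmp i).measurable.aemeasurable (by fun_prop)]
  have hint : ∀ i, Integrable (fun y : Fin O.N → ℝ => y i)
      (Measure.pi fun _ : Fin O.N => O.cascadeLaw) := fun i =>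
    (hmp i).integrable_comp_of_integrable h.integrable
  rw [sumLaw, integral_map (by fun_prop) (by fun_prop), integral_finsetSum _ fun i _ => hint i]
  simp only [hcoord, Finset.sum_const, Finset.card_univ, Fintype.card_fin, nsmul_eq_mul]
  exact mul_pos hN O.meanY_pos

theorem variance_sumLaw_pos : 0 < variance id O.sumLaw := by
  have h := O.isPositiveDiffuse_cascadeLaw
  have := h.prob
  have hN : (0 : ℝ) < O.N := by exact_mod_cast O.N_pos
  have hv := variance_sum_pi (μ := fun _ : Fin O.N => O.cascadeLaw) (X := fun _ => id)
    fun _ => h.memLp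
  have hS : (fun y : Fin O.N → ℝ => ∑ u, y u) = ∑ i, fun y : Fin O.N → ℝ => id (y i) := by
    ext y; simp
  rw [sumLaw, variance_id_map (by fun_prop), hS, hv]
  simp only [Finset.sum_const, Finset.card_univ, Fintype.card_fin, nsmul_eq_mul]
  exact mul_pos hN h.variance_pos

theorem rho_pos : 0 < O.rho :=
  div_pos (pow_pos O.integral_sumLaw_pos 2) O.variance_sumLaw_pos

theorem scale_pos : 0 < O.scale := div_pos O.variance_sumLaw_pos O.integral_sumLaw_pos

theorem r_pos : 0 < O.r := by rcases O.r_eq with h | h <;> omega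

/-- The normalized threshold of the gamma variable. -/
noncomputable def threshold (τ γ : ℝ) : ℝ := O.meanY * (γ / τ) ^ (1 / (O.r : ℝ)) / O.scale

theorem threshold_pos {τ γ : ℝ} (hτ : 0 < τ) (hγ : 0 < γ) : 0 < O.threshold τ γ := by
  have := O.meanY_pos
  have := O.scale_pos
  unfold threshold
  positivity

theorem snr_le_iff {τ γ x : ℝ} (hτ : 0 < τ) (hγ : 0 < γ) (hx : 0 < x) :
    O.snr τ x ≤ γ ↔ x ≤ O.scale * O.threshold τ γ := by
  have hY := O.meanY_pos
  have hw := O.scale_pos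
  have hr : (0 : ℝ) < O.r := by exact_mod_cast O.r_pos
  have h1 : O.scale * O.threshold τ γ = O.meanY * (γ / τ) ^ (1 / (O.r : ℝ)) := by
    rw [threshold]; field_simp
  rw [h1, snr, ← le_div_iff₀' hτ, ← div_le_iff₀' hY, ← Real.rpow_natCast, one_div,
    Real.le_rpow_inv_iff_of_pos (by positivity) (by positivity) hr]

theorem measureReal_snr_le_eq {τ γ : ℝ} (hτ : 0 < τ) (hγ : 0 < γ) :
    O.gammaApproxLaw.real {x | O.snr τ x ≤ γ} =
      lowerGamma O.rho (O.threshold τ γ) / Real.Gamma O.rho := by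
  have hρ := O.rho_pos
  have hw := O.scale_pos
  have hT := O.threshold_pos hτ hγ
  have hΓ := Real.Gamma_pos_of_pos hρ
  have hA : MeasurableSet {x | O.snr τ x ≤ γ} := by
    refine measurableSet_le ?_ measurable_const
    unfold snr
    fun_prop
  have hs : 0 < 1 / O.scale := one_div_pos.2 hw
  have h1 : O.gammaApproxLaw.real {x | O.snr τ x ≤ γ} =
      ∫ x in {x | O.snr τ x ≤ γ}, gammaPDFReal O.rho (1 / O.scale) x := by
    rw [measureReal_def, gammaApproxLaw, gammaMeasure, withDensity_apply _ hA,
      integral_eq_lintegral_of_nonneg_ae]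
    · rfl
    · exact Eventually.of_forall fun x => gammaPDFReal_nonneg hρ hs x
    · exact (measurable_gammaPDFReal _ _).aestronglyMeasurable
  have h2 : ∫ x in {x | O.snr τ x ≤ γ}, gammaPDFReal O.rho (1 / O.scale) x =
      ∫ x in Set.Ioc 0 (O.scale * O.threshold τ γ), gammaPDFReal O.rho (1 / O.scale) x := by
    rw [← integral_indicator hA, ← integral_indicator measurableSet_Ioc]
    refine integral_congr_ae ?_
    -- For `x < 0` the event may hold, but the gamma density vanishes; `x = 0` is a null set. Only
    -- positive `x`, where the threshold is equivalent to the event, remain.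
    have hne : ∀ᵐ x : ℝ, x ≠ 0 := measure_eq_zero_iff_ae_notMem.1 (measure_singleton (0 : ℝ))
    filter_upwards [hne] with x hx
    rcases lt_or_gt_of_ne hx with hx | hx
    · have h0 : gammaPDFReal O.rho (1 / O.scale) x = 0 := by
        rw [gammaPDFReal, if_neg (not_le.2 hx)]
      rw [Set.indicator_apply, Set.indicator_apply, h0]
      simp
    · rw [Set.indicator_apply, Set.indicator_apply]
      refine if_congr ?_ rfl rfl
      rw [Set.mem_ofPred_eq, O.snr_le_iff hτ hγ hx, Set.mem_Ioc]
      exact ⟨fun h => ⟨hx, h⟩, fun h => h.2⟩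
  have h3 := intervalIntegral.integral_comp_mul_right (a := 0) (b := O.scale * O.threshold τ γ)
    (fun t : ℝ => t ^ (O.rho - 1) * Real.exp (-t)) (c := 1 / O.scale) hs.ne'
  rw [zero_mul, show O.scale * O.threshold τ γ * (1 / O.scale) = O.threshold τ γ by field_simp,
    ← lowerGamma, smul_eq_mul, one_div, inv_inv] at h3
  rw [h1, h2, eq_div_iff hΓ.ne', ← inv_mul_cancel_left₀ hw.ne' (lowerGamma _ _), ← h3,
    ← intervalIntegral.integral_const_mul, ← intervalIntegral.integral_of_le (by positivity),
    ← intervalIntegral.integral_mul_const]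
  refine intervalIntegral.integral_congr fun x hx => ?_
  rw [Set.uIcc_of_le (by positivity)] at hx
  have hx0 := hx.1
  simp only [gammaPDFReal, if_pos hx0]
  rw [Real.mul_rpow hx0 (by positivity), one_div, Real.rpow_sub_one (inv_pos.2 hw).ne', mul_comm x O.scale⁻¹]
  field_simp

theorem Ups₄_pos {τ : ℝ} (hτ : 0 < τ) : 0 < O.Ups₄ τ := by
  have := O.meanY_pos
  have := O.scale_pos
  have hr : (0 : ℝ) < O.r := by exact_mod_cast O.r_pos
  unfold Ups₄
  positivity

theorem r_mul_rpow_Ups₄ {τ γ : ℝ} (hτ : 0 < τ) (hγ : 0 < γ) :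
    O.r * (O.Ups₄ τ * γ) ^ (1 / (O.r : ℝ)) = O.threshold τ γ := by
  have hY := O.meanY_pos
  have hw := O.scale_pos
  have hr : (0 : ℝ) < O.r := by exact_mod_cast O.r_pos
  have h1 : O.Ups₄ τ * γ = (O.meanY / (O.r * O.scale)) ^ O.r * (γ / τ) := by
    rw [Ups₄, div_pow, mul_pow]; field_simp
  rw [h1, Real.mul_rpow (by positivity) (by positivity), one_div,
    Real.pow_rpow_inv_natCast (by positivity) O.r_pos.ne', threshold]
  field_simp

/-- `Υ₃` carries exactly the inverse of the multiplication-formula constant in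
`meijerG_detector_eq`, so only `T^ρ / Γ(ρ)` is left. -/
theorem Ups₃_mul {τ γ : ℝ} (hτ : 0 < τ) (hγ : 0 < γ) :
    O.Ups₃ τ * γ ^ (O.rho / O.r) * (Real.sqrt O.r * (2 * Real.pi) ^ (((O.r : ℝ) - 1) / 2)) =
      O.threshold τ γ ^ O.rho / Real.Gamma O.rho := by
  have hY := O.meanY_pos
  have hw := O.scale_pos
  have hΓ := Real.Gamma_pos_of_pos O.rho_pos
  have hr : (0 : ℝ) < O.r := by exact_mod_cast O.r_pos
  have hsq := Real.sqrt_pos.2 hr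
  have hπ : 0 < (2 * Real.pi) ^ (((O.r : ℝ) - 1) / 2) := Real.rpow_pos_of_pos (by positivity) _
  rw [Ups₃, threshold, Real.div_rpow (by positivity) hw.le, Real.mul_rpow hY.le (by positivity),
    ← Real.rpow_mul (by positivity), one_div_mul_eq_div, Real.div_rpow hγ.le hτ.le]
  have h1 := Real.rpow_pos_of_pos hτ (O.rho / O.r)
  have h2 := Real.rpow_pos_of_pos hw O.rho
  field_simp

theorem cdf_eq_closedCDF {τ γ : ℝ} (hτ : 0 < τ) (hγ : 0 < γ) :
    ((lowerGamma O.rho (O.threshold τ γ) / Real.Gamma O.rho : ℝ) : ℂ) = O.closedCDF τ γ := by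
  have hG := meijerG_detector_eq O.r_eq O.rho_pos (mul_pos (O.Ups₄_pos hτ) hγ)
  rw [closedCDF]
  change _ = _ * meijerG O.r 1 ![1 - ((O.rho / O.r : ℝ) : ℂ)] (fun j : Fin (O.r + 1) =>
    if (j : ℕ) < O.r then (j : ℕ) / (O.r : ℂ) else -((O.rho / O.r : ℝ) : ℂ)) _
  rw [hG, ← Complex.ofReal_mul, ← mul_assoc, O.Ups₃_mul hτ hγ, O.r_mul_rpow_Ups₄ hτ hγ,
    lowerGamma_eq_powerAvg O.rho_pos (O.threshold_pos hτ hγ).le]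
  congr 1
  ring

/-! ### High-SNR asymptotics -/

theorem tendsto_threshold (γ : ℝ) :
    Tendsto (fun τ => O.threshold τ γ) atTop (𝓝 0) := by
  have hr : (0 : ℝ) < O.r := by exact_mod_cast O.r_pos
  have h1 : Tendsto (fun τ : ℝ => γ / τ) atTop (𝓝 0) := tendsto_id.const_div_atTop γ
  have h2 := (Real.continuous_rpow_const (one_div_pos.2 hr).le).tendsto 0 |>.comp h1
  rw [Real.zero_rpow (one_div_pos.2 hr).ne'] at h2
  have h3 := (h2.const_mul O.meanY).div_const O.scale
  rw [mul_zero, zero_div] at h3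
  exact h3

/-- For `r = 1` the single term is already the leading monomial. For `r = 2` the term `k = 2`
carries an extra factor `(Υ₄ γ)^(1/2) = T / 2`, so it is of higher order and its coefficient plays
no role in the limit. -/
theorem exists_asympCDF_eq {γ : ℝ} (hγ : 0 < γ) : ∃ C : ℝ, ∀ τ, 0 < τ →
    O.asympCDF τ γ = 1 / Real.Gamma (O.rho + 1) * O.threshold τ γ ^ O.rho +
      C * O.threshold τ γ ^ (O.rho + 1) := by
  have hρ := O.rho_pos
  have hΓ := Real.Gamma_pos_of_pos hρ
  rcases O.r_eq with hr | hr
  · refine ⟨0, fun τ hτ => ?_⟩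
    have hU := O.Ups₃_mul hτ hγ
    rw [hr] at hU
    simp only [Nat.cast_one, Real.sqrt_one, sub_self, zero_div, Real.rpow_zero, mul_one,
      div_one] at hU
    simp only [asympCDF, hr, Finset.Icc_self, Finset.sum_singleton, T₃]
    simp only [Nat.cast_one, le_refl, if_true, sub_self, sub_zero, Real.rpow_zero,
      Finset.erase_singleton, Finset.prod_empty, one_mul, div_one, hU]
    norm_num
    rw [add_comm 1 O.rho, Real.Gamma_add_one hρ.ne']
    field_simp
  -- The coefficient of the term `k = 2`: the common prefactor, the `1/2` from `(Υ₄ γ)^(1/2) = T /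
  -- 2`, and its Gamma quotient.
  · refine ⟨1 / Real.Gamma O.rho / (2 * Real.sqrt Real.pi) * (1 / 2) *
      (Real.Gamma (-1 / 2) * Real.Gamma (1 / 2 + O.rho / 2) /
        Real.Gamma (1 + O.rho / 2 + 1 / 2)), fun τ hτ => ?_⟩
    have hy := mul_pos (O.Ups₄_pos hτ) hγ
    have hT := O.threshold_pos hτ hγ
    have hU := O.Ups₃_mul hτ hγ
    have hV := O.r_mul_rpow_Ups₄ hτ hγ
    rw [hr] at hU hV
    have hπ : Real.sqrt (2 : ℕ) * (2 * Real.pi) ^ ((((2 : ℕ) : ℝ) - 1) / 2) =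
        2 * Real.sqrt Real.pi := by
      rw [show (((2 : ℕ) : ℝ) - 1) / 2 = 1 / 2 by norm_num, ← Real.sqrt_eq_rpow,
        Real.sqrt_mul (by norm_num), ← mul_assoc]
      norm_num
    rw [hπ] at hU
    have hsπ : 0 < Real.sqrt Real.pi := Real.sqrt_pos.2 Real.pi_pos
    rw [← eq_div_iff (by positivity)] at hU
    have hI : Finset.Icc 1 2 = {1, 2} := by decide
    have hI1 : (Finset.Icc 1 2).erase 1 = {2} := by decide
    have hI2 : (Finset.Icc 1 2).erase 2 = {1} := by decide
    rw [asympCDF]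
    simp only [hr]
    rw [hU, hI, Finset.sum_pair (by decide), ← hI, hI1, hI2, Finset.prod_singleton,
      Finset.prod_singleton]
    have t1 : O.T₃ 1 = 1 := by norm_num [T₃, hr]
    have t2 : O.T₃ 2 = 1 / 2 := by norm_num [T₃, hr]
    have t3 : O.T₃ (2 + 1) = 1 + O.rho / 2 := by norm_num [T₃, hr]
    rw [t1, t2, t3]
    have p1 : (1 / (O.Ups₄ τ * γ)) ^ ((1 : ℝ) / 2 - 1) = O.threshold τ γ / 2 := by
      rw [one_div, Real.inv_rpow hy.le, ← Real.rpow_neg hy.le, ← hV]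
      push_cast
      norm_num
    have g1 : Real.Gamma ((1 : ℝ) - 1 / 2) = Real.sqrt Real.pi := by
      rw [← Real.Gamma_one_half_eq]; norm_num
    have hρ2 : 0 < O.rho / 2 := by positivity
    have hΓ2 := Real.Gamma_pos_of_pos hρ2
    have g2 : Real.Gamma (1 + (1 + O.rho / 2) - 1) = O.rho / 2 * Real.Gamma (O.rho / 2) := by
      rw [← Real.Gamma_add_one hρ2.ne']; ring_nf
    rw [p1, g1, g2, sub_self, Real.rpow_zero, Real.rpow_add_one hT.ne', Real.Gamma_add_one hρ.ne']
    have q1 : (1 : ℝ) + O.rho / (2 : ℕ) - 1 = O.rho / 2 := by push_cast; ring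
    have q2 : (1 : ℝ) + O.rho / (2 : ℕ) - 1 / 2 = 1 / 2 + O.rho / 2 := by push_cast; ring
    have q3 : (1 : ℝ) + (1 + O.rho / 2) - 1 / 2 = 1 + O.rho / 2 + 1 / 2 := by ring
    have q4 : (1 : ℝ) / 2 - 1 = -1 / 2 := by ring
    rw [q1, q2, q3, q4]
    have hΓ3 : 0 < Real.Gamma (1 + O.rho / 2 + 1 / 2) := Real.Gamma_pos_of_pos (by positivity)
    field_simp

theorem isEquivalent_asympCDF {γ : ℝ} (hγ : 0 < γ) :
    (fun τ => O.asympCDF τ γ) ~[atTop]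
      fun τ => 1 / Real.Gamma (O.rho + 1) * O.threshold τ γ ^ O.rho := by
  obtain ⟨C, hC⟩ := O.exists_asympCDF_eq hγ
  have hΓ : 0 < Real.Gamma (O.rho + 1) := Real.Gamma_pos_of_pos (by linarith [O.rho_pos])
  have hpos : ∀ᶠ τ in atTop, 0 < O.threshold τ γ := by
    filter_upwards [eventually_gt_atTop 0] with τ hτ using O.threshold_pos hτ hγ
  refine isEquivalent_of_abs_sub_le (C := |C|) (by positivity) hpos (O.tendsto_threshold γ) ?_
  filter_upwards [eventually_gt_atTop 0, hpos] with τ hτ hT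
  rw [hC τ hτ, add_sub_cancel_left, abs_mul, abs_of_pos (Real.rpow_pos_of_pos hT _)]

theorem isEquivalent_cdf {γ : ℝ} (hγ : 0 < γ) :
    (fun τ => lowerGamma O.rho (O.threshold τ γ) / Real.Gamma O.rho) ~[atTop]
      fun τ => 1 / Real.Gamma (O.rho + 1) * O.threshold τ γ ^ O.rho := by
  have hρ := O.rho_pos
  have hΓ := Real.Gamma_pos_of_pos hρ
  have hpos : ∀ᶠ τ in atTop, 0 < O.threshold τ γ := by
    filter_upwards [eventually_gt_atTop 0] with τ hτ using O.threshold_pos hτ hγ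
  rw [Real.Gamma_add_one hρ.ne']
  refine isEquivalent_of_abs_sub_le (C := 1 / ((O.rho + 1) * Real.Gamma O.rho)) (by positivity) hpos
    (O.tendsto_threshold γ) ?_
  filter_upwards [hpos] with τ hT
  have h1 := div_le_div_of_nonneg_right (lowerGamma_le_rpow hρ hT.le) hΓ.le
  have h2 := div_le_div_of_nonneg_right (rpow_sub_le_lowerGamma hρ hT.le) hΓ.le
  have h3 : 0 ≤ 1 / ((O.rho + 1) * Real.Gamma O.rho) * O.threshold τ γ ^ (O.rho + 1) := by
    have := Real.rpow_pos_of_pos hT (O.rho + 1)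
    positivity
  have e1 : O.threshold τ γ ^ O.rho / O.rho / Real.Gamma O.rho =
      1 / (O.rho * Real.Gamma O.rho) * O.threshold τ γ ^ O.rho := by field_simp
  have e2 : O.threshold τ γ ^ (O.rho + 1) / (O.rho + 1) / Real.Gamma O.rho =
      1 / ((O.rho + 1) * Real.Gamma O.rho) * O.threshold τ γ ^ (O.rho + 1) := by field_simp
  rw [e1] at h1
  rw [sub_div, e1, e2] at h2
  rw [abs_le]
  constructor <;> linarith

end OpticalHop

/-! ## The dual-hop link -/

/-- Since `u` and `v` are positive, `u + v` dominates each of them, so no cancellation can spoil the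
sum of the two errors; the product is `o(v)` because `f → 0`. -/
theorem isEquivalent_add_sub_mul {α : Type*} {l : Filter α} {f h u v : α → ℝ}
    (hu : ∀ᶠ x in l, 0 < u x) (hv : ∀ᶠ x in l, 0 < v x) (hfu : f ~[l] u) (hhv : h ~[l] v)
    (hf0 : Tendsto f l (𝓝 0)) :
    (fun x => f x + h x - f x * h x) ~[l] fun x => u x + v x := by
  have h1 : (fun x => (f x - u x) + (h x - v x)) =o[l] fun x => u x + v x := by
    refine (hfu.isLittleO.add_add hhv.isLittleO).congr' EventuallyEq.rfl ?_
    filter_upwards [hu, hv] with x hx hy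
    rw [Real.norm_of_nonneg hx.le, Real.norm_of_nonneg hy.le]
  have h2 : (fun x => f x * h x) =o[l] fun x => u x + v x := by
    have h3 : (fun x => f x * h x) =o[l] fun x => (1 : ℝ) * v x :=
      ((isLittleO_one_iff ℝ).2 hf0).mul_isBigO hhv.isBigO
    refine h3.trans_isBigO (IsBigO.of_bound 1 ?_)
    filter_upwards [hu, hv] with x hx hy
    rw [one_mul, one_mul, Real.norm_of_nonneg hy.le, Real.norm_of_nonneg (by linarith)]
    linarith
  refine IsLittleO.isEquivalent ((h1.sub h2).congr_left fun x => ?_)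
  simp only [Pi.sub_apply]
  ring

/-- The distribution function of the minimum of two independent random variables. -/
theorem measureReal_min_le {Ω : Type*} [MeasurableSpace Ω] {P : Measure Ω}
    [IsProbabilityMeasure P] {X Y : Ω → ℝ} (hY : AEMeasurable Y P) (h : IndepFun X Y P) (t : ℝ) :
    P.real {ω | min (X ω) (Y ω) ≤ t} = P.real {ω | X ω ≤ t} + P.real {ω | Y ω ≤ t} -
      P.real {ω | X ω ≤ t} * P.real {ω | Y ω ≤ t} := by
  have h1 : {ω | min (X ω) (Y ω) ≤ t} = {ω | X ω ≤ t} ∪ {ω | Y ω ≤ t} := by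
    ext ω; simp
  have h2 := measureReal_union_add_inter₀ (μ := P) (s := {ω | X ω ≤ t})
    (hY.nullMeasurableSet_preimage (measurableSet_Iic (a := t)))
  have h3 : P.real ({ω | X ω ≤ t} ∩ {ω | Y ω ≤ t}) =
      P.real {ω | X ω ≤ t} * P.real {ω | Y ω ≤ t} := by
    have := h.measure_inter_preimage_eq_mul _ _ (measurableSet_Iic (a := t))
      (measurableSet_Iic (a := t))
    have h4 := congrArg ENNReal.toReal this
    rw [ENNReal.toReal_mul] at h4
    exact h4
  rw [h1]
  have h5 : P.real ({ω | X ω ≤ t} ∪ {ω | Y ω ≤ t}) + P.real ({ω | X ω ≤ t} ∩ {ω | Y ω ≤ t}) =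
    P.real {ω | X ω ≤ t} + P.real {ω | Y ω ≤ t} := h2
  linarith

theorem mainTheorem11 {Ω : Type*} [MeasurableSpace Ω] (P : Measure Ω) [IsProbabilityMeasure P]
    (R : RFHop) (O : OpticalHop)
    (h : Fin R.L → Ω → ℝ) (q χ : Ω → ℝ)
    (hh : ∀ l, HasLaw (h l) (kappaMuLaw R.κ R.μ) P)
    (hq : HasLaw q (rwpLaw R.D) P)
    (hχ : HasLaw χ O.gammaApproxLaw P)
    (h_indep : iIndepFun h P)
    (hq_indep : IndepFun (fun ω l => h l ω) q P)
    (hχ_indep : IndepFun (fun ω => ((fun l => h l ω), q ω)) χ P)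
    (γR γD : ℝ → Ω → ℝ) (γeq : ℝ → ℝ → Ω → ℝ)
    (hγR : ∀ g ω, γR g ω = R.snr g (fun l => h l ω) (q ω))
    (hγD : ∀ τ ω, γD τ ω = O.snr τ (χ ω))
    (hγeq : ∀ g τ ω, γeq g τ ω = min (γR g ω) (γD τ ω))
    (FR FD : ℝ → ℝ → ℝ) (Feq : ℝ → ℝ → ℝ → ℝ)
    (hFR : ∀ g γ, FR g γ = P.real {ω | γR g ω ≤ γ})
    (hFD : ∀ τ γ, FD τ γ = P.real {ω | γD τ ω ≤ γ})
    (hFeq : ∀ g τ γ, Feq g τ γ = P.real {ω | γeq g τ ω ≤ γ})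
    (γ : ℝ) (hγ : 0 < γ) :
    -- the end-to-end CDF in terms of the CDFs of the hops
    (∀ g τ : ℝ, 0 < g → 0 < τ → Feq g τ γ = FR g γ + FD τ γ - FR g γ * FD τ γ) ∧
    -- the CDF of the RF hop before the Bessel function is approximated
    (∀ g : ℝ, 0 < g → FR g γ = R.cdfWith besselI g γ) ∧
    -- the closed forms, the Bessel function being replaced by its approximation of order `p`
    (∀ τ : ℝ, 0 < τ → ((FD τ γ : ℝ) : ℂ) = O.closedCDF τ γ) ∧
    (∀ p : ℕ, 1 ≤ p → ∀ g : ℝ, 0 < g →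
      ((R.cdfWith (besselApprox p) g γ : ℝ) : ℂ) = R.closedCDF p g γ) ∧
    (∀ p : ℕ, 1 ≤ p → ∀ g τ : ℝ, 0 < g → 0 < τ →
      ((R.cdfWith (besselApprox p) g γ + FD τ γ - R.cdfWith (besselApprox p) g γ * FD τ γ : ℝ) : ℂ)
        = endToEndClosedCDF R O p g τ γ) ∧
    -- the closed form becomes exact as `p` tends to infinity
    (∀ g τ : ℝ, 0 < g → 0 < τ →
      Tendsto (fun p : ℕ => endToEndClosedCDF R O p g τ γ) atTop (𝓝 ((Feq g τ γ : ℝ) : ℂ))) ∧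
    -- high-SNR asymptotics, of the hops and end to end, for every order `p`
    (∀ p : ℕ, 1 ≤ p →
      (fun g : ℝ => FR g γ) ~[atTop] (fun g => R.asympCDF p g γ) ∧
      (fun g : ℝ => R.cdfWith (besselApprox p) g γ) ~[atTop] (fun g => R.asympCDF p g γ) ∧
      (fun τ : ℝ => FD τ γ) ~[atTop] (fun τ => O.asympCDF τ γ) ∧
      (fun x : ℝ × ℝ => Feq x.1 x.2 γ) ~[atTop ×ˢ atTop]
        (fun x => endToEndAsympCDF R O p x.1 x.2 γ) ∧
      (fun x : ℝ × ℝ => endToEndClosedCDF R O p x.1 x.2 γ) ~[atTop ×ˢ atTop]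
        (fun x => ((endToEndAsympCDF R O p x.1 x.2 γ : ℝ) : ℂ))) := by
  have hRmeas : ∀ g, Measurable fun z : (Fin R.L → ℝ) × ℝ => R.snr g z.1 z.2 := by
    intro g
    simp only [RFHop.snr, sq_abs]
    fun_prop
  have hDmeas : ∀ τ, Measurable (O.snr τ) := by
    intro τ
    unfold OpticalHop.snr
    fun_prop
  have hF : ∀ g τ : ℝ, Feq g τ γ = FR g γ + FD τ γ - FR g γ * FD τ γ := by
    intro g τ
    -- The two SNRs are measurable functions of `(h, q)` and of `χ`, which are independent.
    have hi : IndepFun (γR g) (γD τ) P := by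
      have h1 := hχ_indep.comp (hRmeas g) (hDmeas τ)
      have e1 : γR g = (fun z : (Fin R.L → ℝ) × ℝ => R.snr g z.1 z.2) ∘
          fun ω => ((fun l => h l ω), q ω) := funext fun ω => hγR g ω
      have e2 : γD τ = O.snr τ ∘ χ := funext fun ω => hγD τ ω
      rwa [e1, e2]
    have hY : AEMeasurable (γD τ) P := by
      rw [show γD τ = fun ω => O.snr τ (χ ω) from funext fun ω => hγD τ ω]
      exact (hDmeas τ).comp_aemeasurable hχ.aemeasurable
    rw [hFeq, hFR, hFD]
    simp only [hγeq]
    exact measureReal_min_le hY hi γ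
  have hFR' : ∀ g : ℝ, 0 < g → FR g γ = R.cdfWith besselI g γ := by
    intro g hg
    rw [hFR]
    simp only [hγR]
    exact measureReal_snr_le_eq R hh hq h_indep hq_indep hg hγ.le
  have hFD' : ∀ τ : ℝ, 0 < τ →
      FD τ γ = lowerGamma O.rho (O.threshold τ γ) / Real.Gamma O.rho := by
    intro τ hτ
    rw [hFD]
    simp only [hγD]
    rw [hχ.measureReal_eq (p := fun x => O.snr τ x ≤ γ)
      (measurableSet_le (hDmeas τ) measurable_const), O.measureReal_snr_le_eq hτ hγ]
  have hclosedD : ∀ τ : ℝ, 0 < τ → ((FD τ γ : ℝ) : ℂ) = O.closedCDF τ γ := fun τ hτ => by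
    rw [hFD' τ hτ, O.cdf_eq_closedCDF hτ hγ]
  have hclosedR : ∀ p : ℕ, ∀ g : ℝ, 0 < g →
      ((R.cdfWith (besselApprox p) g γ : ℝ) : ℂ) = R.closedCDF p g γ := fun p g hg =>
    R.cdfWith_besselApprox_eq_closedCDF hg hγ
  have hclosed : ∀ p : ℕ, ∀ g τ : ℝ, 0 < g → 0 < τ →
      ((R.cdfWith (besselApprox p) g γ + FD τ γ - R.cdfWith (besselApprox p) g γ * FD τ γ : ℝ) : ℂ)
        = endToEndClosedCDF R O p g τ γ := by
    intro p g τ hg hτ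
    rw [endToEndClosedCDF, ← hclosedD τ hτ, ← hclosedR p g hg]
    push_cast
    ring
  refine ⟨fun g τ _ _ => hF g τ, hFR', hclosedD, fun p _ => hclosedR p, fun p _ => hclosed p,
    fun g τ hg hτ => ?_, fun p hp => ?_⟩
  · have h1 := R.tendsto_cdfWith_besselApprox hg hγ.le
    have h2 := (h1.add_const (FD τ γ)).sub (h1.mul_const (FD τ γ))
    rw [← hFR' g hg, ← hF g τ] at h2
    refine ((Complex.continuous_ofReal.tendsto _).comp h2).congr fun p => ?_
    exact hclosed p g τ hg hτ
  · have eI : (fun g => FR g γ) ~[atTop] fun g => R.asympCDF p g γ := by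
      refine EventuallyEq.trans_isEquivalent ?_
        ((R.isEquivalent_cdfWith_besselI hγ).trans (R.isEquivalent_asympCDF hp hγ).symm)
      filter_upwards [eventually_gt_atTop 0] with g hg using hFR' g hg
    have eA : (fun g => R.cdfWith (besselApprox p) g γ) ~[atTop] fun g => R.asympCDF p g γ :=
      (R.isEquivalent_cdfWith_besselApprox hp hγ).trans (R.isEquivalent_asympCDF hp hγ).symm
    have eD : (fun τ => FD τ γ) ~[atTop] fun τ => O.asympCDF τ γ := by
      refine EventuallyEq.trans_isEquivalent ?_
        ((O.isEquivalent_cdf hγ).trans (O.isEquivalent_asympCDF hγ).symm)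
      filter_upwards [eventually_gt_atTop 0] with τ hτ using hFD' τ hτ
    have pR : ∀ᶠ g in atTop, 0 < R.asympCDF p g γ := by
      refine (R.isEquivalent_asympCDF hp hγ).eventually_pos ?_
      filter_upwards [eventually_gt_atTop 0] with g hg
      exact mul_pos R.leadingCoeff_pos (Real.rpow_pos_of_pos (mul_pos (R.K₂_pos hg) hγ) _)
    have pD : ∀ᶠ τ in atTop, 0 < O.asympCDF τ γ := by
      refine (O.isEquivalent_asympCDF hγ).eventually_pos ?_
      filter_upwards [eventually_gt_atTop 0] with τ hτ
      exact mul_pos (one_div_pos.2 (Real.Gamma_pos_of_pos (by linarith [O.rho_pos])))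
        (Real.rpow_pos_of_pos (O.threshold_pos hτ hγ) _)
    have tR : Tendsto (fun g => R.asympCDF p g γ) atTop (𝓝 0) := by
      refine (R.isEquivalent_asympCDF hp hγ).symm.tendsto_nhds ?_
      have h1 := ((Real.continuous_rpow_const R.combined_pos.le).tendsto 0).comp
        (R.tendsto_K₂_mul γ)
      rw [Real.zero_rpow R.combined_pos.ne'] at h1
      simpa using h1.const_mul R.leadingCoeff
    -- Stated for any `f` equivalent to the RF asymptotics, so that it applies both to the exact CDF
    -- and to its approximation of order `p`.
    have joint : ∀ {f : ℝ → ℝ}, f ~[atTop] (fun g => R.asympCDF p g γ) →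
        (fun x : ℝ × ℝ => f x.1 + FD x.2 γ - f x.1 * FD x.2 γ) ~[atTop ×ˢ atTop]
          fun x => endToEndAsympCDF R O p x.1 x.2 γ := by
      intro f hf
      exact isEquivalent_add_sub_mul (tendsto_fst.eventually pR) (tendsto_snd.eventually pD)
        (hf.comp_tendsto tendsto_fst) (eD.comp_tendsto tendsto_snd)
        ((hf.symm.tendsto_nhds tR).comp tendsto_fst)
    refine ⟨eI, eA, eD, ?_, ?_⟩
    · simp only [hF]
      exact joint eI
    · have h1 := joint eA
      have h2 : (fun x : ℝ × ℝ => ((R.cdfWith (besselApprox p) x.1 γ + FD x.2 γ -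
          R.cdfWith (besselApprox p) x.1 γ * FD x.2 γ : ℝ) : ℂ)) ~[atTop ×ˢ atTop]
          fun x => ((endToEndAsympCDF R O p x.1 x.2 γ : ℝ) : ℂ) := by
        refine IsLittleO.isEquivalent ?_
        -- The embedding of the reals into the complex numbers preserves norms, so the real little-o
        -- relation carries over to the complex closed form.
        have h3 := Complex.isLittleO_ofReal_right.2 (Complex.isLittleO_ofReal_left.2 h1.isLittleO)
        refine h3.congr_left fun x => ?_
        simp only [Pi.sub_apply, Complex.ofReal_sub]
      refine EventuallyEq.trans_isEquivalent ?_ h2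
      filter_upwards [tendsto_fst.eventually (eventually_gt_atTop (0 : ℝ)),
        tendsto_snd.eventually (eventually_gt_atTop (0 : ℝ))] with x hx hy
      exact (hclosed p x.1 x.2 hx hy).symm
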